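/- **Setting.** Let $\theta,b\in\mathbb R$, $C>0$, $\varepsilon>0$, $n\ge 0$ and $0=t_0<t_1<\dots<t_n<t_{n+1}=T$. Let $U_1,\dots,U_n,Z_1,\dots,Z_n$ be independent random variables on a probability space, $U_i$ uniform on $[0,1]$ and $Z_i\sim\mathcal N(0,1)$. For $a\in\mathbb R$ let $\mathcal G(a)f(x)=(-\theta x+a)f'(x)+\tfrac12 b^2f''(x)$. For $s\in[0,T]$ and a probability measure $\mu$ on $\mathbb R$, an admissible controlled system on $[s,T]$ started from $\mu$ consists of a real control process $(\alpha_t)_{t\in[s,T]}$ with integrable paths and a process $(\mu_t)_{t\in[s,T]}$ of probability measures on $\mathbb R$ such that: * $\mu_s=\mu$, and on every time interval $[r,t]\subset[s,T]$ with no observation time in $(r,t]$ the equation $d\mu_q=\mathcal G(\alpha_q)^*\mu_q\,dq$ holds weakly, i.e. $\int f\,d\mu_t=\int f\,d\mu_r+\int_r^t\!\int \mathcal G(\alpha_q)f\,d\mu_q\,dq$ for all $f\in C_c^\infty(\mathbb R)$; * at each observation time $t_i$ with $1\le i\le n$ and $t_i>s$, the weak left limit $\mu_{t_i^-}$ exists,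 one observes $Y_i=\widehat X_i+\varepsilon Z_i$, where $\widehat X_i=F[\mu_{t_i^-}]^{-1}(U_i)$ and $F[\nu]^{-1}$ is the quantile function of $\nu$, and the law is updated by Bayes' rule $$\mu_{t_i}(dx)=\frac{\rho_\varepsilon(Y_i-x)}{\int\rho_\varepsilon(Y_i-x')\,\mu_{t_i^-}(dx')}\,\mu_{t_i^-}(dx),$$ with $\rho_\varepsilon$ the density of $\mathcal N(0,\varepsilon^2)$; * $\alpha$ is progressively measurable with respect to the filtration $\mathcal F_t=\sigma(Y_i: s<t_i\le t)$. The value function is $$V(s,\mu)=\inf\ \mathbb E\Big[\int_s^T\Big(\int x^2\mu_t(dx)+C\alpha_t^2\Big)dt+\int x^2\mu_T(dx)\Big],$$ the infimum being over all admissible controlled systems on $[s,T]$ started from $\mu$. For $t\in[0,T]$, $m\in\mathbb R$ and $z\ge0$ put $\widehat U(t,m,z)=V(t,\mathcal N(m,z))$, where $\mathcal N(m,0)=\delta_m$. **Lemma (HJB, controlled O-U case).** The function $\widehat U$ is finite and satisfies the following. 1. For $t_i\le t<t_{i+1}$, $i=0,\dots,n$, $m\in\mathbb R$ and $z\ge0$,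 the partial derivatives of $\widehat U$ at $(t,m,z)$ exist (as derivatives from the right in $t$ if $t=t_i$, and in $z$ if $z=0$), and $$\frac{\partial\widehat U}{\partial t}+z+m^2-\theta m\frac{\partial\widehat U}{\partial m}+(b^2-2\theta z)\frac{\partial\widehat U}{\partial z}-\frac1{4C}\Big[\frac{\partial\widehat U}{\partial m}\Big]^2=0 .$$ 2. For $i=1,\dots,n$, $m\in\mathbb R$ and $z\ge0$, the left limit $\widehat U(t_i^-,m,z)=\lim_{t\uparrow t_i}\widehat U(t,m,z)$ exists, and $$\widehat U(t_i^-,m,z)=\int_{\mathbb R}\widehat U\Big(t_i,\,m+\frac{z}{\sqrt{z+\varepsilon^2}}\,w,\,\frac{z\varepsilon^2}{z+\varepsilon^2}\Big)\phi(w)\,dw,$$ the integrand being integrable, where $\phi$ is the density of $\mathcal N(0,1)$. 3. For $m\in\mathbb R$ and $z\ge0$, $\widehat U(T,m,z)=m^2+z=\lim_{t\uparrow T}\widehat U(t,m,z)$. -/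

import Mathlib

open MeasureTheory ProbabilityTheory Filter Topology
open scoped ENNReal NNReal

/-- The controlled Ornstein-Uhlenbeck generator
`𝒢(a) f (x) = (-θ x + a) f'(x) + (b² / 2) f''(x)`. -/
noncomputable def ouGenerator (θ b a : ℝ) (f : ℝ → ℝ) (x : ℝ) : ℝ :=
  (-θ * x + a) * deriv f x + b ^ 2 / 2 * deriv (deriv f) x

/-- The likelihood `L_ε(x; y) = ρ_ε(y - x)`, with `ρ_ε` the density of `𝒩(0, ε²)`. -/
noncomputable def obsLikelihood (ε x y : ℝ) : ℝ :=
  gaussianPDFReal 0 (Real.toNNReal (ε ^ 2)) (y - x)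

/-- The Bayes kernel `K_ε(x; ν, y) = L_ε(x; y) / ∫ L_ε(x'; y) ν(dx')`. -/
noncomputable def bayesKernel (ε : ℝ) (x : ℝ) (ν : Measure ℝ) (y : ℝ) : ℝ :=
  obsLikelihood ε x y / ∫ x', obsLikelihood ε x' y ∂ν

/-- The Bayesian update `K_ε(x; ν, y) ν(dx)` of the prior `ν` given the observed value `y`. -/
noncomputable def bayesUpdate (ε : ℝ) (ν : Measure ℝ) (y : ℝ) : Measure ℝ :=
  ν.withDensity fun x => ENNReal.ofReal (bayesKernel ε x ν y)

/-- The generalized inverse (quantile function) of the c.d.f. of `ν`; the value is meaningful for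
`0 < u < 1`. -/
noncomputable def quantile (ν : Measure ℝ) (u : ℝ) : ℝ :=
  sInf {x : ℝ | u ≤ cdf ν x}

/-- The second moment `∫ x² ν(dx)`, with values in `[0, ∞]`. -/
noncomputable def secondMoment (ν : Measure ℝ) : ℝ≥0∞ :=
  ∫⁻ x, ENNReal.ofReal (x ^ 2) ∂ν

/-- The Gaussian law with mean `m` and variance `z ≥ 0` (the Dirac mass at `m` if `z = 0`). -/
noncomputable def gaussianLaw (m z : ℝ) : ProbabilityMeasure ℝ :=
  ⟨gaussianReal m z.toNNReal, inferInstance⟩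

/-- The data of the problem: the coefficients of the dynamics, the weight `C` of the control cost,
the noise level `ε` of the observations, the times `t_0, t_1, …, t_n, t_{n+1}` (the observation
times are `t_1, …, t_n`, while `t_0` is the initial time and `t_{n+1}` the horizon), and the random
variables that drive the observations. -/
structure OUModel (n : ℕ) (Ω : Type*) where
  θ : ℝ
  b : ℝ
  C : ℝ
  ε : ℝ
  time : Fin (n + 2) → ℝ
  U : Fin n → Ω → ℝ
  Z : Fin n → Ω → ℝ

namespace OUModel

variable {n : ℕ} {Ω : Type*}

/-- The time horizon `T = t_{n+1}`. -/
def horizon (M : OUModel n Ω) : ℝ := M.time (Fin.last (n + 1))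

/-- The observation times: `obsTime j` is `t_{j+1}` for `j = 0, …, n - 1`. -/
def obsTime (M : OUModel n Ω) (j : Fin n) : ℝ := M.time j.succ.castSucc

/-- The observation `Y_j = X̂_j + ε Z_j`, where `X̂_j = F[μ_{t_j^-}]⁻¹(U_j)` is sampled from the
conditional law `prior j = μ_{t_j^-}` just before the observation. -/
noncomputable def observation (M : OUModel n Ω) (prior : Fin n → Ω → ProbabilityMeasure ℝ)
    (j : Fin n) (ω : Ω) : ℝ :=
  quantile (prior j ω : Measure ℝ) (M.U j ω) + M.ε * M.Z j ω

/-- The `σ`-algebra generated by the observations made in the time interval `(s, t]`. -/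
noncomputable abbrev obsSigma (M : OUModel n Ω) (prior : Fin n → Ω → ProbabilityMeasure ℝ)
    (s t : ℝ) : MeasurableSpace Ω :=
  ⨆ j : Fin n, ⨆ _ : s < M.obsTime j ∧ M.obsTime j ≤ t,
    MeasurableSpace.comap (M.observation prior j) (borel ℝ)

/-- `α` is an admissible control on `[s, T]` and `μ` is the corresponding conditional law process
on `[s, T]` started from `μ₀` at time `s`, with `prior j` its value `μ_{t_j^-}` just before the
observation time `t_j > s`. -/
structure IsControlledPath (M : OUModel n Ω) (s : ℝ) (μ₀ : ProbabilityMeasure ℝ)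
    (α : ℝ → Ω → ℝ) (μ : ℝ → Ω → ProbabilityMeasure ℝ)
    (prior : Fin n → Ω → ProbabilityMeasure ℝ) : Prop where
  /-- The control is (progressively) adapted to the filtration of the observations. -/
  adapted : ∀ t ∈ Set.Icc s M.horizon,
    Measurable[MeasurableSpace.prod inferInstance (M.obsSigma prior s t)]
      fun p : Set.Icc s t × Ω => α p.1 p.2
  /-- The control is integrable in time, so that the controlled dynamics make sense. -/
  integrable : ∀ ω, IntegrableOn (fun t => α t ω) (Set.Icc s M.horizon)
  initial : ∀ ω, μ s ω = μ₀
  /-- Between observations, `dμ_t = 𝒢(α_t)* μ_t dt` holds in the weak sense. -/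
  fokkerPlanck : ∀ ω, ∀ f : ℝ → ℝ, ContDiff ℝ (⊤ : ℕ∞) f → HasCompactSupport f →
    ∀ r t, s ≤ r → r ≤ t → t ≤ M.horizon → (∀ j, M.obsTime j ∉ Set.Ioc r t) →
      IntervalIntegrable (fun q => ∫ x, ouGenerator M.θ M.b (α q ω) f x ∂(μ q ω : Measure ℝ))
        volume r t ∧
      ∫ x, f x ∂(μ t ω : Measure ℝ) = ∫ x, f x ∂(μ r ω : Measure ℝ) +
        ∫ q in r..t, ∫ x, ouGenerator M.θ M.b (α q ω) f x ∂(μ q ω : Measure ℝ)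
  /-- `prior j` is the left limit of `μ` at the observation time (for weak convergence). -/
  leftLimit : ∀ ω j, s < M.obsTime j →
    Tendsto (fun t => μ t ω) (𝓝[<] M.obsTime j) (𝓝 (prior j ω))
  /-- At an observation time the law is updated by Bayes' rule. -/
  update : ∀ ω j, s < M.obsTime j →
    (μ (M.obsTime j) ω : Measure ℝ) =
      bayesUpdate M.ε (prior j ω : Measure ℝ) (M.observation prior j ω)

/-- The cost on `[s, T]`,
`𝔼 [∫_s^T (∫ x² μ_t(dx) + C α_t²) dt + ∫ x² μ_T(dx)]`, with values in `[0, ∞]`. -/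
noncomputable def cost [MeasurableSpace Ω] (M : OUModel n Ω) (P : Measure Ω) (s : ℝ)
    (α : ℝ → Ω → ℝ) (μ : ℝ → Ω → ProbabilityMeasure ℝ) : ℝ≥0∞ :=
  ∫⁻ ω, ((∫⁻ t in Set.Icc s M.horizon,
      (secondMoment (μ t ω : Measure ℝ) + ENNReal.ofReal (M.C * α t ω ^ 2))) +
    secondMoment (μ M.horizon ω : Measure ℝ)) ∂P

/-- The value function `V(s, μ₀)`: the infimum of the cost over all admissible controls on
`[s, T]`, the conditional law being `μ₀` at time `s`. -/
noncomputable def value [MeasurableSpace Ω] (M : OUModel n Ω) (P : Measure Ω) (s : ℝ)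
    (μ₀ : ProbabilityMeasure ℝ) : ℝ≥0∞ :=
  ⨅ (α : ℝ → Ω → ℝ) (μ : ℝ → Ω → ProbabilityMeasure ℝ)
    (prior : Fin n → Ω → ProbabilityMeasure ℝ) (_ : M.IsControlledPath s μ₀ α μ prior),
    M.cost P s α μ

/-- The value function at Gaussian laws, as a function `Û(t, m, z)` of time, mean and variance. -/
noncomputable def gaussValue [MeasurableSpace Ω] (M : OUModel n Ω) (P : Measure Ω)
    (t m z : ℝ) : ℝ :=
  (M.value P t (gaussianLaw m z)).toReal

end OUModel

/-! The problem is linear, quadratic and Gaussian, so the value has a closed form, `gaussCost`, and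
all assertions are read off from it. Started from a Gaussian law, every admissible law stays
Gaussian. The control moves only the mean, by m' = -θm + α. The variance solves z' = b² - 2θz
between observations and jumps to zε²/(z + ε²) at each of them, whatever the control and the
observed value; its cost is therefore deterministic. At an observation the mean moves by κ = z/(z +
ε²) times the innovation, which is almost surely a 𝒩(0, z + ε²) variable independent of the past;
this adds z²/(z + ε²) to the expected squared mean. Hence the value is p(T - t)m² plus a function of
(t, z), where p solves a Riccati equation.

For the lower bound, completing the square (`riccati_sq_sub`, `ofReal_cost_eq`) writes the cost on
an interval without observations as the candidate value plus C∫(α + pm/C)². Averaging over the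
innovation (`lintegral_posterior`) joins consecutive intervals, and
`IsControlledPath.exists_gaussianLaw` iterates this over the observations. Equality holds for the
feedback α = -pm/C, which is realised explicitly and shown admissible in `isControlledPath_opt`.

The delicate point is that the infimum runs over all weak solutions of the Fokker-Planck equation
with a merely integrable control, so these must be shown to be Gaussian
(`SolvesFokkerPlanck.eq_gaussianLaw`). The coordinate e^{θ(q-r)}x removes the drift -θx, the
equation extends from compactly supported functions to cosines and sines, and the characteristic
function then solves a scalar linear equation (`SolvesFokkerPlanck.charFun_eq`). Differentiation in
time is not available for these arguments; product rules are replaced by `eq_of_norm_sub_le_sq`,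
which makes a function constant once its increments are quadratically small in a suitable clock.

The differential equation splits into the Riccati equation, for the terms in m, and a transport
equation along the variance flow (`varCost_transport`). The jump condition is the Gaussian average
of a quadratic polynomial (`integral_gaussCost`). -/

/-! ### The variance of the uncontrolled dynamics -/

/-- The integrated discount `∫_0^h e^{-2θr} dr`. -/
noncomputable def discountIntegral (θ h : ℝ) : ℝ := ∫ r in (0 : ℝ)..h, Real.exp (-2 * θ * r)

/-- The variance at time `h` of the Ornstein-Uhlenbeck dynamics started with variance `z`. -/
noncomputable def ouVar (θ b h z : ℝ) : ℝ :=
  Real.exp (-2 * θ * h) * z + b ^ 2 * discountIntegral θ h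

lemma hasDerivAt_discountIntegral (θ h : ℝ) :
    HasDerivAt (discountIntegral θ) (Real.exp (-2 * θ * h)) h := by
  have hc : Continuous fun r : ℝ => Real.exp (-2 * θ * r) := by fun_prop
  exact intervalIntegral.integral_hasDerivAt_right (hc.intervalIntegrable _ _)
    hc.stronglyMeasurable.stronglyMeasurableAtFilter hc.continuousAt

/-- Replaces the closed form (1 - e^{-2θh})/(2θ) of the integral, which would exclude θ = 0. -/
lemma exp_eq_one_sub_discountIntegral (θ h : ℝ) :
    Real.exp (-2 * θ * h) = 1 - 2 * θ * discountIntegral θ h := by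
  have key : ∀ x, HasDerivAt (fun x => Real.exp (-2 * θ * x) + 2 * θ * discountIntegral θ x) 0 x := by
    intro x
    have h1 : HasDerivAt (fun x : ℝ => -2 * θ * x) (-2 * θ) x := by
      simpa using (hasDerivAt_id x).const_mul (-2 * θ)
    refine HasDerivAt.congr_deriv (h1.exp.add ((hasDerivAt_discountIntegral θ x).const_mul (2 * θ))) ?_
    ring
  have h2 := is_const_of_deriv_eq_zero (fun x => (key x).differentiableAt)
    (fun x => (key x).deriv) h 0
  have h0 : discountIntegral θ 0 = 0 := by simp [discountIntegral]
  simp only [h0, mul_zero, Real.exp_zero, add_zero] at h2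
  linarith

lemma discountIntegral_pos (θ : ℝ) {h : ℝ} (hh : 0 < h) : 0 < discountIntegral θ h := by
  have hc : Continuous fun r : ℝ => Real.exp (-2 * θ * r) := by fun_prop
  exact intervalIntegral.intervalIntegral_pos_of_pos (hc.intervalIntegrable _ _)
    (fun x => Real.exp_pos _) hh

lemma discountIntegral_nonneg (θ : ℝ) {h : ℝ} (hh : 0 ≤ h) : 0 ≤ discountIntegral θ h := by
  rcases hh.eq_or_lt with rfl | h1
  · simp [discountIntegral]
  · exact (discountIntegral_pos θ h1).le

lemma ouVar_zero (θ b z : ℝ) : ouVar θ b 0 z = z := by simp [ouVar, discountIntegral]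

lemma ouVar_nonneg (θ b : ℝ) {h z : ℝ} (hh : 0 ≤ h) (hz : 0 ≤ z) : 0 ≤ ouVar θ b h z := by
  have := discountIntegral_nonneg θ hh
  unfold ouVar; positivity

/-- Serves to differentiate the standard deviation: at positive times either the variance is
positive and the square root is smooth there, or there is no noise at all and the deviation is
constantly zero. -/
lemma ouVar_pos_or (θ b : ℝ) {z : ℝ} (hz : 0 ≤ z) :
    (∀ h, 0 < h → 0 < ouVar θ b h z) ∨ (b = 0 ∧ ∀ h, ouVar θ b h z = 0) := by
  rcases hz.eq_or_lt with rfl | hz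
  · rcases eq_or_ne b 0 with rfl | hb
    · right; simp [ouVar]
    · left; intro h hh
      have := discountIntegral_pos θ hh
      unfold ouVar; positivity
  · left; intro h hh
    have := discountIntegral_pos θ hh
    unfold ouVar; positivity

lemma hasDerivAt_ouVar (θ b h z : ℝ) :
    HasDerivAt (fun h => ouVar θ b h z) (b ^ 2 - 2 * θ * ouVar θ b h z) h := by
  have h1 : HasDerivAt (fun x : ℝ => -2 * θ * x) (-2 * θ) h := by
    simpa using (hasDerivAt_id h).const_mul (-2 * θ)
  refine HasDerivAt.congr_deriv ((h1.exp.mul_const z).add ((hasDerivAt_discountIntegral θ h).const_mul (b ^ 2))) ?_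
  unfold ouVar
  linear_combination (b ^ 2) * exp_eq_one_sub_discountIntegral θ h

lemma continuous_ouVar_left (θ b z : ℝ) : Continuous fun h => ouVar θ b h z :=
  continuous_iff_continuousAt.2 fun h => (hasDerivAt_ouVar θ b h z).continuousAt

/-- The velocity of a flow at time h is its linearisation applied to the initial velocity. This is
what turns a time derivative of `varCost` into a z-derivative. -/
lemma deriv_ouVar_eq (θ b h z : ℝ) :
    b ^ 2 - 2 * θ * ouVar θ b h z = Real.exp (-2 * θ * h) * (b ^ 2 - 2 * θ * z) := by
  unfold ouVar
  linear_combination (-b ^ 2) * exp_eq_one_sub_discountIntegral θ h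

lemma hasDerivAt_ouVar_right (θ b h z : ℝ) :
    HasDerivAt (fun z => ouVar θ b h z) (Real.exp (-2 * θ * h)) z := by
  simpa [ouVar] using ((hasDerivAt_id z).const_mul (Real.exp (-2 * θ * h))).add_const
    (b ^ 2 * discountIntegral θ h)

/-! ### The cost-to-go due to the variance, on a time interval without observations -/

/-- The cost `∫_0^h v_r dr + g(v_h)` along the variance dynamics `v` started from `z`. -/
noncomputable def varCost (θ b : ℝ) (g : ℝ → ℝ) (h z : ℝ) : ℝ :=
  (∫ r in (0 : ℝ)..h, ouVar θ b r z) + g (ouVar θ b h z)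

lemma varCost_zero (θ b : ℝ) (g : ℝ → ℝ) (z : ℝ) : varCost θ b g 0 z = g z := by
  simp [varCost, ouVar_zero]

lemma varCost_nonneg (θ b : ℝ) {g : ℝ → ℝ} (hg : ∀ z, 0 ≤ z → 0 ≤ g z) {h z : ℝ} (hh : 0 ≤ h)
    (hz : 0 ≤ z) : 0 ≤ varCost θ b g h z := by
  refine add_nonneg (intervalIntegral.integral_nonneg hh fun r hr => ?_)
    (hg _ (ouVar_nonneg θ b hh hz))
  exact ouVar_nonneg θ b hr.1 hz

lemma continuous_discountIntegral (θ : ℝ) : Continuous (discountIntegral θ) :=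
  continuous_iff_continuousAt.2 fun h => (hasDerivAt_discountIntegral θ h).continuousAt

lemma integral_ouVar (θ b h z : ℝ) : ∫ r in (0 : ℝ)..h, ouVar θ b r z =
    discountIntegral θ h * z + b ^ 2 * ∫ r in (0 : ℝ)..h, discountIntegral θ r := by
  unfold ouVar
  have hc : Continuous fun r : ℝ => Real.exp (-2 * θ * r) * z := by fun_prop
  rw [intervalIntegral.integral_add (hc.intervalIntegrable _ _)
    (((continuous_discountIntegral θ).const_mul _).intervalIntegrable _ _),
    intervalIntegral.integral_mul_const, intervalIntegral.integral_const_mul]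
  rfl

/-- Derivatives are taken within [0, ∞) because the terminal cost g is controlled only at
nonnegative variances; the chain rule survives since the variance flow preserves that half-line. -/
lemma hasDerivWithinAt_varCost_right (θ b : ℝ) {g : ℝ → ℝ} {g' h z : ℝ} (hh : 0 ≤ h)
    (hg : HasDerivWithinAt g g' (Set.Ici 0) (ouVar θ b h z)) :
    HasDerivWithinAt (varCost θ b g h)
      (discountIntegral θ h + g' * Real.exp (-2 * θ * h)) (Set.Ici 0) z := by
  have h1 : HasDerivWithinAt (fun z => ∫ r in (0 : ℝ)..h, ouVar θ b r z)
      (discountIntegral θ h) (Set.Ici 0) z := by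
    simp_rw [integral_ouVar]
    simpa using (((hasDerivAt_id z).const_mul (discountIntegral θ h)).add_const
      (b ^ 2 * ∫ r in (0 : ℝ)..h, discountIntegral θ r)).hasDerivWithinAt
  exact h1.add (hg.comp z (hasDerivAt_ouVar_right θ b h z).hasDerivWithinAt
    fun y hy => ouVar_nonneg θ b hh hy)

lemma hasDerivWithinAt_varCost_time (θ b : ℝ) {g : ℝ → ℝ} {g' h z : ℝ} (hz : 0 ≤ z)
    (hg : HasDerivWithinAt g g' (Set.Ici 0) (ouVar θ b h z)) :
    HasDerivWithinAt (fun h => varCost θ b g h z)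
      (ouVar θ b h z + g' * (b ^ 2 - 2 * θ * ouVar θ b h z)) (Set.Ici 0) h := by
  have hc := continuous_ouVar_left θ b z
  have h1 : HasDerivAt (fun h => ∫ r in (0 : ℝ)..h, ouVar θ b r z) (ouVar θ b h z) h :=
    intervalIntegral.integral_hasDerivAt_right (hc.intervalIntegrable _ _)
      hc.stronglyMeasurable.stronglyMeasurableAtFilter hc.continuousAt
  exact h1.hasDerivWithinAt.add (hg.comp h (hasDerivAt_ouVar θ b h z).hasDerivWithinAt
    fun y hy => ouVar_nonneg θ b hy hz)

/-- The transport equation solved by `varCost`, in terms of its partial derivatives. -/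
lemma varCost_transport (θ b g' h z : ℝ) :
    ouVar θ b h z + g' * (b ^ 2 - 2 * θ * ouVar θ b h z) =
      z + (b ^ 2 - 2 * θ * z) * (discountIntegral θ h + g' * Real.exp (-2 * θ * h)) := by
  rw [deriv_ouVar_eq]
  unfold ouVar
  linear_combination z * exp_eq_one_sub_discountIntegral θ h

/-! ### The Riccati equation -/

/-- The rate `√(θ² + 1/C)` in the solution of the Riccati equation. -/
noncomputable def riccatiRate (θ C : ℝ) : ℝ := √(θ ^ 2 + 1 / C)

/-- The numerator of the solution of the Riccati equation. -/
noncomputable def riccatiNum (θ C h : ℝ) : ℝ :=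
  Real.cosh (riccatiRate θ C * h) + (1 - θ) / riccatiRate θ C * Real.sinh (riccatiRate θ C * h)

/-- The denominator of the solution of the Riccati equation. -/
noncomputable def riccatiDen (θ C h : ℝ) : ℝ :=
  Real.cosh (riccatiRate θ C * h) +
    (θ + 1 / C) / riccatiRate θ C * Real.sinh (riccatiRate θ C * h)

/-- The solution of the Riccati equation `p' = 1 - 2θp - p²/C`, `p(0) = 1`. -/
noncomputable def riccati (θ C h : ℝ) : ℝ := riccatiNum θ C h / riccatiDen θ C h

lemma riccatiRate_sq (θ : ℝ) {C : ℝ} (hC : 0 < C) : riccatiRate θ C ^ 2 = θ ^ 2 + 1 / C :=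
  Real.sq_sqrt (by positivity)

lemma abs_lt_riccatiRate (θ : ℝ) {C : ℝ} (hC : 0 < C) : |θ| < riccatiRate θ C := by
  refine Real.lt_sqrt_of_sq_lt ?_
  rw [sq_abs]
  have : 0 < 1 / C := by positivity
  linarith

lemma riccatiRate_pos (θ : ℝ) {C : ℝ} (hC : 0 < C) : 0 < riccatiRate θ C :=
  (abs_nonneg θ).trans_lt (abs_lt_riccatiRate θ hC)

/-- The expression equals e^{-x} + (1 + c) sinh x. Applied to `riccatiNum` and `riccatiDen`, it
excludes blow-up of the Riccati solution at every positive time. -/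
lemma cosh_add_mul_sinh_pos {c x : ℝ} (hc : -1 < c) (hx : 0 ≤ x) :
    0 < Real.cosh x + c * Real.sinh x := by
  have h1 : 0 ≤ Real.sinh x := Real.sinh_nonneg_iff.2 hx
  have h2 := Real.cosh_sub_sinh x
  have h3 := Real.exp_pos (-x)
  nlinarith

lemma riccatiNum_pos (θ : ℝ) {C h : ℝ} (hC : 0 < C) (hh : 0 ≤ h) : 0 < riccatiNum θ C h := by
  have hk := riccatiRate_pos θ hC
  refine cosh_add_mul_sinh_pos ?_ (mul_nonneg hk.le hh)
  rw [lt_div_iff₀ hk]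
  have := (le_abs_self θ).trans_lt (abs_lt_riccatiRate θ hC)
  linarith

lemma riccatiDen_pos (θ : ℝ) {C h : ℝ} (hC : 0 < C) (hh : 0 ≤ h) : 0 < riccatiDen θ C h := by
  have hk := riccatiRate_pos θ hC
  refine cosh_add_mul_sinh_pos ?_ (mul_nonneg hk.le hh)
  rw [lt_div_iff₀ hk]
  have := (neg_le_abs θ).trans_lt (abs_lt_riccatiRate θ hC)
  have : 0 < 1 / C := by positivity
  linarith

lemma hasDerivAt_cosh_add_sinh (k c h : ℝ) :
    HasDerivAt (fun h => Real.cosh (k * h) + c * Real.sinh (k * h))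
      (k * Real.sinh (k * h) + c * k * Real.cosh (k * h)) h := by
  have h1 : HasDerivAt (fun x : ℝ => k * x) k h := by
    simpa using (hasDerivAt_id h).const_mul k
  refine HasDerivAt.congr_deriv (h1.cosh.add (h1.sinh.const_mul c)) ?_
  ring

/-- Numerator and denominator solve a linear system whose quotient solves the Riccati equation. In
reversed time this equation also says that `riccatiDen` is a mean trajectory under the control
-`riccatiNum`/C, which later gives the optimal path in closed form. -/
lemma hasDerivAt_riccatiDen (θ : ℝ) {C : ℝ} (hC : 0 < C) (h : ℝ) :
    HasDerivAt (riccatiDen θ C) (θ * riccatiDen θ C h + riccatiNum θ C h / C) h := by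
  have hk := riccatiRate_pos θ hC
  have hk2 := riccatiRate_sq θ hC
  refine HasDerivAt.congr_deriv (hasDerivAt_cosh_add_sinh (riccatiRate θ C) ((θ + 1 / C) / riccatiRate θ C) h) ?_
  unfold riccatiDen riccatiNum
  field_simp
  field_simp at hk2
  linear_combination (Real.sinh (riccatiRate θ C * h)) * hk2

lemma hasDerivAt_riccatiNum (θ : ℝ) {C : ℝ} (hC : 0 < C) (h : ℝ) :
    HasDerivAt (riccatiNum θ C) (riccatiDen θ C h - θ * riccatiNum θ C h) h := by
  have hk := riccatiRate_pos θ hC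
  have hk2 := riccatiRate_sq θ hC
  refine HasDerivAt.congr_deriv (hasDerivAt_cosh_add_sinh (riccatiRate θ C) ((1 - θ) / riccatiRate θ C) h) ?_
  unfold riccatiDen riccatiNum
  field_simp
  field_simp at hk2
  linear_combination (Real.sinh (riccatiRate θ C * h)) * hk2

lemma hasDerivAt_riccati (θ : ℝ) {C h : ℝ} (hC : 0 < C) (hh : 0 ≤ h) :
    HasDerivAt (riccati θ C) (1 - 2 * θ * riccati θ C h - riccati θ C h ^ 2 / C) h := by
  have hD := riccatiDen_pos θ hC hh
  refine HasDerivAt.congr_deriv ((hasDerivAt_riccatiNum θ hC h).div (hasDerivAt_riccatiDen θ hC h) hD.ne') ?_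
  unfold riccati
  field_simp
  ring

lemma riccati_zero (θ C : ℝ) : riccati θ C 0 = 1 := by
  simp [riccati, riccatiNum, riccatiDen]

lemma riccati_pos (θ : ℝ) {C h : ℝ} (hC : 0 < C) (hh : 0 ≤ h) : 0 < riccati θ C h :=
  div_pos (riccatiNum_pos θ hC hh) (riccatiDen_pos θ hC hh)

/-! ### Functions with increments of second order -/

/-- A function whose increments are of second order with respect to a continuous monotone function
is constant. -/
lemma eq_of_norm_sub_le_sq {E : Type*} [NormedAddCommGroup E] {D : ℝ → E} {S : ℝ → ℝ} {K r t : ℝ}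
    (hrt : r ≤ t) (hS : ContinuousOn S (Set.Icc r t))
    (h : ∀ x y, r ≤ x → x ≤ y → y ≤ t → S x ≤ S y ∧ ‖D y - D x‖ ≤ K * (S y - S x) ^ 2) :
    D t = D r := by
  -- Split at the point where S takes the midpoint value: each half contributes a quarter of the
  -- square, so one bisection halves the bound, and N bisections divide it by 2^N.
  have key : ∀ N : ℕ, ∀ x y, r ≤ x → x ≤ y → y ≤ t →
      ‖D y - D x‖ ≤ K * (S y - S x) ^ 2 / 2 ^ N := by
    intro N
    induction N with
    | zero => intro x y hx hxy hy; simpa using (h x y hx hxy hy).2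
    | succ N ih =>
      intro x y hx hxy hy
      have hm := (h x y hx hxy hy).1
      obtain ⟨z, hz, hSz⟩ := intermediate_value_Icc hxy
        (hS.mono (Set.Icc_subset_Icc hx hy)) (show (S x + S y) / 2 ∈ Set.Icc (S x) (S y) from
          ⟨by linarith, by linarith⟩)
      have h1 := ih x z hx hz.1 (hz.2.trans hy)
      have h2 := ih z y (hx.trans hz.1) hz.2 hy
      have h3 : ‖D y - D x‖ ≤ ‖D y - D z‖ + ‖D z - D x‖ := norm_sub_le_norm_sub_add_norm_sub _ _ _
      rw [hSz] at h1 h2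
      refine h3.trans ((add_le_add h2 h1).trans (le_of_eq ?_))
      rw [pow_succ]
      field_simp
      ring
  have hlim : Tendsto (fun N : ℕ => K * (S t - S r) ^ 2 / 2 ^ N) atTop (𝓝 0) := by
    have := (tendsto_pow_atTop_nhds_zero_of_lt_one (r := (1 / 2 : ℝ)) (by norm_num)
      (by norm_num)).const_mul (K * (S t - S r) ^ 2)
    rw [mul_zero] at this
    refine this.congr fun N => ?_
    rw [one_div, inv_pow, div_eq_mul_inv]
  have h0 : ‖D t - D r‖ ≤ 0 := ge_of_tendsto' hlim fun N => key N r t le_rfl hrt le_rfl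
  exact sub_eq_zero.1 (norm_le_zero_iff.1 h0)

/-- Increments of a primitive. -/
lemma integral_sub_integral_of_mem {E : Type*} [NormedAddCommGroup E] [NormedSpace ℝ E]
    {k : ℝ → E} {r t x y : ℝ} (hk : IntervalIntegrable k volume r t)
    (hx : r ≤ x) (hxy : x ≤ y) (hy : y ≤ t) :
    (∫ w in r..y, k w) - ∫ w in r..x, k w = ∫ w in x..y, k w := by
  refine intervalIntegral.integral_interval_sub_left ?_ ?_ <;>
  refine hk.mono_set ?_ <;>
  rw [Set.uIcc_of_le (by linarith), Set.uIcc_of_le (by linarith)] <;>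
  exact Set.Icc_subset_Icc le_rfl (by linarith)

lemma IntervalIntegrable.mono_Icc {E : Type*} [NormedAddCommGroup E]
    {k : ℝ → E} {r t x y : ℝ} (hk : IntervalIntegrable k volume r t)
    (hx : r ≤ x) (hxy : x ≤ y) (hy : y ≤ t) : IntervalIntegrable k volume x y := by
  refine hk.mono_set ?_
  rw [Set.uIcc_of_le (by linarith), Set.uIcc_of_le (by linarith)]
  exact Set.Icc_subset_Icc hx hy

lemma continuousOn_primitive_Icc {E : Type*} [NormedAddCommGroup E] [NormedSpace ℝ E]
    {k : ℝ → E} {r t : ℝ} (hrt : r ≤ t) (hk : IntervalIntegrable k volume r t) :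
    ContinuousOn (fun x => ∫ w in r..x, k w) (Set.Icc r t) := by
  have := intervalIntegral.continuousOn_primitive_interval (f := k) (μ := volume) (a := r) (b := t)
    (by rw [Set.uIcc_of_le hrt]; exact (intervalIntegrable_iff_integrableOn_Icc_of_le hrt).1 hk)
  rwa [Set.uIcc_of_le hrt] at this

/-- A linear equation with an integrable coefficient. -/
lemma eq_mul_exp_of_integral_eq {Y k : ℝ → ℂ} {r t : ℝ} (hrt : r ≤ t)
    (hk : IntervalIntegrable k volume r t) (hYc : ContinuousOn Y (Set.Icc r t))
    (hY : ∀ x y, r ≤ x → x ≤ y → y ≤ t → Y y = Y x + ∫ w in x..y, k w * Y w) :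
    Y t = Y r * Complex.exp (∫ w in r..t, k w) := by
  obtain ⟨M, hM⟩ := isCompact_Icc.exists_bound_of_continuousOn hYc
  have hM0 : 0 ≤ M := (norm_nonneg _).trans (hM r ⟨le_rfl, hrt⟩)
  set S : ℝ → ℝ := fun x => ∫ w in r..x, ‖k w‖ with hSdef
  have hSc : ContinuousOn S (Set.Icc r t) := continuousOn_primitive_Icc hrt hk.norm
  have hSm : ∀ x y, r ≤ x → x ≤ y → y ≤ t → S y - S x = ∫ w in x..y, ‖k w‖ :=
    fun x y hx hxy hy => integral_sub_integral_of_mem hk.norm hx hxy hy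
  have hS0 : ∀ x y, r ≤ x → x ≤ y → y ≤ t → 0 ≤ S y - S x := fun x y hx hxy hy => by
    rw [hSm x y hx hxy hy]
    exact intervalIntegral.integral_nonneg hxy fun _ _ => norm_nonneg _
  have hkS : ∀ x y, r ≤ x → x ≤ y → y ≤ t → ‖∫ w in x..y, k w‖ ≤ S y - S x :=
    fun x y hx hxy hy => by
    rw [hSm x y hx hxy hy]
    exact intervalIntegral.norm_integral_le_integral_norm hxy
  have hYk : IntervalIntegrable (fun w => k w * Y w) volume r t := by
    refine hk.mul_continuousOn ?_
    rwa [Set.uIcc_of_le hrt]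
  have hYS : ∀ x y, r ≤ x → x ≤ y → y ≤ t → ‖Y y - Y x‖ ≤ M * (S y - S x) :=
    fun x y hx hxy hy => by
    rw [hY x y hx hxy hy, add_sub_cancel_left, hSm x y hx hxy hy,
      ← intervalIntegral.integral_const_mul]
    refine intervalIntegral.norm_integral_le_of_norm_le hxy ?_
      ((hk.norm.const_mul M).mono_Icc hx hxy hy)
    refine Eventually.of_forall fun w hw => ?_
    rw [norm_mul, mul_comm]
    exact mul_le_mul_of_nonneg_right (hM w ⟨hx.trans hw.1.le, hw.2.trans hy⟩) (norm_nonneg _)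
  -- The usual integrating factor. Since k is only integrable, D is shown to be constant through its
  -- increments, measured in the clock S = ∫‖k‖.
  set D : ℝ → ℂ := fun x => Y x * Complex.exp (-∫ w in r..x, k w) with hD
  have hconst : D t = D r := by
    refine eq_of_norm_sub_le_sq (K := Real.exp (S t) * (M * Real.exp (S t) + M)) hrt hSc ?_
    intro x y hx hxy hy
    have hΔ0 := hS0 x y hx hxy hy
    refine ⟨by linarith, ?_⟩
    have hSr : S r = 0 := by simp [hSdef]
    have hSx : 0 ≤ S x := by have := hS0 r x le_rfl hx (hxy.trans hy); rwa [hSr, sub_zero] at this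
    have hyt := hS0 y t (hx.trans hxy) hy le_rfl
    set κ := ∫ w in x..y, k w with hκ
    have hκ1 : ‖κ‖ ≤ S y - S x := hkS x y hx hxy hy
    have hsplit : ∫ w in r..y, k w = (∫ w in r..x, k w) + κ := by
      rw [hκ, ← integral_sub_integral_of_mem hk hx hxy hy]; ring
    have hint : Y y - Y x - κ * Y y = ∫ w in x..y, k w * (Y w - Y y) := by
      simp_rw [mul_sub]
      rw [intervalIntegral.integral_sub (hYk.mono_Icc hx hxy hy)
        ((hk.mono_Icc hx hxy hy).mul_const _), intervalIntegral.integral_mul_const]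
      rw [hY x y hx hxy hy]
      ring
    have hint' : ‖Y y - Y x - κ * Y y‖ ≤ M * (S y - S x) ^ 2 := by
      rw [hint, pow_two, ← mul_assoc, hSm x y hx hxy hy, ← intervalIntegral.integral_const_mul]
      refine intervalIntegral.norm_integral_le_of_norm_le hxy ?_
        ((hk.norm.const_mul _).mono_Icc hx hxy hy)
      refine Eventually.of_forall fun w hw => ?_
      rw [norm_mul, mul_comm, norm_sub_rev]
      refine mul_le_mul_of_nonneg_right ?_ (norm_nonneg _)
      refine (hYS w y (hx.trans hw.1.le) hw.2 hy).trans ?_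
      rw [← hSm x y hx hxy hy]
      have := hS0 x w hx hw.1.le (hw.2.trans hy)
      exact mul_le_mul_of_nonneg_left (by linarith) hM0
    have hexp : ‖Complex.exp (-κ) - 1 + κ‖ ≤ Real.exp (S t) * (S y - S x) ^ 2 := by
      have := Complex.norm_exp_sub_sum_le_norm_mul_exp (-κ) 2
      rw [Finset.sum_range_succ, Finset.sum_range_one] at this
      simp only [pow_zero, Nat.factorial_zero, Nat.cast_one, div_one, pow_one, Nat.factorial_one,
        norm_neg] at this
      rw [show Complex.exp (-κ) - 1 + κ = Complex.exp (-κ) - (1 + -κ) by ring]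
      refine this.trans ?_
      rw [mul_comm]
      refine mul_le_mul (Real.exp_le_exp.2 (by linarith)) ?_ (by positivity) (Real.exp_pos _).le
      exact pow_le_pow_left₀ (norm_nonneg _) hκ1 2
    -- The first order terms cancel. What is left is the second order remainder of the exponential
    -- and ∫ k(w)(Y w - Y y) dw, both quadratic in the increment of S.
    have hDD : D y - D x = Complex.exp (-∫ w in r..x, k w) *
        (Y y * (Complex.exp (-κ) - 1 + κ) + (Y y - Y x - κ * Y y)) := by
      simp only [hD, hsplit, neg_add, Complex.exp_add]
      ring
    rw [hDD, norm_mul, mul_assoc]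
    refine mul_le_mul ?_ ?_ (norm_nonneg _) (Real.exp_pos _).le
    · rw [Complex.norm_exp, Complex.neg_re]
      refine Real.exp_le_exp.2 ?_
      have h1 := hkS r x le_rfl hx (hxy.trans hy)
      have h2 := (neg_le_abs _).trans ((Complex.abs_re_le_norm (∫ w in r..x, k w)))
      linarith
    · refine (norm_add_le _ _).trans ?_
      rw [norm_mul, add_mul, mul_assoc]
      exact add_le_add (mul_le_mul (hM y ⟨hx.trans hxy, hy⟩) hexp (norm_nonneg _) hM0) hint'
  simp only [hD, intervalIntegral.integral_same, neg_zero, Complex.exp_zero, mul_one] at hconst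
  rw [← hconst, mul_assoc, ← Complex.exp_add]
  simp

/-! ### Test functions -/

/-- Smooth functions with compact support. -/
structure IsTest (f : ℝ → ℝ) : Prop where
  smooth : ContDiff ℝ (⊤ : ℕ∞) f
  support : HasCompactSupport f

namespace IsTest

variable {f g : ℝ → ℝ}

lemma deriv (hf : IsTest f) : IsTest (deriv f) :=
  ⟨(contDiff_infty_iff_deriv.1 hf.smooth).2, hf.support.deriv⟩

lemma differentiable (hf : IsTest f) : Differentiable ℝ f :=
  hf.smooth.differentiable (by simp)

lemma hasDerivAt (hf : IsTest f) (x : ℝ) : HasDerivAt f (_root_.deriv f x) x :=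
  (hf.differentiable x).hasDerivAt

lemma continuous (hf : IsTest f) : Continuous f := hf.smooth.continuous

lemma id_mul (hf : IsTest f) : IsTest fun x => x * f x :=
  ⟨contDiff_id.mul hf.smooth, hf.support.mul_left⟩

lemma const_mul (hf : IsTest f) (c : ℝ) : IsTest fun x => c * f x :=
  ⟨contDiff_const.mul hf.smooth, hf.support.mul_left⟩

lemma add (hf : IsTest f) (hg : IsTest g) : IsTest fun x => f x + g x :=
  ⟨hf.smooth.add hg.smooth, hf.support.add hg.support⟩

lemma comp_mul (hf : IsTest f) {c : ℝ} (hc : c ≠ 0) : IsTest fun x => f (c * x) :=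
  ⟨hf.smooth.comp (contDiff_const.mul contDiff_id),
    hf.support.comp_homeomorph (Homeomorph.mulLeft₀ c hc)⟩

lemma bounded (hf : IsTest f) : ∃ K, 0 ≤ K ∧ ∀ x, |f x| ≤ K := by
  obtain ⟨K, hK⟩ := hf.continuous.bounded_above_of_compact_support hf.support
  exact ⟨K, (norm_nonneg _).trans (hK 0), hK⟩

lemma integrable (hf : IsTest f) (μ : Measure ℝ) [IsFiniteMeasure μ] : Integrable f μ :=
  hf.continuous.integrable_of_hasCompactSupport hf.support

end IsTest

/-- The weak form of the Fokker-Planck equation on `[r, t]`. -/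
def SolvesFokkerPlanck (θ b : ℝ) (a : ℝ → ℝ) (ν : ℝ → ProbabilityMeasure ℝ) (r t : ℝ) : Prop :=
  ∀ f, IsTest f → ∀ x y, r ≤ x → x ≤ y → y ≤ t →
    IntervalIntegrable (fun q => ∫ z, ouGenerator θ b (a q) f z ∂(ν q : Measure ℝ)) volume x y ∧
    ∫ z, f z ∂(ν y : Measure ℝ) = ∫ z, f z ∂(ν x : Measure ℝ) +
      ∫ q in x..y, ∫ z, ouGenerator θ b (a q) f z ∂(ν q : Measure ℝ)

/-- The integral of `c^k f(c x)` for `c = e^{θu}`. -/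
noncomputable def scaledIntegral (θ : ℝ) (k : ℕ) (f : ℝ → ℝ) (u : ℝ)
    (μ : ProbabilityMeasure ℝ) : ℝ :=
  ∫ x, Real.exp (θ * u) ^ k * f (Real.exp (θ * u) * x) ∂(μ : Measure ℝ)

lemma IsTest.scaled {f : ℝ → ℝ} (hf : IsTest f) (θ : ℝ) (k : ℕ) (u : ℝ) :
    IsTest fun x => Real.exp (θ * u) ^ k * f (Real.exp (θ * u) * x) :=
  (hf.comp_mul (Real.exp_pos _).ne').const_mul _

/-- The u-derivative has the same scaled form, with f replaced by the test function θ(kf + xf').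
This closure lets one boundedness statement yield the Lipschitz and Taylor bounds below, uniformly
in x. -/
lemma IsTest.hasDerivAt_scaled {f : ℝ → ℝ} (hf : IsTest f) (θ : ℝ) (k : ℕ) (x u : ℝ) :
    HasDerivAt (fun u => Real.exp (θ * u) ^ k * f (Real.exp (θ * u) * x))
      (Real.exp (θ * u) ^ k * (θ * (k * f (Real.exp (θ * u) * x) +
        Real.exp (θ * u) * x * _root_.deriv f (Real.exp (θ * u) * x)))) u := by
  have h0 : HasDerivAt (fun u : ℝ => θ * u) θ u := by simpa using (hasDerivAt_id u).const_mul θ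
  have h1 := h0.exp
  have h2 := (hf.hasDerivAt (Real.exp (θ * u) * x)).comp u (h1.mul_const x)
  refine HasDerivAt.congr_deriv ((h1.pow k).mul h2) ?_
  rcases k with _ | k
  · simp; ring
  · simp only [Nat.add_sub_cancel, Pi.pow_apply]; push_cast; ring

lemma IsTest.scaled_deriv_bounded {f : ℝ → ℝ} (hf : IsTest f) (θ : ℝ) (k : ℕ) {h : ℝ} :
    ∃ K, 0 ≤ K ∧ ∀ u x, 0 ≤ u → u ≤ h → |Real.exp (θ * u) ^ k * f (Real.exp (θ * u) * x)| ≤ K := by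
  obtain ⟨K, hK0, hK⟩ := hf.bounded
  refine ⟨Real.exp (|θ| * h) ^ k * K, by positivity, fun u x hu huh => ?_⟩
  rw [abs_mul, abs_of_nonneg (by positivity)]
  have : θ * u ≤ |θ| * h := mul_le_mul (le_abs_self θ) huh hu (abs_nonneg _)
  exact mul_le_mul (pow_le_pow_left₀ (Real.exp_pos _).le (Real.exp_le_exp.2 this) k) (hK _)
    (abs_nonneg _) (by positivity)

lemma IsTest.scaled_deriv {f : ℝ → ℝ} (hf : IsTest f) (θ : ℝ) (k : ℕ) :
    IsTest fun x => θ * (k * f x + x * _root_.deriv f x) :=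
  ((hf.const_mul k).add hf.deriv.id_mul).const_mul θ

lemma IsTest.scaled_lipschitz {f : ℝ → ℝ} (hf : IsTest f) (θ : ℝ) (k : ℕ) (h : ℝ) :
    ∃ K, 0 ≤ K ∧ ∀ u v x, 0 ≤ u → u ≤ v → v ≤ h →
      |Real.exp (θ * v) ^ k * f (Real.exp (θ * v) * x) -
        Real.exp (θ * u) ^ k * f (Real.exp (θ * u) * x)| ≤ K * (v - u) := by
  obtain ⟨K, hK0, hK⟩ := (hf.scaled_deriv θ k).scaled_deriv_bounded θ k (h := h)
  refine ⟨K, hK0, fun u v x hu huv hv => ?_⟩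
  have := (convex_Icc u v).norm_image_sub_le_of_norm_hasDerivWithin_le
    (fun w _ => (hf.hasDerivAt_scaled θ k x w).hasDerivWithinAt)
    (fun w hw => hK w x (hu.trans hw.1) (hw.2.trans hv)) (Set.left_mem_Icc.2 huv)
    (Set.right_mem_Icc.2 huv)
  rwa [Real.norm_eq_abs, Real.norm_eq_abs, abs_of_nonneg (sub_nonneg.2 huv)] at this

/-- Second-order Taylor bound for `u ↦ f(e^{θu}x)`. -/
lemma IsTest.scaled_taylor {f : ℝ → ℝ} (hf : IsTest f) (θ : ℝ) (h : ℝ) :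
    ∃ K, 0 ≤ K ∧ ∀ u v x, 0 ≤ u → u ≤ v → v ≤ h →
      |f (Real.exp (θ * v) * x) - f (Real.exp (θ * u) * x) -
        (v - u) * (θ * (Real.exp (θ * u) * x * _root_.deriv f (Real.exp (θ * u) * x)))|
        ≤ K * (v - u) ^ 2 := by
  obtain ⟨K, hK0, hK⟩ := (hf.scaled_deriv θ 0).scaled_lipschitz θ 0 h
  refine ⟨K, hK0, fun u v x hu huv hv => ?_⟩
  set c := θ * (Real.exp (θ * u) * x * _root_.deriv f (Real.exp (θ * u) * x)) with hc
  have hd : ∀ w, HasDerivAt (fun w => f (Real.exp (θ * w) * x) - w * c)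
      (θ * (Real.exp (θ * w) * x * _root_.deriv f (Real.exp (θ * w) * x)) - c) w := fun w => by
    refine HasDerivAt.sub ?_ (by simpa using (hasDerivAt_id w).mul_const c)
    simpa using hf.hasDerivAt_scaled θ 0 x w
  have := (convex_Icc u v).norm_image_sub_le_of_norm_hasDerivWithin_le (C := K * (v - u))
    (fun w _ => (hd w).hasDerivWithinAt)
    (fun w hw => ?_) (Set.left_mem_Icc.2 huv) (Set.right_mem_Icc.2 huv)
  · rw [Real.norm_eq_abs, Real.norm_eq_abs, abs_of_nonneg (sub_nonneg.2 huv)] at this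
    rw [show K * (v - u) ^ 2 = K * (v - u) * (v - u) by ring]
    convert this using 2
    ring
  · have h1 := hK u w x hu hw.1 (hw.2.trans hv)
    simp only [pow_zero, one_mul, Nat.cast_zero, zero_mul, zero_add] at h1
    exact h1.trans (mul_le_mul_of_nonneg_left (by linarith [hw.2]) hK0)

lemma abs_integral_le_of_bound (μ : Measure ℝ) [IsProbabilityMeasure μ] {g : ℝ → ℝ} {K : ℝ}
    (h : ∀ x, |g x| ≤ K) : |∫ x, g x ∂μ| ≤ K := by
  simpa using norm_integral_le_of_norm_le_const (μ := μ) (f := g) (C := K)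
    (Eventually.of_forall h)

lemma IsTest.scaledIntegral_bounded {f : ℝ → ℝ} (hf : IsTest f) (θ : ℝ) (k : ℕ) (h : ℝ) :
    ∃ K, 0 ≤ K ∧ ∀ u μ, 0 ≤ u → u ≤ h → |scaledIntegral θ k f u μ| ≤ K := by
  obtain ⟨K, hK0, hK⟩ := hf.scaled_deriv_bounded θ k (h := h)
  exact ⟨K, hK0, fun u μ hu huh => abs_integral_le_of_bound _ fun x => hK u x hu huh⟩

lemma IsTest.scaledIntegral_lipschitz {f : ℝ → ℝ} (hf : IsTest f) (θ : ℝ) (k : ℕ) (h : ℝ) :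
    ∃ K, 0 ≤ K ∧ ∀ u v μ, 0 ≤ u → u ≤ v → v ≤ h →
      |scaledIntegral θ k f v μ - scaledIntegral θ k f u μ| ≤ K * (v - u) := by
  obtain ⟨K, hK0, hK⟩ := hf.scaled_lipschitz θ k h
  refine ⟨K, hK0, fun u v μ hu huv hv => ?_⟩
  unfold scaledIntegral
  rw [← integral_sub ((hf.scaled θ k v).integrable _) ((hf.scaled θ k u).integrable _)]
  exact abs_integral_le_of_bound _ fun x => hK u v x hu huv hv

/-- Each space derivative brings out one factor e^{θu}, whence the exponents 0, 1, 2. The drift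
contributes exactly minus the u-derivative of the scaled integral, so it will cancel when u moves
with time. -/
lemma IsTest.integral_ouGenerator_scaled {f : ℝ → ℝ} (hf : IsTest f) (θ b a u : ℝ)
    (μ : ProbabilityMeasure ℝ) :
    ∫ x, ouGenerator θ b a (fun x => f (Real.exp (θ * u) * x)) x ∂(μ : Measure ℝ) =
      -scaledIntegral θ 0 (fun x => θ * (x * _root_.deriv f x)) u μ +
        a * scaledIntegral θ 1 (_root_.deriv f) u μ +
        b ^ 2 / 2 * scaledIntegral θ 2 (_root_.deriv (_root_.deriv f)) u μ := by
  have h1 : ∀ (g : ℝ → ℝ) (c : ℝ), _root_.deriv (fun x => g (c * x)) =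
      fun x => c * _root_.deriv g (c * x) := fun g c => by
    ext x; simpa using deriv_comp_mul_left c g x
  have h2 : _root_.deriv (_root_.deriv fun x => f (Real.exp (θ * u) * x)) =
      fun x => Real.exp (θ * u) ^ 2 * _root_.deriv (_root_.deriv f) (Real.exp (θ * u) * x) := by
    rw [h1]
    ext x
    rw [deriv_const_mul_field, h1 (_root_.deriv f)]
    ring
  unfold scaledIntegral
  rw [← integral_neg, ← integral_const_mul, ← integral_const_mul, ← integral_add, ← integral_add]
  · refine integral_congr_ae (Eventually.of_forall fun x => ?_)
    simp only [ouGenerator, h2]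
    rw [h1 f]
    ring
  · exact ((hf.deriv.id_mul.const_mul θ).scaled θ 0 u).integrable _ |>.neg.add
      (((hf.deriv.scaled θ 1 u).integrable _).const_mul a)
  · exact ((hf.deriv.deriv.scaled θ 2 u).integrable _).const_mul _
  · exact (((hf.deriv.id_mul.const_mul θ).scaled θ 0 u).integrable _).neg
  · exact ((hf.deriv.scaled θ 1 u).integrable _).const_mul a

lemma scaledIntegral_zero (θ : ℝ) (f : ℝ → ℝ) (u : ℝ) (μ : ProbabilityMeasure ℝ) :
    scaledIntegral θ 0 f u μ = ∫ x, f (Real.exp (θ * u) * x) ∂(μ : Measure ℝ) := by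
  simp [scaledIntegral]

/-! ### Weak solutions tested against rescaled functions -/

section

variable {θ b r t : ℝ} {a : ℝ → ℝ} {ν : ℝ → ProbabilityMeasure ℝ}

/-- The weak equation only admits test functions fixed in time, so the scale u is frozen here and is
tied to the time afterwards. -/
lemma SolvesFokkerPlanck.scaled (h : SolvesFokkerPlanck θ b a ν r t) {f : ℝ → ℝ} (hf : IsTest f)
    (u : ℝ) {x y : ℝ} (hx : r ≤ x) (hxy : x ≤ y) (hy : y ≤ t) :
    IntervalIntegrable (fun q => -scaledIntegral θ 0 (fun x => θ * (x * deriv f x)) u (ν q) +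
        a q * scaledIntegral θ 1 (deriv f) u (ν q) +
        b ^ 2 / 2 * scaledIntegral θ 2 (deriv (deriv f)) u (ν q)) volume x y ∧
    scaledIntegral θ 0 f u (ν y) - scaledIntegral θ 0 f u (ν x) =
      ∫ q in x..y, (-scaledIntegral θ 0 (fun x => θ * (x * deriv f x)) u (ν q) +
        a q * scaledIntegral θ 1 (deriv f) u (ν q) +
        b ^ 2 / 2 * scaledIntegral θ 2 (deriv (deriv f)) u (ν q)) := by
  have := h _ (hf.comp_mul (Real.exp_pos (θ * u)).ne') x y hx hxy hy
  simp_rw [hf.integral_ouGenerator_scaled] at this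
  refine ⟨this.1, ?_⟩
  rw [scaledIntegral_zero, scaledIntegral_zero, this.2, add_sub_cancel_left]

/-- The clock in which the increments of the solutions are measured. -/
noncomputable def controlClock (a : ℝ → ℝ) (r x : ℝ) : ℝ := ∫ w in r..x, (1 + |a w|)

lemma IntervalIntegrable.one_add_abs (ha : IntervalIntegrable a volume r t) :
    IntervalIntegrable (fun w => 1 + |a w|) volume r t :=
  intervalIntegrable_const.add ha.abs

lemma controlClock_sub (ha : IntervalIntegrable a volume r t) {x y : ℝ} (hx : r ≤ x) (hxy : x ≤ y)
    (hy : y ≤ t) : controlClock a r y - controlClock a r x = ∫ w in x..y, (1 + |a w|) :=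
  integral_sub_integral_of_mem ha.one_add_abs hx hxy hy

lemma sub_le_controlClock_sub (ha : IntervalIntegrable a volume r t) {x y : ℝ} (hx : r ≤ x)
    (hxy : x ≤ y) (hy : y ≤ t) : y - x ≤ controlClock a r y - controlClock a r x := by
  rw [controlClock_sub ha hx hxy hy]
  have : y - x = ∫ _ in x..y, (1 : ℝ) := by simp
  rw [this]
  refine intervalIntegral.integral_mono_on hxy (by simp) (ha.one_add_abs.mono_Icc hx hxy hy) ?_
  intro w _
  linarith [abs_nonneg (a w)]

/-- The generator applied to a bounded family of test functions is at most a constant times 1 + |a|,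
the density of the clock. Uniformity in the frozen scale is what allows it to move later. -/
lemma SolvesFokkerPlanck.exists_increment_bound (h : SolvesFokkerPlanck θ b a ν r t)
    (ha : IntervalIntegrable a volume r t) {f : ℝ → ℝ} (hf : IsTest f) (k : ℕ) (H : ℝ) :
    ∃ K, 0 ≤ K ∧ ∀ u x y, 0 ≤ u → u ≤ H → r ≤ x → x ≤ y → y ≤ t →
      |scaledIntegral θ k f u (ν y) - scaledIntegral θ k f u (ν x)| ≤
        K * (controlClock a r y - controlClock a r x) := by
  obtain ⟨K0, hK0, h0⟩ := (hf.deriv.id_mul.const_mul θ).scaledIntegral_bounded θ 0 H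
  obtain ⟨K1, hK1, h1⟩ := hf.deriv.scaledIntegral_bounded θ 1 H
  obtain ⟨K2, hK2, h2⟩ := hf.deriv.deriv.scaledIntegral_bounded θ 2 H
  set L := K0 + K1 + b ^ 2 / 2 * K2 with hL
  have hL0 : 0 ≤ L := by positivity
  refine ⟨Real.exp (|θ| * H) ^ k * L, by positivity, fun u x y hu huH hx hxy hy => ?_⟩
  have hk : ∀ μ, scaledIntegral θ k f u μ = Real.exp (θ * u) ^ k * scaledIntegral θ 0 f u μ := by
    intro μ
    unfold scaledIntegral
    rw [← integral_const_mul]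
    simp
  have hle : θ * u ≤ |θ| * H := mul_le_mul (le_abs_self θ) huH hu (abs_nonneg _)
  rw [hk, hk, ← mul_sub, abs_mul, abs_of_nonneg (by positivity), mul_assoc]
  refine mul_le_mul (pow_le_pow_left₀ (Real.exp_pos _).le (Real.exp_le_exp.2 hle) k) ?_
    (abs_nonneg _) (by positivity)
  rw [(h.scaled hf u hx hxy hy).2, controlClock_sub ha hx hxy hy,
    ← intervalIntegral.integral_const_mul]
  refine intervalIntegral.norm_integral_le_of_norm_le (E := ℝ) hxy ?_
    ((ha.one_add_abs.const_mul _).mono_Icc hx hxy hy)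
  refine Eventually.of_forall fun w _ => ?_
  have e0 := h0 u (ν w) hu huH
  have e1 := h1 u (ν w) hu huH
  have e2 := h2 u (ν w) hu huH
  rw [Real.norm_eq_abs]
  have hb : 0 ≤ b ^ 2 / 2 := by positivity
  calc _ ≤ K0 + |a w| * K1 + b ^ 2 / 2 * K2 := by
        refine (abs_add_le _ _).trans (add_le_add ((abs_add_le _ _).trans (add_le_add ?_ ?_)) ?_)
        · rwa [abs_neg]
        · rw [abs_mul]; exact mul_le_mul_of_nonneg_left e1 (abs_nonneg _)
        · rw [abs_mul, abs_of_nonneg hb]; exact mul_le_mul_of_nonneg_left e2 hb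
    _ ≤ L * (1 + |a w|) := by
        have := abs_nonneg (a w)
        have : 0 ≤ b ^ 2 / 2 * K2 := by positivity
        rw [hL]; nlinarith

end

lemma continuousOn_of_increment_bound {F S : ℝ → ℝ} {K r t : ℝ}
    (hS : ContinuousOn S (Set.Icc r t))
    (h : ∀ x y, r ≤ x → x ≤ y → y ≤ t → |F y - F x| ≤ K * (S y - S x)) :
    ContinuousOn F (Set.Icc r t) := by
  intro x hx
  have hlim : Tendsto (fun y => |K| * |S y - S x|) (𝓝[Set.Icc r t] x) (𝓝 0) := by
    have h1 : Tendsto (fun y => |K| * |S y - S x|) (𝓝[Set.Icc r t] x)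
        (𝓝 (|K| * |S x - S x|)) := ((hS x hx).sub_const (S x)).abs.const_mul |K|
    simpa using h1
  rw [ContinuousWithinAt, tendsto_iff_dist_tendsto_zero]
  refine squeeze_zero' (Eventually.of_forall fun _ => dist_nonneg) ?_ hlim
  filter_upwards [self_mem_nhdsWithin] with y hy
  rw [Real.dist_eq]
  rcases le_total x y with hxy | hxy
  · refine (h x y hx.1 hxy hy.2).trans ((le_abs_self _).trans (abs_mul _ _).le)
  · rw [abs_sub_comm, abs_sub_comm (S y)]
    refine (h y x hy.1 hxy hx.2).trans ((le_abs_self _).trans (abs_mul _ _).le)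

section

variable {θ b r t : ℝ} {a : ℝ → ℝ} {ν : ℝ → ProbabilityMeasure ℝ}

lemma continuousOn_controlClock (hrt : r ≤ t) (ha : IntervalIntegrable a volume r t) :
    ContinuousOn (controlClock a r) (Set.Icc r t) :=
  continuousOn_primitive_Icc hrt ha.one_add_abs

/-- Time and scale are moved one after the other, through the mixed term with the old scale and the
new law. -/
lemma SolvesFokkerPlanck.exists_diag_increment_bound (h : SolvesFokkerPlanck θ b a ν r t)
    (ha : IntervalIntegrable a volume r t) {f : ℝ → ℝ} (hf : IsTest f) (k : ℕ) :
    ∃ K, 0 ≤ K ∧ ∀ x y, r ≤ x → x ≤ y → y ≤ t →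
      |scaledIntegral θ k f (y - r) (ν y) - scaledIntegral θ k f (x - r) (ν x)| ≤
        K * (controlClock a r y - controlClock a r x) := by
  obtain ⟨K, hK, h1⟩ := h.exists_increment_bound ha hf k (t - r)
  obtain ⟨L, hL, h2⟩ := hf.scaledIntegral_lipschitz θ k (t - r)
  refine ⟨K + L, by positivity, fun x y hx hxy hy => ?_⟩
  have e1 := h1 (x - r) x y (by linarith) (by linarith) hx hxy hy
  have e2 := h2 (x - r) (y - r) (ν y) (by linarith) (by linarith) (by linarith)
  have e3 := sub_le_controlClock_sub ha hx hxy hy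
  have e4 := abs_sub_le (scaledIntegral θ k f (y - r) (ν y))
    (scaledIntegral θ k f (x - r) (ν y)) (scaledIntegral θ k f (x - r) (ν x))
  have e5 : L * (y - r - (x - r)) ≤ L * (controlClock a r y - controlClock a r x) :=
    mul_le_mul_of_nonneg_left (by linarith) hL
  linarith

lemma SolvesFokkerPlanck.continuousOn_diag (hrt : r ≤ t) (h : SolvesFokkerPlanck θ b a ν r t)
    (ha : IntervalIntegrable a volume r t) {f : ℝ → ℝ} (hf : IsTest f) (k : ℕ) :
    ContinuousOn (fun w => scaledIntegral θ k f (w - r) (ν w)) (Set.Icc r t) := by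
  obtain ⟨K, _, hK⟩ := h.exists_diag_increment_bound ha hf k
  exact continuousOn_of_increment_bound (continuousOn_controlClock hrt ha) hK

/-- In the coordinate `e^{θ(q-r)}x` the drift `-θx` disappears from the equation. -/
lemma SolvesFokkerPlanck.scaled_equation (hrt : r ≤ t) (h : SolvesFokkerPlanck θ b a ν r t)
    (ha : IntervalIntegrable a volume r t) {f : ℝ → ℝ} (hf : IsTest f) :
    IntervalIntegrable (fun w => a w * scaledIntegral θ 1 (deriv f) (w - r) (ν w) +
      b ^ 2 / 2 * scaledIntegral θ 2 (deriv (deriv f)) (w - r) (ν w)) volume r t ∧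
    scaledIntegral θ 0 f (t - r) (ν t) = scaledIntegral θ 0 f 0 (ν r) +
      ∫ w in r..t, (a w * scaledIntegral θ 1 (deriv f) (w - r) (ν w) +
        b ^ 2 / 2 * scaledIntegral θ 2 (deriv (deriv f)) (w - r) (ν w)) := by
  set Φ : ℝ → ℝ := fun w => a w * scaledIntegral θ 1 (deriv f) (w - r) (ν w) +
        b ^ 2 / 2 * scaledIntegral θ 2 (deriv (deriv f)) (w - r) (ν w) with hΦdef
  have hΦ : IntervalIntegrable Φ volume r t := by
    refine IntervalIntegrable.add ?_ ?_
    · refine ha.mul_continuousOn ?_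
      rw [Set.uIcc_of_le hrt]
      exact h.continuousOn_diag hrt ha hf.deriv 1
    · refine ContinuousOn.intervalIntegrable ?_
      rw [Set.uIcc_of_le hrt]
      exact (h.continuousOn_diag hrt ha hf.deriv.deriv 2).const_mul _
  refine ⟨hΦ, ?_⟩
  set S := controlClock a r with hSdef
  set E : ℝ → ℝ := fun x => θ * (x * deriv f x) with hE
  have hEt : IsTest E := hf.deriv.id_mul.const_mul θ
  obtain ⟨K0, hK0, h0⟩ := h.exists_increment_bound ha hEt 0 (t - r)
  obtain ⟨K1, hK1, h1⟩ := hf.deriv.scaledIntegral_lipschitz θ 1 (t - r)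
  obtain ⟨K2, hK2, h2⟩ := hf.deriv.deriv.scaledIntegral_lipschitz θ 2 (t - r)
  obtain ⟨K3, hK3, h3⟩ := hf.scaled_taylor θ (t - r)
  have hb : 0 ≤ b ^ 2 / 2 := by positivity
  set L := K0 + K1 + b ^ 2 / 2 * K2 with hL
  have hL0 : 0 ≤ L := by positivity
  -- An increment of D is split at the mixed term (old scale, law at y). Moving the scale gives (y -
  -- x)∫E dν_y up to K3(y - x)². Moving the law gives -∫E dν_w integrated in w, plus Φ, up to errors
  -- from freezing the scale and replacing ν_w by ν_y; these are quadratic in the clock, with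
  -- constant L.
  set D : ℝ → ℝ := fun q => scaledIntegral θ 0 f (q - r) (ν q) - ∫ w in r..q, Φ w with hD
  have hconst : D t = D r := by
    refine eq_of_norm_sub_le_sq (K := K3 + L) hrt (continuousOn_controlClock hrt ha) ?_
    intro x y hx hxy hy
    have hSxy := sub_le_controlClock_sub ha hx hxy hy
    have hS0 : 0 ≤ S y - S x := by linarith
    refine ⟨by linarith, ?_⟩
    obtain ⟨hint, hinc⟩ := h.scaled hf (x - r) hx hxy hy
    -- the space increment
    have hA1 : |scaledIntegral θ 0 f (y - r) (ν y) - scaledIntegral θ 0 f (x - r) (ν y) -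
        (y - x) * scaledIntegral θ 0 E (x - r) (ν y)| ≤ K3 * (y - x) ^ 2 := by
      simp only [scaledIntegral]
      rw [← integral_sub ((hf.scaled θ 0 _).integrable _) ((hf.scaled θ 0 _).integrable _),
        ← integral_const_mul, ← integral_sub]
      · refine abs_integral_le_of_bound _ fun z => ?_
        have := h3 (x - r) (y - r) z (by linarith) (by linarith) (by linarith)
        rw [sub_sub_sub_cancel_right] at this
        simpa [hE] using this
      · exact ((hf.scaled θ 0 _).integrable _).sub ((hf.scaled θ 0 _).integrable _)
      · exact ((hEt.scaled θ 0 _).integrable _).const_mul _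
    have hconstI : ∫ _ in x..y, scaledIntegral θ 0 E (x - r) (ν y) =
        (y - x) * scaledIntegral θ 0 E (x - r) (ν y) := by simp
    have hΦxy := hΦ.mono_Icc hx hxy hy
    have hSS : L * (S y - S x) ^ 2 = ∫ w in x..y, L * (S y - S x) * (1 + |a w|) := by
      rw [intervalIntegral.integral_const_mul, ← controlClock_sub ha hx hxy hy]
      ring
    -- the time increment
    have hA2 : |scaledIntegral θ 0 f (x - r) (ν y) - scaledIntegral θ 0 f (x - r) (ν x) +
        (y - x) * scaledIntegral θ 0 E (x - r) (ν y) - ∫ w in x..y, Φ w| ≤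
        L * (S y - S x) ^ 2 := by
      rw [hinc, ← hconstI, ← intervalIntegral.integral_add hint intervalIntegrable_const,
        ← intervalIntegral.integral_sub (hint.add intervalIntegrable_const) hΦxy, hSS]
      refine intervalIntegral.norm_integral_le_of_norm_le (E := ℝ) hxy ?_
        ((ha.one_add_abs.const_mul _).mono_Icc hx hxy hy)
      refine Eventually.of_forall fun w hw => ?_
      have hxw := hw.1.le
      have hwy := hw.2
      have e0 := h0 (x - r) w y (by linarith) (by linarith) (by linarith) hwy hy
      have e1 := h1 (x - r) (w - r) (ν w) (by linarith) (by linarith) (by linarith)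
      have e2 := h2 (x - r) (w - r) (ν w) (by linarith) (by linarith) (by linarith)
      have hw1 := sub_le_controlClock_sub ha hx hxw (hwy.trans hy)
      have hw2 := sub_le_controlClock_sub ha (hx.trans hxw) hwy hy
      rw [abs_sub_comm] at e1 e2
      have e0' : |scaledIntegral θ 0 E (x - r) (ν y) - scaledIntegral θ 0 E (x - r) (ν w)| ≤
          K0 * (S y - S x) := e0.trans (mul_le_mul_of_nonneg_left (by linarith) hK0)
      have e1' : |scaledIntegral θ 1 (deriv f) (x - r) (ν w) -
          scaledIntegral θ 1 (deriv f) (w - r) (ν w)| ≤ K1 * (S y - S x) :=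
        e1.trans (mul_le_mul_of_nonneg_left (by linarith) hK1)
      have e2' : |scaledIntegral θ 2 (deriv (deriv f)) (x - r) (ν w) -
          scaledIntegral θ 2 (deriv (deriv f)) (w - r) (ν w)| ≤ K2 * (S y - S x) :=
        e2.trans (mul_le_mul_of_nonneg_left (by linarith) hK2)
      rw [Real.norm_eq_abs]
      have hsplit : -scaledIntegral θ 0 E (x - r) (ν w) +
          a w * scaledIntegral θ 1 (deriv f) (x - r) (ν w) +
          b ^ 2 / 2 * scaledIntegral θ 2 (deriv (deriv f)) (x - r) (ν w) +
          scaledIntegral θ 0 E (x - r) (ν y) - Φ w =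
          (scaledIntegral θ 0 E (x - r) (ν y) - scaledIntegral θ 0 E (x - r) (ν w)) +
          a w * (scaledIntegral θ 1 (deriv f) (x - r) (ν w) -
            scaledIntegral θ 1 (deriv f) (w - r) (ν w)) +
          b ^ 2 / 2 * (scaledIntegral θ 2 (deriv (deriv f)) (x - r) (ν w) -
            scaledIntegral θ 2 (deriv (deriv f)) (w - r) (ν w)) := by
        simp only [hΦdef]; ring
      rw [hsplit]
      calc _ ≤ K0 * (S y - S x) + |a w| * (K1 * (S y - S x)) +
            b ^ 2 / 2 * (K2 * (S y - S x)) := by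
            refine (abs_add_le _ _).trans
              (add_le_add ((abs_add_le _ _).trans (add_le_add e0' ?_)) ?_)
            · rw [abs_mul]; exact mul_le_mul_of_nonneg_left e1' (abs_nonneg _)
            · rw [abs_mul, abs_of_nonneg hb]; exact mul_le_mul_of_nonneg_left e2' hb
        _ ≤ L * (S y - S x) * (1 + |a w|) := by
            have haw := abs_nonneg (a w)
            have : 0 ≤ b ^ 2 / 2 * (K2 * (S y - S x)) * |a w| := by positivity
            have : 0 ≤ K0 * (S y - S x) * |a w| := by positivity
            have : 0 ≤ K1 * (S y - S x) := by positivity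
            rw [hL]; nlinarith
    have hDD : D y - D x = (scaledIntegral θ 0 f (y - r) (ν y) -
        scaledIntegral θ 0 f (x - r) (ν y) - (y - x) * scaledIntegral θ 0 E (x - r) (ν y)) +
        (scaledIntegral θ 0 f (x - r) (ν y) - scaledIntegral θ 0 f (x - r) (ν x) +
        (y - x) * scaledIntegral θ 0 E (x - r) (ν y) - ∫ w in x..y, Φ w) := by
      rw [← integral_sub_integral_of_mem hΦ hx hxy hy]
      simp only [hD]
      ring
    rw [hDD, Real.norm_eq_abs]
    refine (abs_add_le _ _).trans ((add_le_add hA1 hA2).trans ?_)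
    have : K3 * (y - x) ^ 2 ≤ K3 * (S y - S x) ^ 2 :=
      mul_le_mul_of_nonneg_left (pow_le_pow_left₀ (by linarith) hSxy 2) hK3
    linarith
  simp only [hD, intervalIntegral.integral_same, sub_zero, sub_self] at hconst
  linarith

end

/-! ### From compactly supported test functions to bounded ones, and to characteristic functions -/

lemma abs_scaledIntegral_le {θ H B u : ℝ} (k : ℕ) {g : ℝ → ℝ} (hB : ∀ x, |g x| ≤ B)
    (μ : ProbabilityMeasure ℝ) (hu : 0 ≤ u) (huH : u ≤ H) :
    |scaledIntegral θ k g u μ| ≤ Real.exp (|θ| * H) ^ k * B := by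
  refine abs_integral_le_of_bound _ fun x => ?_
  rw [abs_mul, abs_of_nonneg (by positivity)]
  have : θ * u ≤ |θ| * H := mul_le_mul (le_abs_self θ) huH hu (abs_nonneg _)
  exact mul_le_mul (pow_le_pow_left₀ (Real.exp_pos _).le (Real.exp_le_exp.2 this) k) (hB _)
    (abs_nonneg _) (by positivity)

lemma tendsto_scaledIntegral {θ B u : ℝ} (k : ℕ) {g : ℕ → ℝ → ℝ} {g₀ : ℝ → ℝ}
    (hg : ∀ n, Continuous (g n)) (hB : ∀ n x, |g n x| ≤ B)
    (hlim : ∀ x, Tendsto (fun n => g n x) atTop (𝓝 (g₀ x))) (μ : ProbabilityMeasure ℝ) :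
    Tendsto (fun n => scaledIntegral θ k (g n) u μ) atTop (𝓝 (scaledIntegral θ k g₀ u μ)) := by
  refine tendsto_integral_of_dominated_convergence (fun _ => Real.exp (θ * u) ^ k * B)
    (fun n => ?_) (integrable_const _) (fun n => Eventually.of_forall fun x => ?_)
    (Eventually.of_forall fun x => (hlim _).const_mul _)
  · have := hg n
    exact Continuous.aestronglyMeasurable (by fun_prop)
  · rw [Real.norm_eq_abs, abs_mul, abs_of_nonneg (by positivity)]
    exact mul_le_mul_of_nonneg_left (hB n _) (by positivity)

/-- A bounded smooth function is a limit of test functions, boundedly with two derivatives. -/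
lemma exists_isTest_seq {f : ℝ → ℝ} (hf : ContDiff ℝ (⊤ : ℕ∞) f) {B : ℝ}
    (h0 : ∀ x, |f x| ≤ B) (h1 : ∀ x, |deriv f x| ≤ B) (h2 : ∀ x, |deriv (deriv f) x| ≤ B) :
    ∃ (g : ℕ → ℝ → ℝ) (B' : ℝ), (∀ n, IsTest (g n)) ∧
      (∀ n x, |g n x| ≤ B' ∧ |deriv (g n) x| ≤ B' ∧ |deriv (deriv (g n)) x| ≤ B') ∧
      (∀ x, Tendsto (fun n => g n x) atTop (𝓝 (f x)) ∧
        Tendsto (fun n => deriv (g n) x) atTop (𝓝 (deriv f x)) ∧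
        Tendsto (fun n => deriv (deriv (g n)) x) atTop (𝓝 (deriv (deriv f) x))) := by
  let χ : ContDiffBump (0 : ℝ) := ⟨1, 2, one_pos, one_lt_two⟩
  have hχ : IsTest χ := ⟨χ.contDiff, χ.hasCompactSupport⟩
  obtain ⟨A0, hA0, hχ0⟩ := hχ.bounded
  obtain ⟨A1, hA1, hχ1⟩ := hχ.deriv.bounded
  obtain ⟨A2, hA2, hχ2⟩ := hχ.deriv.deriv.bounded
  have hB0 : 0 ≤ B := (abs_nonneg _).trans (h0 0)
  have hfd : ContDiff ℝ (⊤ : ℕ∞) (deriv f) := (contDiff_infty_iff_deriv.1 hf).2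
  have hd0 : ∀ x, HasDerivAt f (deriv f x) x := fun x =>
    (hf.differentiable (by simp) x).hasDerivAt
  have hd1 : ∀ x, HasDerivAt (deriv f) (deriv (deriv f) x) x := fun x =>
    (hfd.differentiable (by simp) x).hasDerivAt
  -- The cutoffs χ(x/(n+1)) equal 1 on growing balls; scales at most 1 keep their derivatives
  -- bounded uniformly in n.
  let c : ℕ → ℝ := fun n => 1 / ((n : ℝ) + 1)
  have hc0 : ∀ n, 0 < c n := fun n => by positivity
  have hc1 : ∀ n, c n ≤ 1 := fun n => by
    rw [div_le_one (by positivity)]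
    linarith [n.cast_nonneg (α := ℝ)]
  have hcx : ∀ n x, HasDerivAt (fun x : ℝ => c n * x) (c n) x := fun n x => by
    simpa using (hasDerivAt_id x).const_mul (c n)
  have hg1 : ∀ n, deriv (fun x => χ (c n * x) * f x) =
      fun x => c n * deriv χ (c n * x) * f x + χ (c n * x) * deriv f x := fun n => by
    ext x
    refine (HasDerivAt.congr_deriv (((hχ.hasDerivAt (c n * x)).comp x (hcx n x)).mul (hd0 x))
      ?_).deriv
    simp only [Function.comp]; ring
  have hg2 : ∀ n, deriv (deriv (fun x => χ (c n * x) * f x)) =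
      fun x => c n * (c n * deriv (deriv χ) (c n * x)) * f x +
        2 * (c n * deriv χ (c n * x) * deriv f x) + χ (c n * x) * deriv (deriv f) x := fun n => by
    rw [hg1]
    ext x
    refine (HasDerivAt.congr_deriv (((((hχ.deriv.hasDerivAt (c n * x)).comp x
      (hcx n x)).const_mul (c n)).mul (hd0 x)).add
      (((hχ.hasDerivAt (c n * x)).comp x (hcx n x)).mul (hd1 x))) ?_).deriv
    simp only [Function.comp]; ring
  -- Near a fixed point the truncated functions eventually coincide with f, so all derivatives
  -- converge because they become constant in n.
  have hev : ∀ x, ∀ᶠ n in atTop, (fun x => χ (c n * x) * f x) =ᶠ[𝓝 x] f := fun x => by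
    filter_upwards [eventually_ge_atTop ⌈|x|⌉₊] with n hn
    have hx : |x| < (n : ℝ) + 1 := ((Nat.le_ceil _).trans (Nat.cast_le.2 hn)).trans_lt
      (lt_add_one _)
    filter_upwards [(isOpen_lt continuous_abs continuous_const).mem_nhds hx] with y hy
    have : χ (c n * y) = 1 := by
      refine χ.one_of_mem_closedBall ?_
      rw [mem_closedBall_zero_iff, Real.norm_eq_abs, abs_mul, abs_of_pos (hc0 n)]
      change 1 / ((n : ℝ) + 1) * |y| ≤ 1
      rw [one_div_mul_eq_div, div_le_one (by positivity)]
      exact le_of_lt hy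
    rw [this, one_mul]
  refine ⟨fun n x => χ (c n * x) * f x, (A0 + 2 * A1 + A2) * B, fun n => ?_, fun n x => ?_,
    fun x => ?_⟩
  · have := hχ.comp_mul (hc0 n).ne'
    exact ⟨this.smooth.mul hf, this.support.mul_right⟩
  · have b0 : |χ (c n * x)| ≤ A0 := hχ0 _
    have b1 : |c n * deriv χ (c n * x)| ≤ A1 := by
      rw [abs_mul, abs_of_pos (hc0 n)]
      simpa using mul_le_mul (hc1 n) (hχ1 (c n * x)) (abs_nonneg _) zero_le_one
    have b2 : |c n * (c n * deriv (deriv χ) (c n * x))| ≤ A2 := by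
      rw [abs_mul, abs_mul, abs_of_pos (hc0 n)]
      have := mul_le_mul (hc1 n) (hχ2 (c n * x)) (abs_nonneg _) zero_le_one
      simpa using mul_le_mul (hc1 n) this (mul_nonneg (hc0 n).le (abs_nonneg _)) zero_le_one
    have m : ∀ {p q P : ℝ}, |p| ≤ P → |q| ≤ B → |p * q| ≤ P * B := fun hp hq => by
      rw [abs_mul]
      exact mul_le_mul hp hq (abs_nonneg _) ((abs_nonneg _).trans hp)
    have p0 : 0 ≤ A0 * B := by positivity
    have p1 : 0 ≤ A1 * B := by positivity
    have p2 : 0 ≤ A2 * B := by positivity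
    refine ⟨(m b0 (h0 x)).trans (by linarith), ?_, ?_⟩
    · rw [hg1]
      refine (abs_add_le _ _).trans ((add_le_add (m b1 (h0 x)) (m b0 (h1 x))).trans (by linarith))
    · rw [hg2]
      have m1 : |2 * (c n * deriv χ (c n * x) * deriv f x)| ≤ 2 * (A1 * B) := by
        rw [abs_mul, abs_two]
        exact mul_le_mul_of_nonneg_left (m b1 (h1 x)) zero_le_two
      refine (abs_add_le _ _).trans ((add_le_add ((abs_add_le _ _).trans (add_le_add
        (m b2 (h0 x)) m1)) (m b0 (h2 x))).trans (by linarith))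
  · refine ⟨tendsto_const_nhds.congr' ?_, tendsto_const_nhds.congr' ?_,
      tendsto_const_nhds.congr' ?_⟩ <;> filter_upwards [hev x] with n hn
    · exact hn.eq_of_nhds.symm
    · exact hn.deriv_eq.symm
    · exact hn.deriv.deriv_eq.symm

section

variable {θ b r t : ℝ} {a : ℝ → ℝ} {ν : ℝ → ProbabilityMeasure ℝ}

lemma SolvesFokkerPlanck.mono (h : SolvesFokkerPlanck θ b a ν r t) {q : ℝ} (hq : q ≤ t) :
    SolvesFokkerPlanck θ b a ν r q :=
  fun f hf x y hx hxy hy => h f hf x y hx hxy (hy.trans hq)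

/-- Dominated convergence along the cutoffs, with a multiple of 1 + |a| as dominating function. It
is wanted for cosines and sines, which have no compact support. -/
lemma SolvesFokkerPlanck.scaled_equation_of_bounded (hrt : r ≤ t)
    (h : SolvesFokkerPlanck θ b a ν r t) (ha : IntervalIntegrable a volume r t)
    {f : ℝ → ℝ} (hf : ContDiff ℝ (⊤ : ℕ∞) f) {B : ℝ}
    (h0 : ∀ x, |f x| ≤ B) (h1 : ∀ x, |deriv f x| ≤ B) (h2 : ∀ x, |deriv (deriv f) x| ≤ B) :
    IntervalIntegrable (fun w => a w * scaledIntegral θ 1 (deriv f) (w - r) (ν w) +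
      b ^ 2 / 2 * scaledIntegral θ 2 (deriv (deriv f)) (w - r) (ν w)) volume r t ∧
    scaledIntegral θ 0 f (t - r) (ν t) = scaledIntegral θ 0 f 0 (ν r) +
      ∫ w in r..t, (a w * scaledIntegral θ 1 (deriv f) (w - r) (ν w) +
        b ^ 2 / 2 * scaledIntegral θ 2 (deriv (deriv f)) (w - r) (ν w)) := by
  obtain ⟨g, B', hg, hB, hlim⟩ := exists_isTest_seq hf h0 h1 h2
  have hB0 : 0 ≤ B' := (abs_nonneg _).trans (hB 0 0).1
  have hF := fun n => h.scaled_equation hrt ha (hg n)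
  set Γ := Real.exp (|θ| * (t - r)) with hΓ
  set L := Γ ^ 1 * B' + b ^ 2 / 2 * (Γ ^ 2 * B') with hL
  have hL0 : 0 ≤ L := by positivity
  have hbd : IntervalIntegrable (fun w => L * (1 + |a w|)) volume r t :=
    ha.one_add_abs.const_mul _
  have hbound : ∀ n, ∀ w ∈ Set.uIoc r t,
      ‖a w * scaledIntegral θ 1 (deriv (g n)) (w - r) (ν w) +
        b ^ 2 / 2 * scaledIntegral θ 2 (deriv (deriv (g n))) (w - r) (ν w)‖ ≤ L * (1 + |a w|) := by
    intro n w hw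
    rw [Set.uIoc_of_le hrt] at hw
    have e1 := abs_scaledIntegral_le (θ := θ) 1 (fun x => (hB n x).2.1) (ν w)
      (sub_nonneg.2 hw.1.le) (sub_le_sub_right hw.2 r)
    have e2 := abs_scaledIntegral_le (θ := θ) 2 (fun x => (hB n x).2.2) (ν w)
      (sub_nonneg.2 hw.1.le) (sub_le_sub_right hw.2 r)
    have haw := abs_nonneg (a w)
    have hb : 0 ≤ b ^ 2 / 2 := by positivity
    rw [Real.norm_eq_abs]
    refine (abs_add_le _ _).trans ?_
    rw [abs_mul, abs_mul, abs_of_nonneg hb]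
    refine (add_le_add (mul_le_mul_of_nonneg_left e1 haw)
      (mul_le_mul_of_nonneg_left e2 hb)).trans ?_
    have q1 : 0 ≤ Γ ^ 1 * B' := by positivity
    have q2 : 0 ≤ b ^ 2 / 2 * (Γ ^ 2 * B') * |a w| := by positivity
    rw [hL, ← hΓ]
    nlinarith
  have hpt : ∀ w, Tendsto (fun n => a w * scaledIntegral θ 1 (deriv (g n)) (w - r) (ν w) +
      b ^ 2 / 2 * scaledIntegral θ 2 (deriv (deriv (g n))) (w - r) (ν w)) atTop
      (𝓝 (a w * scaledIntegral θ 1 (deriv f) (w - r) (ν w) +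
        b ^ 2 / 2 * scaledIntegral θ 2 (deriv (deriv f)) (w - r) (ν w))) := fun w =>
    ((tendsto_scaledIntegral 1 (fun n => (hg n).deriv.continuous) (fun n x => (hB n x).2.1)
      (fun x => (hlim x).2.1) (ν w)).const_mul _).add
    ((tendsto_scaledIntegral 2 (fun n => (hg n).deriv.deriv.continuous)
      (fun n x => (hB n x).2.2) (fun x => (hlim x).2.2) (ν w)).const_mul _)
  have hI := intervalIntegral.tendsto_integral_filter_of_dominated_convergence
    (fun w => L * (1 + |a w|)) (Eventually.of_forall fun n => (hF n).1.def'.aestronglyMeasurable)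
    (Eventually.of_forall fun n => Eventually.of_forall fun w hw => hbound n w hw) hbd
    (Eventually.of_forall fun w _ => hpt w)
  have h3 : ∀ u μ, Tendsto (fun n => scaledIntegral θ 0 (g n) u μ) atTop
      (𝓝 (scaledIntegral θ 0 f u μ)) := fun u μ =>
    tendsto_scaledIntegral 0 (fun n => (hg n).continuous) (fun n x => (hB n x).1)
      (fun x => (hlim x).1) μ
  refine ⟨?_, ?_⟩
  · refine IntervalIntegrable.mono_fun' hbd ?_ ?_
    · exact aestronglyMeasurable_of_tendsto_ae atTop
        (fun n => (hF n).1.def'.aestronglyMeasurable) (Eventually.of_forall hpt)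
    · filter_upwards [ae_restrict_mem measurableSet_uIoc] with w hw
      exact le_of_tendsto (hpt w).norm (Eventually.of_forall fun n => hbound n w hw)
  · exact tendsto_nhds_unique (h3 (t - r) (ν t))
      (((h3 0 (ν r)).add hI).congr fun n => (hF n).2.symm)

/-- The characteristic function of a solution of the Fokker-Planck equation. -/
lemma SolvesFokkerPlanck.charFun_eq (hrt : r ≤ t) (h : SolvesFokkerPlanck θ b a ν r t)
    (ha : IntervalIntegrable a volume r t) (ξ : ℝ) :
    charFun (ν t : Measure ℝ) (ξ * Real.exp (θ * (t - r))) = charFun (ν r : Measure ℝ) ξ *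
      Complex.exp (∫ w in r..t, (Complex.I * ξ * (a w * Real.exp (θ * (w - r)) : ℝ) -
        ξ ^ 2 * (b ^ 2 / 2 * Real.exp (θ * (w - r)) ^ 2 : ℝ))) := by
  set c : ℝ → ℝ := fun x => Real.cos (ξ * x) with hc
  set s : ℝ → ℝ := fun x => Real.sin (ξ * x) with hs
  have hξ : ∀ x, HasDerivAt (fun x : ℝ => ξ * x) ξ x := fun x => by
    simpa using (hasDerivAt_id x).const_mul ξ
  have hc1 : deriv c = fun x => -ξ * s x := by
    ext x; rw [(hξ x).cos.deriv]; simp only [hs]; ring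
  have hs1 : deriv s = fun x => ξ * c x := by
    ext x; rw [(hξ x).sin.deriv]; simp only [hc]; ring
  have hc2 : deriv (deriv c) = fun x => -ξ ^ 2 * c x := by
    rw [hc1]; ext x; rw [deriv_const_mul_field, hs1]; ring
  have hs2 : deriv (deriv s) = fun x => -ξ ^ 2 * s x := by
    rw [hs1]; ext x; rw [deriv_const_mul_field, hc1]; ring
  have hcsm : ContDiff ℝ (⊤ : ℕ∞) c := Real.contDiff_cos.comp (contDiff_const.mul contDiff_id)
  have hssm : ContDiff ℝ (⊤ : ℕ∞) s := Real.contDiff_sin.comp (contDiff_const.mul contDiff_id)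
  have hcb : ∀ x, |c x| ≤ 1 := fun x => Real.abs_cos_le_one _
  have hsb : ∀ x, |s x| ≤ 1 := fun x => Real.abs_sin_le_one _
  have habs := abs_nonneg ξ
  have hmul : ∀ (k y B : ℝ), |y| ≤ 1 → |k| ≤ B → |k * y| ≤ B := fun k y B hy hk => by
    rw [abs_mul]
    exact (mul_le_mul hk hy (abs_nonneg _) ((abs_nonneg _).trans hk)).trans (mul_one _).le
  have k1 : |ξ| ≤ 1 + |ξ| + |ξ| ^ 2 := by nlinarith
  have k2 : |-ξ ^ 2| ≤ 1 + |ξ| + |ξ| ^ 2 := by rw [abs_neg, abs_pow]; nlinarith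
  have k0 : 1 ≤ 1 + |ξ| + |ξ| ^ 2 := by nlinarith
  have EC := fun q (hq : r ≤ q) (hqt : q ≤ t) =>
    (h.mono hqt).scaled_equation_of_bounded hq (ha.mono_Icc le_rfl hq hqt) hcsm
    (B := 1 + |ξ| + |ξ| ^ 2)
    (fun x => (hcb x).trans k0)
    (fun x => by rw [hc1]; exact hmul _ _ _ (hsb x) (by rwa [abs_neg]))
    (fun x => by rw [hc2]; exact hmul _ _ _ (hcb x) k2)
  have ES := fun q (hq : r ≤ q) (hqt : q ≤ t) =>
    (h.mono hqt).scaled_equation_of_bounded hq (ha.mono_Icc le_rfl hq hqt) hssm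
    (B := 1 + |ξ| + |ξ| ^ 2)
    (fun x => (hsb x).trans k0)
    (fun x => by rw [hs1]; exact hmul _ _ _ (hcb x) k1)
    (fun x => by rw [hs2]; exact hmul _ _ _ (hsb x) k2)
  have hlin : ∀ (k : ℕ) (κ : ℝ) (g : ℝ → ℝ) (u : ℝ) (μ : ProbabilityMeasure ℝ),
      scaledIntegral θ k (fun x => κ * g x) u μ =
        κ * (Real.exp (θ * u) ^ k * scaledIntegral θ 0 g u μ) := fun k κ g u μ => by
    unfold scaledIntegral
    rw [← integral_const_mul, ← integral_const_mul]
    congr 1; ext x; ring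
  simp only [hc2, hs2] at EC ES
  simp only [hc1, hs1, hlin] at EC ES
  set Cq : ℝ → ℝ := fun q => scaledIntegral θ 0 c (q - r) (ν q) with hCq
  set Sq : ℝ → ℝ := fun q => scaledIntegral θ 0 s (q - r) (ν q) with hSq
  set e : ℝ → ℝ := fun w => Real.exp (θ * (w - r)) with he
  have hec : Continuous e := by fun_prop
  -- Along the moving frequency ξe^{θ(q-r)} the drift has disappeared, and differentiation only
  -- exchanges cosine and sine. The two real equations thus combine into the scalar equation Y' =
  -- kY.
  set k : ℝ → ℂ := fun w => Complex.I * ξ * (a w * e w : ℝ) -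
    ξ ^ 2 * (b ^ 2 / 2 * e w ^ 2 : ℝ) with hk
  set Y : ℝ → ℂ := fun q => (Cq q : ℂ) + Complex.I * Sq q with hY
  have hcharFun : ∀ q, charFun (ν q : Measure ℝ) (ξ * e q) = Y q := fun q => by
    rw [charFun_apply_real]
    have : ∀ x : ℝ, Complex.exp (((ξ * e q : ℝ) : ℂ) * x * Complex.I) =
        ((c (e q * x) : ℝ) : ℂ) + Complex.I * ((s (e q * x) : ℝ) : ℂ) := fun x => by
      rw [Complex.exp_mul_I, hc, hs]
      push_cast
      rw [mul_assoc (ξ : ℂ)]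
      ring
    simp_rw [this]
    have ic : Integrable (fun x => ((c (e q * x) : ℝ) : ℂ)) (ν q : Measure ℝ) := by
      refine Integrable.ofReal (Integrable.of_bound (Continuous.aestronglyMeasurable ?_) 1 ?_)
      · exact hcsm.continuous.comp (continuous_const.mul continuous_id)
      · exact Eventually.of_forall fun x => hcb _
    have is : Integrable (fun x => ((s (e q * x) : ℝ) : ℂ)) (ν q : Measure ℝ) := by
      refine Integrable.ofReal (Integrable.of_bound (Continuous.aestronglyMeasurable ?_) 1 ?_)
      · exact hssm.continuous.comp (continuous_const.mul continuous_id)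
      · exact Eventually.of_forall fun x => hsb _
    rw [integral_add ic (is.const_mul _), integral_const_mul, integral_complex_ofReal,
      integral_complex_ofReal]
    simp only [hY, hCq, hSq, scaledIntegral_zero, he]
  have hkint : IntervalIntegrable k volume r t := by
    refine IntervalIntegrable.sub (IntervalIntegrable.const_mul ?_ _) ?_
    · have : IntervalIntegrable (fun w => a w * e w) volume r t :=
        ha.mul_continuousOn hec.continuousOn
      exact ⟨this.1.ofReal, this.2.ofReal⟩
    · exact Continuous.intervalIntegrable (by fun_prop) _ _
  have hYeq : ∀ q, r ≤ q → q ≤ t → IntervalIntegrable (fun w => k w * Y w) volume r q ∧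
      Y q = Y r + ∫ w in r..q, k w * Y w := by
    intro q hq hqt
    obtain ⟨ic, hCe⟩ := EC q hq hqt
    obtain ⟨is, hSe⟩ := ES q hq hqt
    have hkY : ∀ w, k w * Y w =
        ((a w * (-ξ * (Real.exp (θ * (w - r)) ^ 1 * scaledIntegral θ 0 s (w - r) (ν w))) +
          b ^ 2 / 2 * (-ξ ^ 2 * (Real.exp (θ * (w - r)) ^ 2 *
            scaledIntegral θ 0 c (w - r) (ν w))) : ℝ) : ℂ) +
        Complex.I * ((a w * (ξ * (Real.exp (θ * (w - r)) ^ 1 *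
            scaledIntegral θ 0 c (w - r) (ν w))) +
          b ^ 2 / 2 * (-ξ ^ 2 * (Real.exp (θ * (w - r)) ^ 2 *
            scaledIntegral θ 0 s (w - r) (ν w))) : ℝ) : ℂ) := fun w => by
      simp only [hk, hY, hCq, hSq, he]
      push_cast
      linear_combination (ξ * a w * Complex.exp (θ * (w - r)) *
        (scaledIntegral θ 0 s (w - r) (ν w))) * Complex.I_sq
    have ic' : IntervalIntegrable (fun w => ((a w * (-ξ * (Real.exp (θ * (w - r)) ^ 1 *
        scaledIntegral θ 0 s (w - r) (ν w))) + b ^ 2 / 2 * (-ξ ^ 2 * (Real.exp (θ * (w - r)) ^ 2 *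
            scaledIntegral θ 0 c (w - r) (ν w))) : ℝ) : ℂ)) volume r q :=
      ⟨ic.1.ofReal, ic.2.ofReal⟩
    have is' : IntervalIntegrable (fun w => ((a w * (ξ * (Real.exp (θ * (w - r)) ^ 1 *
        scaledIntegral θ 0 c (w - r) (ν w))) + b ^ 2 / 2 * (-ξ ^ 2 * (Real.exp (θ * (w - r)) ^ 2 *
            scaledIntegral θ 0 s (w - r) (ν w))) : ℝ) : ℂ)) volume r q :=
      ⟨is.1.ofReal, is.2.ofReal⟩
    simp_rw [hkY]
    refine ⟨ic'.add (is'.const_mul _), ?_⟩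
    rw [intervalIntegral.integral_add ic' (is'.const_mul _), intervalIntegral.integral_const_mul,
      intervalIntegral.integral_ofReal, intervalIntegral.integral_ofReal]
    simp only [hY, hCq, hSq, sub_self]
    rw [hCe, hSe]
    push_cast
    ring
  have hYc : ContinuousOn Y (Set.Icc r t) := by
    have := continuousOn_primitive_Icc hrt (hYeq t hrt le_rfl).1
    exact (continuousOn_const.add this).congr fun q hq => (hYeq q hq.1 hq.2).2
  have hfin := eq_mul_exp_of_integral_eq hrt hkint hYc fun x y hx hxy hy => by
    have e1 := (hYeq x hx (hxy.trans hy)).2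
    have e2 := (hYeq y (hx.trans hxy) hy).2
    have e3 := integral_sub_integral_of_mem (hYeq t hrt le_rfl).1 hx hxy hy
    rw [← e3, e2, e1]
    ring
  rw [← hcharFun, ← hcharFun] at hfin
  simpa [he] using hfin

end

/-! ### Gaussian solutions of the Fokker-Planck equation -/

/-- The mean at time `q` of the controlled dynamics with mean `m` at time `r`. -/
noncomputable def meanFlow (θ : ℝ) (a : ℝ → ℝ) (r q m : ℝ) : ℝ :=
  Real.exp (-(θ * (q - r))) * (m + ∫ w in r..q, a w * Real.exp (θ * (w - r)))

lemma charFun_gaussianLaw (m ξ : ℝ) {z : ℝ} (hz : 0 ≤ z) :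
    charFun (gaussianLaw m z : Measure ℝ) ξ =
      Complex.exp (ξ * m * Complex.I - z * ξ ^ 2 / 2) := by
  have := charFun_gaussianReal (μ := m) (v := z.toNNReal) ξ
  rw [Real.coe_toNNReal z hz] at this
  exact this

/-- Lévy's continuity theorem, which also covers limits that degenerate to a Dirac mass. -/
lemma tendsto_gaussianLaw {ι : Type*} {l : Filter ι} [l.IsCountablyGenerated] {m z : ι → ℝ}
    {m₀ z₀ : ℝ} (hm : Tendsto m l (𝓝 m₀)) (hz : Tendsto z l (𝓝 z₀)) (hz0 : ∀ i, 0 ≤ z i)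
    (hz₀ : 0 ≤ z₀) : Tendsto (fun i => gaussianLaw (m i) (z i)) l (𝓝 (gaussianLaw m₀ z₀)) := by
  refine tendsto_of_seq_tendsto fun x hx => ProbabilityMeasure.tendsto_of_tendsto_charFun ?_
  intro ξ
  rw [charFun_gaussianLaw _ _ hz₀]
  refine Tendsto.congr (fun n => (charFun_gaussianLaw _ _ (hz0 (x n))).symm) ?_
  have h1 : Tendsto (fun n => ((m (x n) : ℝ) : ℂ)) atTop (𝓝 (m₀ : ℂ)) :=
    (Complex.continuous_ofReal.tendsto _).comp (hm.comp hx)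
  have h2 : Tendsto (fun n => ((z (x n) : ℝ) : ℂ)) atTop (𝓝 (z₀ : ℂ)) :=
    (Complex.continuous_ofReal.tendsto _).comp (hz.comp hx)
  refine (Complex.continuous_exp.tendsto _).comp ?_
  exact ((h1.const_mul _).mul_const _).sub ((h2.mul_const _).div_const _)

/-- In the moving coordinate the noise accumulates with weight e^{2θ(w-r)}; the substitution u = t -
w brings it to the discounted form used in `ouVar`. -/
lemma integral_exp_sq (θ r t : ℝ) : ∫ w in r..t, Real.exp (θ * (w - r)) ^ 2 =
    Real.exp (θ * (t - r)) ^ 2 * discountIntegral θ (t - r) := by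
  have := intervalIntegral.integral_comp_sub_left (a := r) (b := t)
    (fun u => Real.exp (-2 * θ * u)) t
  rw [sub_self] at this
  rw [discountIntegral, ← this, ← intervalIntegral.integral_const_mul]
  congr 1
  ext w
  rw [← Real.exp_nat_mul, ← Real.exp_nat_mul, ← Real.exp_add]
  congr 1
  push_cast
  ring

/-- The Fokker-Planck equation preserves Gaussian laws; in particular its solution started from a
Gaussian law is unique. -/
lemma SolvesFokkerPlanck.eq_gaussianLaw {θ b r t : ℝ} {a : ℝ → ℝ} {ν : ℝ → ProbabilityMeasure ℝ}
    (hrt : r ≤ t) (h : SolvesFokkerPlanck θ b a ν r t) (ha : IntervalIntegrable a volume r t)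
    {m z : ℝ} (hz : 0 ≤ z) (h0 : ν r = gaussianLaw m z) :
    ν t = gaussianLaw (meanFlow θ a r t m) (ouVar θ b (t - r) z) := by
  suffices h : charFun (ν t : Measure ℝ) =
      charFun (gaussianLaw (meanFlow θ a r t m) (ouVar θ b (t - r) z) : Measure ℝ) from
    ProbabilityMeasure.toMeasure_injective (Measure.ext_of_charFun h)
  ext η
  set e := Real.exp (θ * (t - r)) with he
  have he0 : (e : ℂ) ≠ 0 := Complex.ofReal_ne_zero.2 (Real.exp_pos _).ne'
  -- The initial frequency is chosen so that the frequency reached at time t is η.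
  have key := h.charFun_eq hrt ha (η / e)
  have hv := ouVar_nonneg θ b (sub_nonneg.2 hrt) hz
  have hae : IntervalIntegrable (fun w => a w * Real.exp (θ * (w - r))) volume r t :=
    ha.mul_continuousOn (Continuous.continuousOn (by fun_prop))
  have hae' : IntervalIntegrable (fun w => ((a w * Real.exp (θ * (w - r)) : ℝ) : ℂ))
      volume r t := ⟨hae.1.ofReal, hae.2.ofReal⟩
  have hI : (∫ w in r..t, (Complex.I * ((η / e : ℝ) : ℂ) *
      (a w * Real.exp (θ * (w - r)) : ℝ) -
        ((η / e : ℝ) : ℂ) ^ 2 * (b ^ 2 / 2 * Real.exp (θ * (w - r)) ^ 2 : ℝ))) =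
      Complex.I * ((η / e : ℝ) : ℂ) * ((∫ w in r..t, a w * Real.exp (θ * (w - r)) : ℝ) : ℂ) -
        ((η / e : ℝ) : ℂ) ^ 2 * ((b ^ 2 / 2 * (e ^ 2 * discountIntegral θ (t - r)) : ℝ) : ℂ) := by
    rw [intervalIntegral.integral_sub (hae'.const_mul _)
      (Continuous.intervalIntegrable (by fun_prop) _ _), intervalIntegral.integral_const_mul,
      intervalIntegral.integral_const_mul, intervalIntegral.integral_ofReal,
      intervalIntegral.integral_ofReal, intervalIntegral.integral_const_mul, integral_exp_sq]
  rw [div_mul_cancel₀ _ (Real.exp_pos _).ne', hI, h0, charFun_gaussianLaw _ _ hz,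
    ← Complex.exp_add] at key
  rw [charFun_gaussianLaw _ _ hv, key]
  congr 1
  have he1 : Real.exp (-(θ * (t - r))) = e⁻¹ := by rw [he, Real.exp_neg]
  have he2 : Real.exp (-2 * θ * (t - r)) = e⁻¹ ^ 2 := by
    rw [← he1, ← Real.exp_nat_mul]; congr 1; push_cast; ring
  rw [meanFlow, ouVar, he1, he2]
  push_cast
  field_simp
  ring

/-! ### Averages of test functions under Gaussian laws -/

/-- The standard Gaussian average of `f(m + σ x)`. -/
noncomputable def gaussAvg (f : ℝ → ℝ) (m σ : ℝ) : ℝ := ∫ x, f (m + σ * x) ∂(gaussianReal 0 1)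

lemma gaussianReal_eq_map (m : ℝ) {z : ℝ} (hz : 0 ≤ z) :
    gaussianReal m z.toNNReal = (gaussianReal 0 1).map fun x => m + √z * x := by
  have h1 : (gaussianReal 0 1).map (fun x => √z * x) = gaussianReal 0 z.toNNReal := by
    rw [gaussianReal_map_const_mul, mul_zero, mul_one]
    congr 1
    ext
    simp [Real.sq_sqrt hz, Real.coe_toNNReal z hz]
  have h2 : (fun x => m + √z * x) = (fun y => m + y) ∘ fun x => √z * x := rfl
  rw [h2, ← Measure.map_map (by fun_prop) (by fun_prop), h1, gaussianReal_map_const_add, zero_add]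

lemma integral_gaussianLaw {f : ℝ → ℝ} (hf : Continuous f) (m : ℝ) {z : ℝ} (hz : 0 ≤ z) :
    ∫ x, f x ∂(gaussianLaw m z : Measure ℝ) = gaussAvg f m √z := by
  change ∫ x, f x ∂(gaussianReal m z.toNNReal) = _
  rw [gaussianReal_eq_map m hz, integral_map (by fun_prop) hf.aestronglyMeasurable]
  rfl

lemma integrable_id_gaussianReal : Integrable (fun x : ℝ => x) (gaussianReal 0 1) :=
  (memLp_id_gaussianReal 1).integrable (by simp)

namespace IsTest

variable {f : ℝ → ℝ}

lemma integrable_comp_affine (hf : IsTest f) (m σ : ℝ) :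
    Integrable (fun x => f (m + σ * x)) (gaussianReal 0 1) := by
  obtain ⟨K, _, hK⟩ := hf.bounded
  have := hf.continuous
  exact Integrable.of_bound (Continuous.aestronglyMeasurable (by fun_prop)) K
    (Eventually.of_forall fun x => hK _)

lemma integrable_comp_affine_mul (hf : IsTest f) (m σ : ℝ) :
    Integrable (fun x => f (m + σ * x) * x) (gaussianReal 0 1) := by
  obtain ⟨K, _, hK⟩ := hf.bounded
  have := hf.continuous
  exact integrable_id_gaussianReal.bdd_mul (c := K)
    (Continuous.aestronglyMeasurable (by fun_prop)) (Eventually.of_forall fun x => hK _)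

lemma continuous_gaussAvg (hf : IsTest f) : Continuous fun p : ℝ × ℝ => gaussAvg f p.1 p.2 := by
  obtain ⟨K, _, hK⟩ := hf.bounded
  have := hf.continuous
  exact continuous_of_dominated (bound := fun _ => K)
    (fun p => Continuous.aestronglyMeasurable (by fun_prop))
    (fun p => Eventually.of_forall fun x => hK _) (integrable_const _)
    (Eventually.of_forall fun x => by fun_prop)

/-- Differentiation under the integral, dominated by K(1 + |x|). The parameter is the standard
deviation because f(m + σx) is smooth in σ even at σ = 0. -/
lemma hasDerivAt_gaussAvg (hf : IsTest f) {m σ : ℝ → ℝ} {m' σ' q : ℝ} (hm : HasDerivAt m m' q)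
    (hσ : HasDerivAt σ σ' q) :
    HasDerivAt (fun q => gaussAvg f (m q) (σ q)) (m' * gaussAvg (_root_.deriv f) (m q) (σ q) +
      σ' * ∫ x, _root_.deriv f (m q + σ q * x) * x ∂(gaussianReal 0 1)) q := by
  obtain ⟨K, hK0, hK⟩ := hf.deriv.bounded
  have hc := hf.continuous
  have hc' := hf.deriv.continuous
  let F' : ℝ × ℝ → ℝ → (ℝ × ℝ →L[ℝ] ℝ) := fun p x => _root_.deriv f (p.1 + p.2 * x) •
    (ContinuousLinearMap.fst ℝ ℝ ℝ + x • ContinuousLinearMap.snd ℝ ℝ ℝ)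
  have hb : ∀ p x, ‖F' p x‖ ≤ K * (1 + |x|) := fun p x => by
    rw [norm_smul]
    refine mul_le_mul (hK _) ((norm_add_le _ _).trans (add_le_add
      (ContinuousLinearMap.norm_fst_le ..) ?_)) (norm_nonneg _) hK0
    rw [norm_smul, Real.norm_eq_abs]
    exact (mul_le_mul_of_nonneg_left (ContinuousLinearMap.norm_snd_le ..) (abs_nonneg x)).trans
      (mul_one _).le
  have hbi : Integrable (fun x : ℝ => K * (1 + |x|)) (gaussianReal 0 1) :=
    ((integrable_const _).add integrable_id_gaussianReal.abs).const_mul K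
  have hF'm : AEStronglyMeasurable (F' (m q, σ q)) (gaussianReal 0 1) :=
    Continuous.aestronglyMeasurable (by fun_prop)
  have h1 : HasFDerivAt (fun p : ℝ × ℝ => gaussAvg f p.1 p.2)
      (∫ x, F' (m q, σ q) x ∂(gaussianReal 0 1)) (m q, σ q) := by
    refine hasFDerivAt_integral_of_dominated_of_fderiv_le (F' := F')
      (bound := fun x => K * (1 + |x|)) univ_mem
      (Eventually.of_forall fun p => Continuous.aestronglyMeasurable (by fun_prop))
      (hf.integrable_comp_affine _ _) hF'm
      (Eventually.of_forall fun x p _ => hb p x) hbi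
      (Eventually.of_forall fun x p _ => ?_)
    refine HasDerivAt.comp_hasFDerivAt p (hf.hasDerivAt (p.1 + p.2 * x)) ?_
    have := (hasFDerivAt_fst (𝕜 := ℝ) (p := p)).add
      ((hasFDerivAt_snd (𝕜 := ℝ) (p := p)).mul_const x)
    exact this
  have h2 := h1.comp_hasDerivAt q (hm.prodMk hσ)
  refine HasDerivAt.congr_deriv h2 ?_
  rw [ContinuousLinearMap.integral_apply (hbi.mono' hF'm (Eventually.of_forall (hb _)))]
  unfold gaussAvg
  rw [← integral_const_mul, ← integral_const_mul, ← integral_add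
    ((hf.deriv.integrable_comp_affine _ _).const_mul _)
    ((hf.deriv.integrable_comp_affine_mul _ _).const_mul _)]
  congr 1
  ext x
  simp only [F', smul_apply, add_apply,
    ContinuousLinearMap.coe_fst', ContinuousLinearMap.coe_snd', smul_eq_mul]
  ring

/-- Gaussian integration by parts. -/
lemma gaussAvg_mul_id (hf : IsTest f) (m σ : ℝ) :
    ∫ x, f (m + σ * x) * x ∂(gaussianReal 0 1) = σ * gaussAvg (_root_.deriv f) m σ := by
  have hφ : ∀ x, HasDerivAt (fun x => -gaussianPDFReal 0 1 x) (x * gaussianPDFReal 0 1 x) x := by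
    intro x
    have h1 : HasDerivAt (fun x : ℝ => -(x - 0) ^ 2 / (2 * ((1 : ℝ≥0) : ℝ))) (-x) x := by
      have := (((hasDerivAt_id x).sub_const 0).pow 2).neg.div_const (2 * ((1 : ℝ≥0) : ℝ))
      refine HasDerivAt.congr_deriv this ?_
      simp; ring
    have := (h1.exp.const_mul ((√(2 * Real.pi * ((1 : ℝ≥0) : ℝ)))⁻¹)).neg
    refine HasDerivAt.congr_deriv this ?_
    simp only [gaussianPDFReal]; ring
  have hu : ∀ x, HasDerivAt (fun x => f (m + σ * x)) (σ * _root_.deriv f (m + σ * x)) x := by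
    intro x
    have h1 : HasDerivAt (fun x : ℝ => m + σ * x) σ x := by
      simpa using ((hasDerivAt_id x).const_mul σ).const_add m
    refine HasDerivAt.congr_deriv ((hf.hasDerivAt _).comp x h1) (by ring)
  have hne : (1 : ℝ≥0) ≠ 0 := one_ne_zero
  have hi : ∀ g : ℝ → ℝ, Integrable g (gaussianReal 0 1) →
      Integrable fun x => gaussianPDFReal 0 1 x * g x := fun g hg => by
    rw [gaussianReal_of_var_ne_zero _ hne] at hg
    have := (integrable_withDensity_iff_integrable_smul' (measurable_gaussianPDF 0 1)
      (Eventually.of_forall fun x => gaussianPDF_lt_top)).1 hg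
    simpa using this
  rw [gaussAvg, integral_gaussianReal_eq_integral_smul hne,
    integral_gaussianReal_eq_integral_smul hne]
  have key := integral_mul_deriv_eq_deriv_mul_of_integrable (fun x _ => hu x) (fun x _ => hφ x)
    ((hi _ (hf.integrable_comp_affine_mul m σ)).congr (Eventually.of_forall fun x => by
      simp only [Pi.mul_apply]; ring))
    ((hi _ ((hf.deriv.integrable_comp_affine m σ).const_mul (-σ))).congr
      (Eventually.of_forall fun x => by simp only [Pi.mul_apply]; ring))
    ((hi _ ((hf.integrable_comp_affine m σ).const_mul (-1))).congr
      (Eventually.of_forall fun x => by simp only [Pi.mul_apply]; ring))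
  rw [← integral_const_mul, ← integral_congr_ae (f := fun x => f (m + σ * x) *
    (x * gaussianPDFReal 0 1 x)) (Eventually.of_forall fun x => by simp only [smul_eq_mul]; ring),
    key, ← integral_neg]
  congr 1
  ext x
  simp only [smul_eq_mul]; ring

/-- Writing the state as m + √z x, integration by parts turns the fluctuating part of the drift,
-θ√z x f', into -θz f''. The two coefficients are then the velocity of the mean and half that of the
variance. -/
lemma integral_ouGenerator_gaussianLaw (hf : IsTest f) (θ b a m : ℝ) {z : ℝ} (hz : 0 ≤ z) :
    ∫ x, ouGenerator θ b a f x ∂(gaussianLaw m z : Measure ℝ) =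
      (-θ * m + a) * gaussAvg (_root_.deriv f) m √z +
      (b ^ 2 / 2 - θ * z) * gaussAvg (_root_.deriv (_root_.deriv f)) m √z := by
  have hc1 := hf.deriv.continuous
  have hc2 := hf.deriv.deriv.continuous
  rw [integral_gaussianLaw (by unfold ouGenerator; fun_prop) m hz]
  have hz2 : θ * z = θ * √z * √z := by rw [mul_assoc, Real.mul_self_sqrt hz]
  have i1 := (hf.deriv.integrable_comp_affine m √z).const_mul (-θ * m + a)
  have i2 := (hf.deriv.integrable_comp_affine_mul m √z).const_mul (-θ * √z)
  have i3 := (hf.deriv.deriv.integrable_comp_affine m √z).const_mul (b ^ 2 / 2)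
  have : gaussAvg (ouGenerator θ b a f) m √z =
      (-θ * m + a) * gaussAvg (_root_.deriv f) m √z +
      -θ * √z * ∫ x, _root_.deriv f (m + √z * x) * x ∂(gaussianReal 0 1) +
      b ^ 2 / 2 * gaussAvg (_root_.deriv (_root_.deriv f)) m √z := by
    unfold gaussAvg
    rw [← integral_const_mul, ← integral_const_mul, ← integral_const_mul, ← integral_add i1 i2,
      ← integral_add (i1.fun_add i2) i3]
    congr 1
    ext x
    simp only [ouGenerator]
    ring
  rw [this, hf.deriv.gaussAvg_mul_id, hz2]
  ring

end IsTest

/-- The fundamental theorem of calculus is applied with derivatives in the open interval only: when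
z = 0 the standard deviation need not be differentiable at r. -/
lemma gaussianLaw_solvesFokkerPlanck {θ b r t z : ℝ} {a m : ℝ → ℝ} (hz : 0 ≤ z)
    (ha : ContinuousOn a (Set.Icc r t)) (hm : ContinuousOn m (Set.Icc r t))
    (hm' : ∀ q ∈ Set.Ioo r t, HasDerivAt m (-θ * m q + a q) q) :
    SolvesFokkerPlanck θ b a (fun q => gaussianLaw (m q) (ouVar θ b (q - r) z)) r t := by
  intro f hf x y hx hxy hy
  have hv : ∀ q, r ≤ q → 0 ≤ ouVar θ b (q - r) z := fun q hq =>
    ouVar_nonneg θ b (sub_nonneg.2 hq) hz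
  have hvc : Continuous fun q => ouVar θ b (q - r) z :=
    (continuous_ouVar_left θ b z).comp (continuous_id.sub continuous_const)
  have hvd : ∀ q, HasDerivAt (fun q => ouVar θ b (q - r) z)
      (b ^ 2 - 2 * θ * ouVar θ b (q - r) z) q := fun q => by
    exact HasDerivAt.comp_sub_const q r (hasDerivAt_ouVar θ b (q - r) z)
  have hsub : Set.Icc x y ⊆ Set.Icc r t := Set.Icc_subset_Icc hx hy
  have hcont : ∀ g, IsTest g → ContinuousOn
      (fun q => gaussAvg g (m q) √(ouVar θ b (q - r) z)) (Set.Icc x y) := fun g hg =>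
    hg.continuous_gaussAvg.comp_continuousOn
      ((hm.mono hsub).prodMk hvc.sqrt.continuousOn)
  have hgen : Set.EqOn (fun q => ∫ z', ouGenerator θ b (a q) f z'
        ∂(gaussianLaw (m q) (ouVar θ b (q - r) z) : Measure ℝ))
      (fun q => (-θ * m q + a q) * gaussAvg (deriv f) (m q) √(ouVar θ b (q - r) z) +
      (b ^ 2 / 2 - θ * ouVar θ b (q - r) z) *
        gaussAvg (deriv (deriv f)) (m q) √(ouVar θ b (q - r) z)) (Set.Icc x y) := fun q hq =>
    hf.integral_ouGenerator_gaussianLaw θ b (a q) (m q) (hv q (hx.trans hq.1))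
  have hgc : ContinuousOn (fun q => ∫ z', ouGenerator θ b (a q) f z'
        ∂(gaussianLaw (m q) (ouVar θ b (q - r) z) : Measure ℝ)) (Set.Icc x y) := by
    refine ContinuousOn.congr ?_ hgen
    refine ContinuousOn.add (ContinuousOn.mul ?_ (hcont _ hf.deriv))
      (ContinuousOn.mul ?_ (hcont _ hf.deriv.deriv))
    · exact ((hm.mono hsub).const_mul _).add (ha.mono hsub)
    · exact Continuous.continuousOn (by fun_prop)
  have hint : IntervalIntegrable (fun q => ∫ z', ouGenerator θ b (a q) f z'
        ∂(gaussianLaw (m q) (ouVar θ b (q - r) z) : Measure ℝ)) volume x y :=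
    ContinuousOn.intervalIntegrable (by rwa [Set.uIcc_of_le hxy])
  refine ⟨hint, ?_⟩
  rw [intervalIntegral.integral_eq_sub_of_hasDerivAt_of_le hxy (hcont f hf) ?_ hint,
    integral_gaussianLaw hf.continuous _ (hv y (hx.trans hxy)),
    integral_gaussianLaw hf.continuous _ (hv x hx)]
  · ring
  · intro q hq
    have hq1 : r < q := hx.trans_lt hq.1
    have hmq := hm' q ⟨hq1, hq.2.trans_le hy⟩
    refine HasDerivAt.congr_deriv ?_ (hgen ⟨hq.1.le, hq.2.le⟩).symm
    dsimp only
    rcases ouVar_pos_or θ b hz with hpos | ⟨hb, hzero⟩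
    · have hp := hpos (q - r) (sub_pos.2 hq1)
      have hσ := (hvd q).sqrt hp.ne'
      refine HasDerivAt.congr_deriv (hf.hasDerivAt_gaussAvg hmq hσ) ?_
      rw [hf.deriv.gaussAvg_mul_id]
      have : √(ouVar θ b (q - r) z) ≠ 0 := (Real.sqrt_pos.2 hp).ne'
      field_simp
    · simp only [hzero, Real.sqrt_zero]
      refine HasDerivAt.congr_deriv (hf.hasDerivAt_gaussAvg hmq (hasDerivAt_const q 0)) ?_
      simp [hb]

/-! ### The cost on a time interval without observations -/

/-- The product rule for W n² when n is only a primitive of an integrable function, again obtained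
from second order increments. -/
lemma weighted_sq_sub_eq_integral {W W' n β : ℝ → ℝ} {r t : ℝ} (hrt : r ≤ t)
    (hβ : IntervalIntegrable β volume r t) (hW : ∀ x ∈ Set.Icc r t, HasDerivAt W (W' x) x)
    (hW' : ContinuousOn W' (Set.Icc r t))
    (hn : ∀ x y, r ≤ x → x ≤ y → y ≤ t → n y - n x = ∫ w in x..y, β w) :
    IntervalIntegrable (fun w => W' w * n w ^ 2 + 2 * W w * n w * β w) volume r t ∧
    W t * n t ^ 2 - W r * n r ^ 2 = ∫ w in r..t, (W' w * n w ^ 2 + 2 * W w * n w * β w) := by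
  have hnS : ∀ x y, r ≤ x → x ≤ y → y ≤ t →
      |n y - n x| ≤ 1 * (controlClock β r y - controlClock β r x) := by
    intro x y hx hxy hy
    rw [hn x y hx hxy hy, controlClock_sub hβ hx hxy hy, one_mul]
    exact intervalIntegral.norm_integral_le_of_norm_le (E := ℝ) hxy
      (Eventually.of_forall fun w _ => by rw [Real.norm_eq_abs]; linarith)
      (hβ.one_add_abs.mono_Icc hx hxy hy)
  have hnc : ContinuousOn n (Set.Icc r t) :=
    continuousOn_of_increment_bound (continuousOn_controlClock hrt hβ) hnS
  have hWc : ContinuousOn W (Set.Icc r t) := fun x hx => (hW x hx).continuousAt.continuousWithinAt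
  have hu : Set.uIcc r t = Set.Icc r t := Set.uIcc_of_le hrt
  have h1 : IntervalIntegrable (fun w => W' w * n w ^ 2) volume r t :=
    ContinuousOn.intervalIntegrable (by rw [hu]; exact hW'.mul (hnc.pow 2))
  have h2 : IntervalIntegrable (fun w => 2 * W w * n w * β w) volume r t :=
    hβ.continuousOn_mul (by rw [hu]; exact (hWc.const_mul 2).mul hnc)
  have hF := h1.add h2
  refine ⟨hF, ?_⟩
  obtain ⟨B, hB⟩ := isCompact_Icc.exists_bound_of_continuousOn hWc
  obtain ⟨B', hB'⟩ := isCompact_Icc.exists_bound_of_continuousOn hW'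
  obtain ⟨N, hN⟩ := isCompact_Icc.exists_bound_of_continuousOn hnc
  have hr : r ∈ Set.Icc r t := ⟨le_rfl, hrt⟩
  have hB0 : 0 ≤ B := (norm_nonneg _).trans (hB r hr)
  have hB'0 : 0 ≤ B' := (norm_nonneg _).trans (hB' r hr)
  have hN0 : 0 ≤ N := (norm_nonneg _).trans (hN r hr)
  simp only [Real.norm_eq_abs] at hB hB' hN
  set S := controlClock β r with hS
  set K := B' * (2 * N) + (2 * B + 2 * B' * N) with hK
  set D : ℝ → ℝ := fun q => W q * n q ^ 2 -
    ∫ w in r..q, (W' w * n w ^ 2 + 2 * W w * n w * β w) with hD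
  have hconst : D t = D r := by
    refine eq_of_norm_sub_le_sq (K := K) hrt (continuousOn_controlClock hrt hβ) ?_
    intro x y hx hxy hy
    have hSxy := sub_le_controlClock_sub hβ hx hxy hy
    refine ⟨by linarith, ?_⟩
    have hβxy := hβ.mono_Icc hx hxy hy
    have hW'i : IntervalIntegrable W' volume r t :=
      ContinuousOn.intervalIntegrable (by rw [hu]; exact hW')
    have hW'xy := hW'i.mono_Icc hx hxy hy
    have hWinc : W y - W x = ∫ w in x..y, W' w := by
      refine (intervalIntegral.integral_eq_sub_of_hasDerivAt (fun w hw => hW w ?_) hW'xy).symm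
      rw [Set.uIcc_of_le hxy] at hw
      exact ⟨hx.trans hw.1, hw.2.trans hy⟩
    -- The increment of the product is arranged so that each bracket vanishes when x = w = y and is
    -- therefore of first order in the clock.
    have hDD : D y - D x = ∫ w in x..y, (W' w * (n y ^ 2 - n w ^ 2) +
        β w * (W x * (n y + n x) - 2 * W w * n w)) := by
      have e1 : D y - D x = (W y - W x) * n y ^ 2 + (n y - n x) * (W x * (n y + n x)) -
          ∫ w in x..y, (W' w * n w ^ 2 + 2 * W w * n w * β w) := by
        rw [← integral_sub_integral_of_mem hF hx hxy hy]
        simp only [hD]; ring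
      rw [e1, hWinc, hn x y hx hxy hy, ← intervalIntegral.integral_mul_const,
        ← intervalIntegral.integral_mul_const, ← intervalIntegral.integral_add
          (hW'xy.mul_const _) (hβxy.mul_const _), ← intervalIntegral.integral_sub
          ((hW'xy.mul_const _).add (hβxy.mul_const _)) (hF.mono_Icc hx hxy hy)]
      congr 1; ext w; ring
    have hKS : K * (S y - S x) ^ 2 = ∫ w in x..y, K * (S y - S x) * (1 + |β w|) := by
      rw [intervalIntegral.integral_const_mul, ← controlClock_sub hβ hx hxy hy]
      ring
    rw [hDD, hKS]
    refine intervalIntegral.norm_integral_le_of_norm_le hxy ?_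
      ((hβ.one_add_abs.const_mul _).mono_Icc hx hxy hy)
    refine Eventually.of_forall fun w hw => ?_
    have hxw := hw.1.le
    have hwy := hw.2
    have mx : x ∈ Set.Icc r t := ⟨hx, hxy.trans hy⟩
    have my : y ∈ Set.Icc r t := ⟨hx.trans hxy, hy⟩
    have mw : w ∈ Set.Icc r t := ⟨hx.trans hxw, hwy.trans hy⟩
    have s1 := sub_le_controlClock_sub hβ hx hxw mw.2
    have s2 := sub_le_controlClock_sub hβ mw.1 hwy hy
    have n1 := hnS x w hx hxw mw.2
    have n2 := hnS w y mw.1 hwy hy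
    have hd0 : 0 ≤ S y - S x := by linarith
    have b1 : |n y ^ 2 - n w ^ 2| ≤ 2 * N * (S y - S x) := by
      rw [show n y ^ 2 - n w ^ 2 = (n y + n w) * (n y - n w) by ring, abs_mul]
      refine mul_le_mul ((abs_add_le _ _).trans ?_) (by linarith) (abs_nonneg _) (by linarith)
      linarith [hN y my, hN w mw]
    have hWl : |W x - W w| ≤ B' * (S y - S x) := by
      have := (convex_Icc x w).norm_image_sub_le_of_norm_hasDerivWithin_le
        (fun v hv => (hW v ⟨hx.trans hv.1, hv.2.trans mw.2⟩).hasDerivWithinAt)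
        (fun v hv => hB' v ⟨hx.trans hv.1, hv.2.trans mw.2⟩) (Set.left_mem_Icc.2 hxw)
        (Set.right_mem_Icc.2 hxw)
      rw [Real.norm_eq_abs, Real.norm_eq_abs, abs_of_nonneg (sub_nonneg.2 hxw)] at this
      rw [abs_sub_comm]
      exact this.trans (mul_le_mul_of_nonneg_left (by linarith) hB'0)
    have b2 : |W x * (n y + n x) - 2 * W w * n w| ≤ (2 * B + 2 * B' * N) * (S y - S x) := by
      rw [show W x * (n y + n x) - 2 * W w * n w =
        W x * ((n y - n w) - (n w - n x)) + 2 * ((W x - W w) * n w) by ring]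
      refine (abs_add_le _ _).trans ?_
      rw [abs_mul, abs_mul, abs_mul, abs_two]
      have c1 : |W x| * |(n y - n w) - (n w - n x)| ≤ B * (2 * (S y - S x)) :=
        mul_le_mul (hB x mx) ((abs_sub _ _).trans (by linarith)) (abs_nonneg _) hB0
      have c2 : |W x - W w| * |n w| ≤ B' * (S y - S x) * N :=
        mul_le_mul hWl (hN w mw) (abs_nonneg _) (by positivity)
      linarith
    rw [Real.norm_eq_abs]
    calc _ ≤ B' * (2 * N * (S y - S x)) + |β w| * ((2 * B + 2 * B' * N) * (S y - S x)) := by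
          refine (abs_add_le _ _).trans ?_
          rw [abs_mul, abs_mul]
          exact add_le_add (mul_le_mul (hB' w mw) b1 (abs_nonneg _) hB'0)
            (mul_le_mul_of_nonneg_left b2 (abs_nonneg _))
      _ ≤ K * (S y - S x) * (1 + |β w|) := by
          have hβ0 := abs_nonneg (β w)
          have : 0 ≤ B' * (2 * N * (S y - S x)) * |β w| := by positivity
          have : 0 ≤ (2 * B + 2 * B' * N) * (S y - S x) := by positivity
          rw [hK]; nlinarith
  simp only [hD, intervalIntegral.integral_same, sub_zero] at hconst
  linarith

section

variable {θ C T r t m : ℝ} {a : ℝ → ℝ}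

lemma meanFlow_self (θ : ℝ) (a : ℝ → ℝ) (r m : ℝ) : meanFlow θ a r r m = m := by
  simp [meanFlow]

lemma intervalIntegrable_mul_exp (ha : IntervalIntegrable a volume r t) :
    IntervalIntegrable (fun w => a w * Real.exp (θ * (w - r))) volume r t :=
  ha.mul_continuousOn (Continuous.continuousOn (by fun_prop))

lemma continuousOn_meanFlow (hrt : r ≤ t) (ha : IntervalIntegrable a volume r t) :
    ContinuousOn (fun q => meanFlow θ a r q m) (Set.Icc r t) :=
  ContinuousOn.mul (Continuous.continuousOn (by fun_prop))
    (continuousOn_const.add (continuousOn_primitive_Icc hrt (intervalIntegrable_mul_exp ha)))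

/-- Completion of the square along the controlled mean. -/
lemma riccati_sq_sub (hC : 0 < C) (hrt : r ≤ t) (htT : t ≤ T)
    (ha : IntervalIntegrable a volume r t) :
    riccati θ C (T - t) * meanFlow θ a r t m ^ 2 - riccati θ C (T - r) * m ^ 2 =
      ∫ w in r..t, ((riccati θ C (T - w) ^ 2 / C - 1) * meanFlow θ a r w m ^ 2 +
        2 * riccati θ C (T - w) * meanFlow θ a r w m * a w) := by
  -- The mean is e^{-θ(q-r)}n. Moving the squared exponential into the differentiable weight W
  -- leaves n with the control alone as its rate, and cancels the term 2θp of the Riccati equation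
  -- in W'.
  set n : ℝ → ℝ := fun q => m + ∫ w in r..q, a w * Real.exp (θ * (w - r)) with hn
  set W : ℝ → ℝ := fun q => riccati θ C (T - q) * Real.exp (-(θ * (q - r))) ^ 2 with hW
  have hint := intervalIntegrable_mul_exp (θ := θ) ha
  have hP : ∀ q, q ≤ T → HasDerivAt (fun q => riccati θ C (T - q))
      (-(1 - 2 * θ * riccati θ C (T - q) - riccati θ C (T - q) ^ 2 / C)) q := fun q hq =>
    HasDerivAt.comp_const_sub T q (hasDerivAt_riccati θ hC (sub_nonneg.2 hq))
  have hE : ∀ q, HasDerivAt (fun q => Real.exp (-(θ * (q - r))))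
      (Real.exp (-(θ * (q - r))) * -θ) q := fun q => by
    have : HasDerivAt (fun q : ℝ => -(θ * (q - r))) (-θ) q := by
      simpa using (((hasDerivAt_id q).sub_const r).const_mul θ).fun_neg
    exact this.exp
  have hWd : ∀ q ∈ Set.Icc r t, HasDerivAt W
      ((riccati θ C (T - q) ^ 2 / C - 1) * Real.exp (-(θ * (q - r))) ^ 2) q := fun q hq => by
    refine HasDerivAt.congr_deriv ((hP q (hq.2.trans htT)).mul ((hE q).pow 2)) ?_
    push_cast
    ring
  have hPc : ContinuousOn (fun q => riccati θ C (T - q)) (Set.Icc r t) := fun q hq =>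
    (hP q (hq.2.trans htT)).continuousAt.continuousWithinAt
  have key := (weighted_sq_sub_eq_integral (n := n) hrt hint hWd
    ((((hPc.pow 2).div_const C).sub continuousOn_const).mul
      (Continuous.continuousOn (by fun_prop))) fun x y hx hxy hy => by
        simp only [hn]
        rw [add_sub_add_left_eq_sub]
        exact integral_sub_integral_of_mem hint hx hxy hy).2
  have hm : ∀ q, meanFlow θ a r q m = Real.exp (-(θ * (q - r))) * n q := fun q => rfl
  have e1 : W t * n t ^ 2 = riccati θ C (T - t) * meanFlow θ a r t m ^ 2 := by
    rw [hm, hW]; ring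
  have e2 : W r * n r ^ 2 = riccati θ C (T - r) * m ^ 2 := by
    simp [hW, hn]
  rw [← e1, ← e2, key]
  congr 1
  ext w
  rw [hm, hW]
  have : Real.exp (θ * (w - r)) * Real.exp (-(θ * (w - r))) = 1 := by
    rw [← Real.exp_add, add_neg_cancel, Real.exp_zero]
  linear_combination (2 * riccati θ C (T - w) * Real.exp (-(θ * (w - r))) * n w * a w) * this

variable {b z : ℝ} {g : ℝ → ℝ}

lemma continuousOn_riccati_sub (hC : 0 < C) :
    ContinuousOn (fun q => riccati θ C (T - q)) (Set.Iic T) := fun _ hq =>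
  ((hasDerivAt_riccati θ hC (sub_nonneg.2 hq)).comp_const_sub T _).continuousAt.continuousWithinAt

/-- The cost on an interval with a square integrable control. -/
lemma ofReal_cost_eq (hC : 0 < C) (hrt : r ≤ t) (htT : t ≤ T) (hz : 0 ≤ z)
    (hg : ∀ z, 0 ≤ z → 0 ≤ g z) (ha : IntervalIntegrable a volume r t)
    (ha2 : IntervalIntegrable (fun w => a w ^ 2) volume r t) :
    (∫⁻ q in Set.Ioc r t, ENNReal.ofReal (meanFlow θ a r q m ^ 2 + ouVar θ b (q - r) z +
        C * a q ^ 2)) +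
      ENNReal.ofReal (riccati θ C (T - t) * meanFlow θ a r t m ^ 2 +
        g (ouVar θ b (t - r) z)) =
    ENNReal.ofReal (riccati θ C (T - r) * m ^ 2 + varCost θ b g (t - r) z +
      ∫ q in r..t, C * (a q + riccati θ C (T - q) * meanFlow θ a r q m / C) ^ 2) := by
  have hu : Set.uIcc r t = Set.Icc r t := Set.uIcc_of_le hrt
  have hmc := continuousOn_meanFlow (θ := θ) (m := m) hrt ha
  have hPc : ContinuousOn (fun q => riccati θ C (T - q)) (Set.Icc r t) :=
    (continuousOn_riccati_sub hC).mono fun q hq => hq.2.trans htT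
  have hvc : Continuous fun q => ouVar θ b (q - r) z :=
    (continuous_ouVar_left θ b z).comp (continuous_id.sub continuous_const)
  have i1 : IntervalIntegrable (fun q => meanFlow θ a r q m ^ 2) volume r t :=
    ContinuousOn.intervalIntegrable (by rw [hu]; exact hmc.pow 2)
  have i2 : IntervalIntegrable (fun q => ouVar θ b (q - r) z) volume r t :=
    hvc.intervalIntegrable _ _
  have i3 := ha2.const_mul C
  have i4 : IntervalIntegrable (fun w => (riccati θ C (T - w) ^ 2 / C - 1) *
      meanFlow θ a r w m ^ 2) volume r t :=
    ContinuousOn.intervalIntegrable (by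
      rw [hu]; exact (((hPc.pow 2).div_const C).sub continuousOn_const).mul (hmc.pow 2))
  have i5 : IntervalIntegrable (fun w => 2 * riccati θ C (T - w) * meanFlow θ a r w m * a w)
      volume r t := ha.continuousOn_mul (by rw [hu]; exact (hPc.const_mul 2).mul hmc)
  have iv : ∫ q in r..t, ouVar θ b (q - r) z = ∫ q in (0 : ℝ)..(t - r), ouVar θ b q z := by
    rw [intervalIntegral.integral_comp_sub_right (fun q => ouVar θ b q z) r, sub_self]
  have hnn : ∀ q ∈ Set.Ioc r t, 0 ≤ meanFlow θ a r q m ^ 2 + ouVar θ b (q - r) z + C * a q ^ 2 :=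
    fun q hq => by
    have := ouVar_nonneg θ b (sub_nonneg.2 hq.1.le) hz
    positivity
  have hend : 0 ≤ riccati θ C (T - t) * meanFlow θ a r t m ^ 2 + g (ouVar θ b (t - r) z) := by
    have := (riccati_pos θ hC (sub_nonneg.2 htT)).le
    have := hg _ (ouVar_nonneg θ b (sub_nonneg.2 hrt) hz)
    positivity
  rw [← ofReal_integral_eq_lintegral_ofReal ((i1.add i2).add i3).1
    ((ae_restrict_mem measurableSet_Ioc).mono hnn), ← intervalIntegral.integral_of_le hrt,
    ← ENNReal.ofReal_add (intervalIntegral.integral_nonneg_of_ae_restrict hrt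
      ((ae_restrict_mem measurableSet_Icc).mono fun q hq => by
        have := ouVar_nonneg θ b (sub_nonneg.2 hq.1) hz
        positivity)) hend]
  congr 1
  have key := riccati_sq_sub (θ := θ) (m := m) hC hrt htT ha
  rw [intervalIntegral.integral_add i4 i5] at key
  -- In the expanded square, p²m²/C is written as (p²/C - 1)m² + m²: the first part belongs to
  -- `riccati_sq_sub`, the second is the running cost of the mean.
  have hsq : ∫ q in r..t, C * (a q + riccati θ C (T - q) * meanFlow θ a r q m / C) ^ 2 =
      (∫ q in r..t, C * a q ^ 2) +
      (∫ w in r..t, 2 * riccati θ C (T - w) * meanFlow θ a r w m * a w) +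
      ((∫ w in r..t, (riccati θ C (T - w) ^ 2 / C - 1) * meanFlow θ a r w m ^ 2) +
      ∫ q in r..t, meanFlow θ a r q m ^ 2) := by
    rw [← intervalIntegral.integral_add i3 i5, ← intervalIntegral.integral_add i4 i1,
      ← intervalIntegral.integral_add (i3.add i5) (i4.add i1)]
    congr 1; ext q; field_simp; ring
  rw [intervalIntegral.integral_add (i1.add i2) i3, intervalIntegral.integral_add i1 i2, iv, hsq,
    varCost]
  linarith

/-- If the running cost is infinite there is nothing to show; otherwise the control is square
integrable, and the excess over the left side is the integral of a square. -/
lemma le_cost_Ioc (hC : 0 < C) (hrt : r ≤ t) (htT : t ≤ T) (hz : 0 ≤ z)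
    (hg : ∀ z, 0 ≤ z → 0 ≤ g z) (ha : IntervalIntegrable a volume r t) :
    ENNReal.ofReal (riccati θ C (T - r) * m ^ 2 + varCost θ b g (t - r) z) ≤
    (∫⁻ q in Set.Ioc r t, ENNReal.ofReal (meanFlow θ a r q m ^ 2 + ouVar θ b (q - r) z +
        C * a q ^ 2)) +
      ENNReal.ofReal (riccati θ C (T - t) * meanFlow θ a r t m ^ 2 +
        g (ouVar θ b (t - r) z)) := by
  by_cases hfin : ∫⁻ q in Set.Ioc r t, ENNReal.ofReal (meanFlow θ a r q m ^ 2 +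
      ouVar θ b (q - r) z + C * a q ^ 2) = ⊤
  · rw [hfin, top_add]; exact le_top
  have ha2 : IntervalIntegrable (fun w => a w ^ 2) volume r t := by
    rw [intervalIntegrable_iff_integrableOn_Ioc_of_le hrt]
    have hmeas : AEStronglyMeasurable (fun w => C * a w ^ 2) (volume.restrict (Set.Ioc r t)) :=
      (ha.1.aestronglyMeasurable.pow 2).const_mul C
    have hCa : IntegrableOn (fun w => C * a w ^ 2) (Set.Ioc r t) := by
      refine ⟨hmeas, ?_⟩
      rw [hasFiniteIntegral_iff_ofReal (Eventually.of_forall fun w => by positivity)]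
      refine lt_of_le_of_lt ?_ (lt_top_iff_ne_top.2 hfin)
      refine setLIntegral_mono' measurableSet_Ioc fun q hq => ENNReal.ofReal_le_ofReal ?_
      have := ouVar_nonneg θ b (sub_nonneg.2 hq.1.le) hz
      nlinarith [sq_nonneg (meanFlow θ a r q m)]
    have := hCa.const_mul C⁻¹
    refine this.congr (Eventually.of_forall fun w => ?_)
    field_simp
  rw [ofReal_cost_eq hC hrt htT hz hg ha ha2]
  refine ENNReal.ofReal_le_ofReal ?_
  have : 0 ≤ ∫ q in r..t, C * (a q + riccati θ C (T - q) * meanFlow θ a r q m / C) ^ 2 :=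
    intervalIntegral.integral_nonneg hrt fun q _ => by positivity
  linarith

/-- The feedback annihilates the completed square. It is required in the open interval only, since
at t an observation may already have changed the mean. -/
lemma cost_Ioc_eq (hC : 0 < C) (hrt : r ≤ t) (htT : t ≤ T) (hz : 0 ≤ z)
    (hg : ∀ z, 0 ≤ z → 0 ≤ g z) (ha : IntervalIntegrable a volume r t)
    (hfb : ∀ q ∈ Set.Ioo r t, a q = -(riccati θ C (T - q) * meanFlow θ a r q m / C)) :
    (∫⁻ q in Set.Ioc r t, ENNReal.ofReal (meanFlow θ a r q m ^ 2 + ouVar θ b (q - r) z +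
        C * a q ^ 2)) +
      ENNReal.ofReal (riccati θ C (T - t) * meanFlow θ a r t m ^ 2 +
        g (ouVar θ b (t - r) z)) =
    ENNReal.ofReal (riccati θ C (T - r) * m ^ 2 + varCost θ b g (t - r) z) := by
  have hae : ∀ᵐ q ∂(volume : Measure ℝ), q ∈ Set.uIoc r t →
      a q = -(riccati θ C (T - q) * meanFlow θ a r q m / C) := by
    have : ∀ᵐ q ∂(volume : Measure ℝ), q ≠ t := by simp [ae_iff]
    filter_upwards [this] with q hq hqm
    rw [Set.uIoc_of_le hrt] at hqm
    exact hfb q ⟨hqm.1, lt_of_le_of_ne hqm.2 hq⟩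
  have hc : ContinuousOn (fun q => -(riccati θ C (T - q) * meanFlow θ a r q m / C))
      (Set.Icc r t) :=
    (((((continuousOn_riccati_sub hC).mono fun q hq => hq.2.trans htT)).mul
      (continuousOn_meanFlow hrt ha)).div_const C).neg
  have ha2 : IntervalIntegrable (fun w => a w ^ 2) volume r t := by
    refine IntervalIntegrable.congr_ae (f := fun q => (-(riccati θ C (T - q) *
      meanFlow θ a r q m / C)) ^ 2) (ContinuousOn.intervalIntegrable (by
      rw [Set.uIcc_of_le hrt]; exact hc.pow 2)) ?_
    rw [Filter.EventuallyEq, ae_restrict_iff' measurableSet_uIoc]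
    filter_upwards [hae] with q hq hqm
    rw [hq hqm]
  rw [ofReal_cost_eq hC hrt htT hz hg ha ha2]
  have : ∫ q in r..t, C * (a q + riccati θ C (T - q) * meanFlow θ a r q m / C) ^ 2 = 0 := by
    rw [intervalIntegral.integral_congr_ae (g := fun _ => 0)]
    · simp
    · filter_upwards [hae] with q hq hqm
      rw [show C * (a q + riccati θ C (T - q) * meanFlow θ a r q m / C) ^ 2 =
        C * (a q - -(riccati θ C (T - q) * meanFlow θ a r q m / C)) ^ 2 by ring, ← hq hqm]
      ring
  rw [this, add_zero]

end

/-! ### Bayes' rule for Gaussian laws -/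

/-- Completing the square in x factors the joint density of state and observation as the marginal of
the observation times the posterior. -/
lemma gaussianPDFReal_mul_likelihood {ε v : ℝ} (hε : 0 < ε) (hv : 0 < v) (m x y : ℝ) :
    gaussianPDFReal m v.toNNReal x * obsLikelihood ε x y =
      gaussianPDFReal m (v + ε ^ 2).toNNReal y *
        gaussianPDFReal (m + v / (v + ε ^ 2) * (y - m))
          (v * ε ^ 2 / (v + ε ^ 2)).toNNReal x := by
  have hε2 : 0 < ε ^ 2 := by positivity
  have hpi := Real.pi_pos
  simp only [obsLikelihood, gaussianPDFReal]
  rw [Real.coe_toNNReal _ hv.le, Real.coe_toNNReal _ hε2.le, Real.coe_toNNReal _ (by positivity),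
    Real.coe_toNNReal _ (by positivity)]
  rw [mul_mul_mul_comm, mul_mul_mul_comm (√(2 * Real.pi * (v + ε ^ 2)))⁻¹, ← Real.exp_add, ← Real.exp_add, ← mul_inv, ← mul_inv,
    ← Real.sqrt_mul (by positivity), ← Real.sqrt_mul (by positivity)]
  congr 1
  · congr 2
    field_simp
  · congr 1
    field_simp
    ring

/-- For v > 0 the marginal factor is the normalising constant. For v = 0 there is no density, but
the kernel equals 1 at the atom. -/
lemma bayesUpdate_gaussianLaw {ε v : ℝ} (hε : 0 < ε) (hv : 0 ≤ v) (m y : ℝ) :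
    bayesUpdate ε (gaussianLaw m v : Measure ℝ) y =
      (gaussianLaw (m + v / (v + ε ^ 2) * (y - m)) (v * ε ^ 2 / (v + ε ^ 2)) : Measure ℝ) := by
  have hε2 : 0 < ε ^ 2 := by positivity
  have hL : ∀ x, 0 < obsLikelihood ε x y := fun x =>
    gaussianPDFReal_pos _ _ _ (by simpa using hε.ne')
  change bayesUpdate ε (gaussianReal m v.toNNReal) y = gaussianReal _ _
  rcases hv.eq_or_lt with rfl | hv
  · simp only [Real.toNNReal_zero, zero_div, zero_mul, add_zero, gaussianReal_zero_var]
    rw [bayesUpdate]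
    have h1 : ∀ s, MeasurableSet s → (Measure.dirac m).withDensity
        (fun x => ENNReal.ofReal (bayesKernel ε x (Measure.dirac m) y)) s =
          Measure.dirac m s := fun s hs => by
      rw [withDensity_apply _ hs]
      have h2 : ENNReal.ofReal (bayesKernel ε m (Measure.dirac m) y) = 1 := by
        rw [bayesKernel, integral_dirac, div_self (hL m).ne', ENNReal.ofReal_one]
      rw [← lintegral_indicator hs, lintegral_dirac, Measure.dirac_apply' _ hs]
      by_cases hm : m ∈ s <;> simp [hm, h2]
    exact Measure.ext h1
  · have hv0 : v.toNNReal ≠ 0 := by simpa using hv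
    have hv' : 0 < v * ε ^ 2 / (v + ε ^ 2) := by positivity
    have hv'0 : (v * ε ^ 2 / (v + ε ^ 2)).toNNReal ≠ 0 := by simpa using hv'
    have hs0 : (v + ε ^ 2).toNNReal ≠ 0 := by
      have : 0 < v + ε ^ 2 := by positivity
      simpa using this
    have hnorm : ∫ x', obsLikelihood ε x' y ∂(gaussianReal m v.toNNReal) =
        gaussianPDFReal m (v + ε ^ 2).toNNReal y := by
      rw [integral_gaussianReal_eq_integral_smul hv0]
      simp_rw [smul_eq_mul, gaussianPDFReal_mul_likelihood hε hv]
      rw [integral_const_mul, integral_gaussianPDFReal_eq_one _ hv'0, mul_one]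
    have hmeas : Measurable fun x => ENNReal.ofReal (bayesKernel ε x (gaussianReal m v.toNNReal) y) := by
      refine Measurable.ennreal_ofReal (Measurable.div_const ?_ _)
      exact (measurable_gaussianPDFReal _ _).comp (measurable_const.sub measurable_id)
    rw [bayesUpdate, gaussianReal_of_var_ne_zero (v := (v * ε ^ 2 / (v + ε ^ 2)).toNNReal) _ hv'0]
    conv_lhs => rw [gaussianReal_of_var_ne_zero _ hv0]
    rw [← withDensity_mul _ (measurable_gaussianPDF _ _)
      (by rw [← gaussianReal_of_var_ne_zero _ hv0]; exact hmeas)]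
    congr 1
    ext x
    rw [Pi.mul_apply, ← gaussianReal_of_var_ne_zero _ hv0, gaussianPDF, gaussianPDF,
      ← ENNReal.ofReal_mul (gaussianPDFReal_nonneg _ _ _), bayesKernel, hnorm, ← mul_div_assoc,
      gaussianPDFReal_mul_likelihood hε hv, mul_div_cancel_left₀]
    exact (gaussianPDFReal_pos _ _ _ hs0).ne'

lemma secondMoment_gaussianReal (m : ℝ) (v : ℝ≥0) :
    secondMoment (gaussianReal m v) = ENNReal.ofReal (m ^ 2 + v) := by
  have h2 : MemLp (fun x : ℝ => x) 2 (gaussianReal m v) := memLp_id_gaussianReal 2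
  rw [secondMoment, ← ofReal_integral_eq_lintegral_ofReal h2.integrable_sq
    (Eventually.of_forall fun x => sq_nonneg x)]
  congr 1
  have := variance_eq_sub h2
  rw [variance_fun_id_gaussianReal, integral_id_gaussianReal] at this
  have h3 : ∫ x, ((fun x : ℝ => x) ^ 2) x ∂(gaussianReal m v) = ∫ x, x ^ 2 ∂(gaussianReal m v) := rfl
  rw [h3] at this
  linarith

lemma secondMoment_gaussianLaw (m : ℝ) {z : ℝ} (hz : 0 ≤ z) :
    secondMoment (gaussianLaw m z : Measure ℝ) = ENNReal.ofReal (m ^ 2 + z) := by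
  have := secondMoment_gaussianReal m z.toNNReal
  rwa [Real.coe_toNNReal z hz] at this

lemma integral_id_gaussianLaw (m z : ℝ) : ∫ x, x ∂(gaussianLaw m z : Measure ℝ) = m :=
  integral_id_gaussianReal

lemma lintegral_affine_sq_gaussianReal (c k : ℝ) (v : ℝ≥0) :
    ∫⁻ w, ENNReal.ofReal ((c + k * w) ^ 2) ∂(gaussianReal 0 v) =
      ENNReal.ofReal (c ^ 2 + k ^ 2 * v) := by
  have h1 := gaussianReal_map_const_mul (μ := 0) (v := v) k
  have h2 := gaussianReal_map_const_add (μ := k * 0) (v := NNReal.mk (k ^ 2) (sq_nonneg _) * v) c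
  rw [← h1, Measure.map_map (by fun_prop) (by fun_prop)] at h2
  have h3 := secondMoment_gaussianReal (k * 0 + c) (NNReal.mk (k ^ 2) (sq_nonneg _) * v)
  rw [← h2, secondMoment, lintegral_map (by fun_prop) (by fun_prop)] at h3
  simp only [Function.comp] at h3
  rw [h3]
  simp

/-! ### Quantile functions -/

lemma quantile_set_nonempty (ν : Measure ℝ) {u : ℝ} (hu : u < 1) :
    {x : ℝ | u ≤ cdf ν x}.Nonempty := by
  obtain ⟨x, hx⟩ := ((tendsto_cdf_atTop ν).eventually (lt_mem_nhds hu)).exists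
  exact ⟨x, hx.le⟩

lemma quantile_set_bddBelow (ν : Measure ℝ) {u : ℝ} (hu : 0 < u) :
    BddBelow {x : ℝ | u ≤ cdf ν x} := by
  obtain ⟨x, hx⟩ := ((tendsto_cdf_atBot ν).eventually (gt_mem_nhds hu)).exists
  refine ⟨x, fun y hy => ?_⟩
  by_contra! h
  exact absurd (hy.trans (monotone_cdf ν h.le)) (not_le.2 hx)

/-- Right continuity of the distribution function makes the infimum attained, hence the Galois
connection. -/
lemma quantile_le_iff (ν : Measure ℝ) {u x : ℝ} (hu : u ∈ Set.Ioo (0 : ℝ) 1) :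
    quantile ν u ≤ x ↔ u ≤ cdf ν x := by
  refine ⟨fun h => ?_, fun h => csInf_le (quantile_set_bddBelow ν hu.1) h⟩
  have hright : Tendsto (cdf ν) (𝓝[>] x) (𝓝 (cdf ν x)) :=
    ((cdf ν).right_continuous x).mono Set.Ioi_subset_Ici_self
  refine ge_of_tendsto hright ?_
  filter_upwards [self_mem_nhdsWithin] with y hy
  obtain ⟨w, hw, hwy⟩ := exists_lt_of_csInf_lt (quantile_set_nonempty ν hu.2) (h.trans_lt hy)
  exact le_trans hw (monotone_cdf ν hwy.le)

lemma quantile_of_nonpos (ν : Measure ℝ) {u : ℝ} (hu : u ≤ 0) : quantile ν u = 0 := by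
  have : {x : ℝ | u ≤ cdf ν x} = Set.univ := Set.eq_univ_of_forall fun x =>
    hu.trans (cdf_nonneg ν x)
  rw [quantile, this, Real.sInf_univ]

lemma quantile_of_one_lt (ν : Measure ℝ) {u : ℝ} (hu : 1 < u) : quantile ν u = 0 := by
  have : {x : ℝ | u ≤ cdf ν x} = ∅ := Set.eq_empty_of_forall_notMem fun x hx =>
    absurd (hx.trans (cdf_le_one ν x)) (not_le.2 hu)
  rw [quantile, this, Real.sInf_empty]

lemma measurable_quantile (ν : Measure ℝ) : Measurable (quantile ν) := by
  refine measurable_of_Iic fun x => ?_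
  -- Inside (0, 1) the Galois connection applies; for u ≤ 0 and u > 1 the infimum takes its default
  -- value 0. At u = 1 either may happen, but a single point is measurable anyway.
  have : quantile ν ⁻¹' Set.Iic x = (Set.Ioo 0 1 ∩ Set.Iic (cdf ν x)) ∪
      (((Set.Iic 0 ∪ Set.Ioi 1) ∩ {_u | (0 : ℝ) ≤ x}) ∪ ({1} ∩ {_u | quantile ν 1 ≤ x})) := by
    ext u
    simp only [Set.mem_preimage, Set.mem_Iic, Set.mem_union, Set.mem_inter_iff, Set.mem_Ioi,
      Set.mem_ofPred_eq, Set.mem_singleton_iff]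
    rcases le_or_gt u 0 with h0 | h0
    · rw [quantile_of_nonpos ν h0]
      have : ¬ u ∈ Set.Ioo (0 : ℝ) 1 := fun h => absurd h.1 (not_lt.2 h0)
      have : u ≠ 1 := by linarith
      simp [*]
    rcases lt_or_ge 1 u with h1 | h1
    · rw [quantile_of_one_lt ν h1]
      have : ¬ u ∈ Set.Ioo (0 : ℝ) 1 := fun h => absurd h.2 (not_lt.2 h1.le)
      have : u ≠ 1 := by linarith
      simp [*]
    rcases h1.eq_or_lt with rfl | h1
    · simp
    · rw [quantile_le_iff ν ⟨h0, h1⟩]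
      have : ¬ u ≤ 0 := not_le.2 h0
      have : ¬ 1 < u := not_lt.2 h1.le
      have : u ≠ 1 := h1.ne
      simp [*]
  rw [this]
  refine (measurableSet_Ioo.inter measurableSet_Iic).union
    (((measurableSet_Iic.union measurableSet_Ioi).inter (MeasurableSet.const _)).union
    ((measurableSet_singleton _).inter (MeasurableSet.const _)))

/-- The inverse transform: the quantile function of a uniform random variable has law `ν`. -/
lemma map_quantile (ν : Measure ℝ) [IsProbabilityMeasure ν] :
    (volume.restrict (Set.Icc (0 : ℝ) 1)).map (quantile ν) = ν := by
  have : IsProbabilityMeasure ((volume.restrict (Set.Icc (0 : ℝ) 1)).map (quantile ν)) := by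
    have : IsProbabilityMeasure (volume.restrict (Set.Icc (0 : ℝ) 1)) := ⟨by simp⟩
    exact Measure.isProbabilityMeasure_map (measurable_quantile ν).aemeasurable
  refine Measure.ext_of_Iic _ _ fun x => ?_
  rw [Measure.map_apply (measurable_quantile ν) measurableSet_Iic, ← ofReal_cdf ν x,
    restrict_Ioo_eq_restrict_Icc.symm,
    Measure.restrict_apply (measurable_quantile ν measurableSet_Iic)]
  have h1 : quantile ν ⁻¹' Set.Iic x ∩ Set.Ioo 0 1 = Set.Iic (cdf ν x) ∩ Set.Ioo 0 1 := by
    ext u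
    simp only [Set.mem_inter_iff, Set.mem_preimage, Set.mem_Iic, and_congr_left_iff]
    exact fun hu => quantile_le_iff ν hu
  rw [h1, ← Measure.restrict_apply measurableSet_Iic, restrict_Ioo_eq_restrict_Ioc,
    Measure.restrict_apply measurableSet_Iic]
  have h2 : Set.Iic (cdf ν x) ∩ Set.Ioc 0 1 = Set.Ioc 0 (cdf ν x) := by
    ext u
    simp only [Set.mem_inter_iff, Set.mem_Iic, Set.mem_Ioc]
    exact ⟨fun h => ⟨h.2.1, h.1⟩, fun h => ⟨h.2, h.1, h.2.trans (cdf_le_one ν x)⟩⟩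
  rw [h2, Real.volume_Ioc, sub_zero]

lemma cdf_gaussianLaw (m z x : ℝ) :
    cdf (gaussianLaw m z : Measure ℝ) x = cdf (gaussianLaw 0 z : Measure ℝ) (x - m) := by
  have h := gaussianReal_map_const_add (μ := 0) (v := z.toNNReal) m
  rw [zero_add] at h
  change cdf (gaussianReal m z.toNNReal) x = cdf (gaussianReal 0 z.toNNReal) (x - m)
  rw [cdf_eq_real, cdf_eq_real, ← h, measureReal_def, measureReal_def,
    Measure.map_apply (by fun_prop) measurableSet_Iic]
  congr 2
  ext y
  simp [le_sub_iff_add_le, add_comm]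

-- Translation by m commutes with the infimum except where the default value 0 is taken, and whether
-- this happens depends on u and z alone. An identity valid for every u is needed because
-- measurability for the noise σ-algebras must hold exactly, not almost everywhere.
open scoped Classical in
lemma quantile_gaussianLaw_eq (m z u : ℝ) : quantile (gaussianLaw m z : Measure ℝ) u =
    if {x : ℝ | u ≤ cdf (gaussianLaw 0 z : Measure ℝ) x}.Nonempty ∧
      BddBelow {x : ℝ | u ≤ cdf (gaussianLaw 0 z : Measure ℝ) x} then
      m + quantile (gaussianLaw 0 z : Measure ℝ) u else 0 := by
  set S := {x : ℝ | u ≤ cdf (gaussianLaw 0 z : Measure ℝ) x} with hS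
  have himg : {x : ℝ | u ≤ cdf (gaussianLaw m z : Measure ℝ) x} = OrderIso.addLeft m '' S := by
    ext x
    simp only [Set.mem_ofPred_eq, cdf_gaussianLaw m, hS, Set.mem_image, OrderIso.addLeft_apply]
    exact ⟨fun h => ⟨x - m, h, by ring⟩, by rintro ⟨y, hy, rfl⟩; simpa using hy⟩
  rw [quantile, himg]
  split_ifs with h
  · exact ((OrderIso.addLeft m).map_csInf' h.1 h.2).symm
  · by_cases h1 : S.Nonempty
    · exact Real.sInf_of_not_bddBelow
        (by rw [OrderIso.bddBelow_image]; exact fun h2 => h ⟨h1, h2⟩)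
    · rw [Set.not_nonempty_iff_eq_empty.1 h1, Set.image_empty, Real.sInf_empty]

lemma quantile_gaussianLaw_of_mem (m z : ℝ) {u : ℝ} (hu : u ∈ Set.Ioo (0 : ℝ) 1) :
    quantile (gaussianLaw m z : Measure ℝ) u = m + quantile (gaussianLaw 0 z : Measure ℝ) u := by
  rw [quantile_gaussianLaw_eq, if_pos ⟨quantile_set_nonempty _ hu.2, quantile_set_bddBelow _ hu.1⟩]

lemma measurable_quantile_gaussianLaw (z : ℝ) :
    Measurable fun p : ℝ × ℝ => quantile (gaussianLaw p.1 z : Measure ℝ) p.2 := by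
  classical
  rw [show (fun p : ℝ × ℝ => quantile (gaussianLaw p.1 z : Measure ℝ) p.2) = _ from
    funext fun p => quantile_gaussianLaw_eq p.1 z p.2]
  set A := {u : ℝ | {x : ℝ | u ≤ cdf (gaussianLaw 0 z : Measure ℝ) x}.Nonempty ∧
      BddBelow {x : ℝ | u ≤ cdf (gaussianLaw 0 z : Measure ℝ) x}} with hA
  have hAm : MeasurableSet A := by
    have : A = Set.Ioo 0 1 ∪ (A ∩ {1}) := by
      ext u
      refine ⟨fun h => ?_, ?_⟩
      · have h0 : 0 < u := by
          by_contra! h0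
          have : {x : ℝ | u ≤ cdf (gaussianLaw 0 z : Measure ℝ) x} = Set.univ :=
            Set.eq_univ_of_forall fun x => h0.trans (cdf_nonneg _ x)
          have h2 := h.2
          rw [this] at h2
          exact not_bddBelow_univ h2
        obtain ⟨x, hx⟩ := h.1
        rcases (le_trans hx (cdf_le_one _ x)).eq_or_lt with h1 | h1
        · exact Or.inr ⟨h, h1⟩
        · exact Or.inl ⟨h0, h1⟩
      · rintro (h | h)
        · exact ⟨quantile_set_nonempty _ h.2, quantile_set_bddBelow _ h.1⟩
        · exact h.1
    rw [this]
    exact measurableSet_Ioo.union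
      ((Set.subsingleton_singleton.anti Set.inter_subset_right).measurableSet)
  refine Measurable.ite (measurable_snd hAm) ?_ measurable_const
  exact measurable_fst.add ((measurable_quantile _).comp measurable_snd)

/-! ### The value function in closed form -/

namespace OUModel

variable {n : ℕ} {Ω : Type*} (M : OUModel n Ω)

/-- The times of the model, indexed by natural numbers. -/
def timeNat (k : ℕ) : ℝ := M.time ⟨min k (n + 1), by omega⟩

lemma timeNat_castSucc (i : Fin (n + 1)) : M.time i.castSucc = M.timeNat i := by
  unfold timeNat; congr 1; ext; simp only [Fin.val_castSucc]; omega

lemma timeNat_succ (i : Fin (n + 1)) : M.time i.succ = M.timeNat (i + 1) := by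
  unfold timeNat; congr 1; ext; simp only [Fin.val_succ]; omega

lemma obsTime_eq (j : Fin n) : M.obsTime j = M.timeNat (j + 1) := by
  unfold obsTime timeNat; congr 1; ext; simp only [Fin.val_castSucc, Fin.val_succ]; omega

lemma horizon_eq : M.horizon = M.timeNat (n + 1) := by
  unfold horizon timeNat; congr 1; ext; simp

lemma timeNat_zero : M.timeNat 0 = M.time 0 := by
  unfold timeNat; congr 1

variable {M}

lemma timeNat_lt (h : StrictMono M.time) {k l : ℕ} (hkl : k < l) (hl : l ≤ n + 1) :
    M.timeNat k < M.timeNat l :=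
  h (by simp only [Fin.mk_lt_mk]; omega)

lemma timeNat_mono (h : StrictMono M.time) : Monotone M.timeNat := fun k l hkl =>
  h.monotone (by simp only [Fin.mk_le_mk]; omega)

lemma timeNat_le_horizon (h : StrictMono M.time) (k : ℕ) : M.timeNat k ≤ M.horizon :=
  h.monotone (Fin.le_last _)

lemma exists_timeNat_mem {s : ℝ} (hs : M.time 0 ≤ s)
    (hsT : s < M.horizon) : ∃ i ≤ n, s ∈ Set.Ico (M.timeNat i) (M.timeNat (i + 1)) := by
  have key : ∀ k, k ≤ n + 1 → s < M.timeNat k →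
      ∃ i ≤ n, s ∈ Set.Ico (M.timeNat i) (M.timeNat (i + 1)) := by
    intro k
    induction k with
    | zero => intro _ h0; rw [timeNat_zero] at h0; exact absurd hs (not_le.2 h0)
    | succ k ih =>
      intro hk hsk
      rcases lt_or_ge s (M.timeNat k) with h1 | h1
      · exact ih (by omega) h1
      · exact ⟨k, by omega, h1, hsk⟩
  exact key (n + 1) le_rfl (by rwa [← horizon_eq])

variable (M)

/-- The cost-to-go due to the variance just before an observation, as a function of the number of
the remaining observations (that one included). -/
noncomputable def varCostToGo : ℕ → ℝ → ℝ
  | 0, z => z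
  | d + 1, z => riccati M.θ M.C (M.horizon - M.timeNat (n - d)) * (z ^ 2 / (z + M.ε ^ 2)) +
      varCost M.θ M.b (varCostToGo d) (M.timeNat (n + 1 - d) - M.timeNat (n - d))
        (z * M.ε ^ 2 / (z + M.ε ^ 2))

/-- The cost-to-go due to the variance just before the time `t_k`. -/
noncomputable def priorCost (k : ℕ) : ℝ → ℝ := M.varCostToGo (n + 1 - k)

lemma priorCost_last (z : ℝ) : M.priorCost (n + 1) z = z := by
  simp [priorCost, varCostToGo]

/-- Here z²/(z + ε²) is the variance of the jump of the mean, weighted by the Riccati coefficient;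
the rest is the cost of continuing from the posterior variance. -/
lemma priorCost_eq {k : ℕ} (hk : k ≤ n) (z : ℝ) : M.priorCost k z =
    riccati M.θ M.C (M.horizon - M.timeNat k) * (z ^ 2 / (z + M.ε ^ 2)) +
      varCost M.θ M.b (M.priorCost (k + 1)) (M.timeNat (k + 1) - M.timeNat k)
        (z * M.ε ^ 2 / (z + M.ε ^ 2)) := by
  obtain ⟨d, rfl⟩ := Nat.exists_eq_add_of_le hk
  simp only [priorCost, show k + d + 1 - k = d + 1 by omega, show k + d + 1 - (k + 1) = d by omega]
  rw [varCostToGo]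
  simp only [show k + d - d = k by omega, show k + d + 1 - d = k + 1 by omega]

/-- The value at Gaussian laws at the times `t ∈ [t_k, t_{k+1}]`. -/
noncomputable def gaussCost (k : ℕ) (t m z : ℝ) : ℝ :=
  riccati M.θ M.C (M.horizon - t) * m ^ 2 +
    varCost M.θ M.b (M.priorCost (k + 1)) (M.timeNat (k + 1) - t) z

variable {M}

lemma posterior_nonneg (hε : 0 < M.ε) {z : ℝ} (hz : 0 ≤ z) :
    0 ≤ z * M.ε ^ 2 / (z + M.ε ^ 2) := by positivity

lemma varCostToGo_nonneg (hC : 0 < M.C) (hε : 0 < M.ε) (h : StrictMono M.time) (d : ℕ) :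
    ∀ z, 0 ≤ z → 0 ≤ M.varCostToGo d z := by
  induction d with
  | zero => intro z hz; simpa [varCostToGo] using hz
  | succ d ih =>
    intro z hz
    rw [varCostToGo]
    have h1 := (riccati_pos M.θ hC (sub_nonneg.2 (timeNat_le_horizon h (n - d)))).le
    have h2 := varCost_nonneg M.θ M.b ih (h := M.timeNat (n + 1 - d) - M.timeNat (n - d))
      (sub_nonneg.2 (timeNat_mono h (by omega))) (posterior_nonneg hε hz)
    positivity

lemma priorCost_nonneg (hC : 0 < M.C) (hε : 0 < M.ε) (h : StrictMono M.time) (k : ℕ) :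
    ∀ z, 0 ≤ z → 0 ≤ M.priorCost k z := varCostToGo_nonneg hC hε h _

lemma gaussCost_nonneg (hC : 0 < M.C) (hε : 0 < M.ε) (h : StrictMono M.time) {k : ℕ} {t : ℝ}
    (ht : t ≤ M.timeNat (k + 1)) (m : ℝ) {z : ℝ} (hz : 0 ≤ z) : 0 ≤ M.gaussCost k t m z := by
  have h1 := (riccati_pos M.θ hC (sub_nonneg.2 (ht.trans (timeNat_le_horizon h (k + 1))))).le
  have h2 := varCost_nonneg M.θ M.b (priorCost_nonneg hC hε h (k + 1)) (sub_nonneg.2 ht) hz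
  unfold gaussCost; positivity

/-- Backward induction through the observations: ε > 0 keeps z + ε² away from zero, and both the
update and the variance flow preserve [0, ∞). -/
lemma differentiableWithinAt_varCostToGo (hε : 0 < M.ε) (h : StrictMono M.time) (d : ℕ) :
    ∀ z, 0 ≤ z → DifferentiableWithinAt ℝ (M.varCostToGo d) (Set.Ici 0) z := by
  induction d with
  | zero => intro z _; exact differentiableWithinAt_id
  | succ d ih =>
    intro z hz
    have hne : z + M.ε ^ 2 ≠ 0 := by positivity
    have hh : 0 ≤ M.timeNat (n + 1 - d) - M.timeNat (n - d) :=
      sub_nonneg.2 (timeNat_mono h (by omega))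
    have hpost := posterior_nonneg hε hz
    have h1 := hasDerivWithinAt_varCost_right M.θ M.b hh
      (ih _ (ouVar_nonneg M.θ M.b hh hpost)).hasDerivWithinAt
    have h2 : DifferentiableAt ℝ (fun z => z * M.ε ^ 2 / (z + M.ε ^ 2)) z := by
      fun_prop (disch := assumption)
    have h3 : DifferentiableAt ℝ (fun z => riccati M.θ M.C (M.horizon - M.timeNat (n - d)) *
        (z ^ 2 / (z + M.ε ^ 2))) z := by
      fun_prop (disch := assumption)
    have h4 : Set.MapsTo (fun z => z * M.ε ^ 2 / (z + M.ε ^ 2)) (Set.Ici 0) (Set.Ici 0) :=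
      fun y hy => posterior_nonneg hε hy
    have h5 : DifferentiableWithinAt ℝ (fun z => varCost M.θ M.b (M.varCostToGo d)
        (M.timeNat (n + 1 - d) - M.timeNat (n - d)) (z * M.ε ^ 2 / (z + M.ε ^ 2)))
        (Set.Ici 0) z :=
      DifferentiableWithinAt.comp (g := varCost M.θ M.b (M.varCostToGo d)
        (M.timeNat (n + 1 - d) - M.timeNat (n - d))) z h1.differentiableWithinAt
        h2.differentiableWithinAt h4
    exact h3.differentiableWithinAt.add h5

lemma differentiableWithinAt_priorCost (hε : 0 < M.ε) (h : StrictMono M.time) (k : ℕ) {z : ℝ}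
    (hz : 0 ≤ z) : DifferentiableWithinAt ℝ (M.priorCost k) (Set.Ici 0) z :=
  differentiableWithinAt_varCostToGo hε h _ z hz

/-- The terms in m² cancel by the Riccati equation, since the m-derivative is 2pm, and the others by
`varCost_transport`. -/
lemma gaussCost_hjb (hC : 0 < M.C) (hε : 0 < M.ε) (h : StrictMono M.time) {k : ℕ} {t : ℝ}
    (ht : t ∈ Set.Ico (M.timeNat k) (M.timeNat (k + 1))) (m : ℝ) {z : ℝ} (hz : 0 ≤ z) :
    ∃ Ut Um Uz : ℝ,
      HasDerivWithinAt (fun r => M.gaussCost k r m z) Ut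
        (Set.Ico (M.timeNat k) (M.timeNat (k + 1))) t ∧
      HasDerivAt (fun x => M.gaussCost k t x z) Um m ∧
      HasDerivWithinAt (fun y => M.gaussCost k t m y) Uz (Set.Ici 0) z ∧
      Ut + z + m ^ 2 - M.θ * m * Um + (M.b ^ 2 - 2 * M.θ * z) * Uz
          - 1 / (4 * M.C) * Um ^ 2 = 0 := by
  set τ := M.timeNat (k + 1) - t with hτ
  have hτ0 : 0 ≤ τ := sub_nonneg.2 ht.2.le
  set p := riccati M.θ M.C (M.horizon - t) with hp
  have hT : t ≤ M.horizon := ht.2.le.trans (timeNat_le_horizon h (k + 1))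
  have hg := (differentiableWithinAt_priorCost hε h (k + 1)
    (ouVar_nonneg M.θ M.b hτ0 hz)).hasDerivWithinAt
  set g' := derivWithin (M.priorCost (k + 1)) (Set.Ici 0) (ouVar M.θ M.b τ z) with hg'
  have h1 : HasDerivAt (fun r => riccati M.θ M.C (M.horizon - r) * m ^ 2)
      (-(1 - 2 * M.θ * p - p ^ 2 / M.C) * m ^ 2) t :=
    ((hasDerivAt_riccati M.θ hC (sub_nonneg.2 hT)).comp_const_sub M.horizon t).mul_const _
  have h2 : HasDerivWithinAt (fun r => varCost M.θ M.b (M.priorCost (k + 1))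
      (M.timeNat (k + 1) - r) z)
      ((ouVar M.θ M.b τ z + g' * (M.b ^ 2 - 2 * M.θ * ouVar M.θ M.b τ z)) * -1)
      (Set.Ico (M.timeNat k) (M.timeNat (k + 1))) t := by
    have := hasDerivWithinAt_varCost_time M.θ M.b hz hg
    have hmaps : Set.MapsTo (fun r => M.timeNat (k + 1) - r)
        (Set.Ico (M.timeNat k) (M.timeNat (k + 1))) (Set.Ici 0) :=
      fun r hr => sub_nonneg.2 hr.2.le
    exact this.comp t (((hasDerivAt_id t).const_sub _).hasDerivWithinAt) hmaps
  have h3 : HasDerivAt (fun x : ℝ => p * x ^ 2) (p * (2 * m)) m := by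
    simpa using (hasDerivAt_pow 2 m).const_mul p
  refine ⟨_, _, _, h1.hasDerivWithinAt.add h2, h3.add_const _,
    (hasDerivWithinAt_varCost_right M.θ M.b hτ0 hg).const_add _, ?_⟩
  have key := varCost_transport M.θ M.b g' τ z
  rw [key]
  field_simp
  ring

lemma tendsto_gaussCost (hC : 0 < M.C) (hε : 0 < M.ε) (h : StrictMono M.time) (k : ℕ) (m : ℝ)
    {z : ℝ} (hz : 0 ≤ z) : Tendsto (fun t => M.gaussCost k t m z) (𝓝[<] M.timeNat (k + 1))
      (𝓝 (riccati M.θ M.C (M.horizon - M.timeNat (k + 1)) * m ^ 2 + M.priorCost (k + 1) z)) := by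
  have hT := timeNat_le_horizon h (k + 1)
  have h1 : Tendsto (fun r => riccati M.θ M.C (M.horizon - r) * m ^ 2) (𝓝[<] M.timeNat (k + 1))
      (𝓝 (riccati M.θ M.C (M.horizon - M.timeNat (k + 1)) * m ^ 2)) :=
    (((hasDerivAt_riccati M.θ hC (sub_nonneg.2 hT)).comp_const_sub M.horizon
      _).mul_const _).continuousAt.continuousWithinAt
  have hg := (differentiableWithinAt_priorCost hε h (k + 1)
    (ouVar_nonneg M.θ M.b (h := M.timeNat (k + 1) - M.timeNat (k + 1)) (by simp)
      hz)).hasDerivWithinAt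
  have hmaps : Set.MapsTo (fun r => M.timeNat (k + 1) - r) (Set.Iio (M.timeNat (k + 1)))
      (Set.Ici 0) := fun r hr => by
    have := Set.mem_Iio.1 hr
    exact sub_nonneg.2 this.le
  have h2 := ((hasDerivWithinAt_varCost_time M.θ M.b hz hg).comp (M.timeNat (k + 1))
      (((hasDerivAt_id (M.timeNat (k + 1))).const_sub (M.timeNat (k + 1))).hasDerivWithinAt)
      hmaps).continuousWithinAt
  have h3 := h1.add h2
  simp only [Function.comp, sub_self, varCost_zero] at h3
  exact h3

lemma integrable_affine_sq (m κ : ℝ) :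
    Integrable (fun w => (m + κ * w) ^ 2) (gaussianReal 0 1) := by
  have h1 : MemLp (fun w : ℝ => m + κ * w) 2 (gaussianReal 0 1) :=
    (memLp_const m).add ((memLp_id_gaussianReal 2).const_mul κ)
  exact h1.integrable_sq

lemma integral_affine_sq (m κ : ℝ) :
    ∫ w, (m + κ * w) ^ 2 ∂(gaussianReal 0 1) = m ^ 2 + κ ^ 2 := by
  have h1 := lintegral_affine_sq_gaussianReal m κ 1
  rw [← ofReal_integral_eq_lintegral_ofReal (integrable_affine_sq m κ)
    (Eventually.of_forall fun w => sq_nonneg _), ENNReal.ofReal_eq_ofReal_iff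
    (integral_nonneg fun w => sq_nonneg _) (by positivity)] at h1
  simpa using h1

/-- The cost is quadratic in the mean, so averaging only adds p times the squared coefficient of w;
this is the first term of `priorCost_eq`. -/
lemma integral_gaussCost (hε : 0 < M.ε) {k : ℕ} (hk : k ≤ n) (m : ℝ) {z : ℝ} (hz : 0 ≤ z) :
    Integrable (fun w => M.gaussCost k (M.timeNat k) (m + z / √(z + M.ε ^ 2) * w)
        (z * M.ε ^ 2 / (z + M.ε ^ 2)) * gaussianPDFReal 0 1 w) ∧
    ∫ w, M.gaussCost k (M.timeNat k) (m + z / √(z + M.ε ^ 2) * w)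
        (z * M.ε ^ 2 / (z + M.ε ^ 2)) * gaussianPDFReal 0 1 w =
      riccati M.θ M.C (M.horizon - M.timeNat k) * m ^ 2 + M.priorCost k z := by
  set κ := z / √(z + M.ε ^ 2) with hκ
  have hκ2 : κ ^ 2 = z ^ 2 / (z + M.ε ^ 2) := by
    rw [hκ, div_pow, Real.sq_sqrt (by positivity)]
  set p := riccati M.θ M.C (M.horizon - M.timeNat k) with hp
  set c := varCost M.θ M.b (M.priorCost (k + 1)) (M.timeNat (k + 1) - M.timeNat k)
        (z * M.ε ^ 2 / (z + M.ε ^ 2)) with hc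
  have hne : (1 : ℝ≥0) ≠ 0 := one_ne_zero
  have hi : Integrable (fun w => p * (m + κ * w) ^ 2 + c) (gaussianReal 0 1) :=
    ((integrable_affine_sq m κ).const_mul p).add (integrable_const c)
  constructor
  · rw [gaussianReal_of_var_ne_zero _ hne] at hi
    have := (integrable_withDensity_iff_integrable_smul' (measurable_gaussianPDF 0 1)
      (Eventually.of_forall fun x => gaussianPDF_lt_top)).1 hi
    refine this.congr (Eventually.of_forall fun w => ?_)
    simp only [toReal_gaussianPDF, smul_eq_mul, gaussCost, ← hp, ← hc]
    ring
  · have h1 : ∫ w, (p * (m + κ * w) ^ 2 + c) ∂(gaussianReal 0 1) = p * (m ^ 2 + κ ^ 2) + c := by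
      rw [integral_add ((integrable_affine_sq m κ).const_mul p) (integrable_const c),
        integral_const_mul, integral_affine_sq]
      simp
    rw [integral_gaussianReal_eq_integral_smul hne] at h1
    rw [priorCost_eq M hk, ← hp, ← hc]
    rw [hκ2] at h1
    rw [show p * m ^ 2 + (p * (z ^ 2 / (z + M.ε ^ 2)) + c) =
      p * (m ^ 2 + z ^ 2 / (z + M.ε ^ 2)) + c by ring, ← h1]
    congr 1
    ext w
    simp only [smul_eq_mul, gaussCost, ← hp, ← hc]
    ring

end OUModel

/-! ### Measurability and independence -/

/-- The mean before the next observation is measurable with respect to the past. -/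
lemma measurable_meanFlow {Ω : Type*} [MeasurableSpace Ω] {α : ℝ → Ω → ℝ} {θ s r t : ℝ}
    (hsr : s ≤ r) (hrt : r ≤ t)
    (hα : ∀ q ∈ Set.Ico r t, Measurable fun p : Set.Icc s q × Ω => α p.1 p.2)
    (hint : ∀ ω, IntervalIntegrable (fun q => α q ω) volume r t)
    {m : Ω → ℝ} (hm : Measurable m) :
    Measurable fun ω => meanFlow θ (fun q => α q ω) r t (m ω) := by
  classical
  rcases hrt.eq_or_lt with rfl | hrt'
  · simp only [meanFlow_self]; exact hm
  have key : ∀ q ∈ Set.Ico r t,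
      Measurable fun ω => ∫ w in r..q, α w ω * Real.exp (θ * (w - r)) := by
    intro q hq
    -- Progressive measurability concerns [s, q] × Ω; extension by zero gives a jointly measurable
    -- function to which measurability of parameter integrals applies.
    have h1 : Measurable fun p : ℝ × Ω => if h : p.1 ∈ Set.Icc s q then α p.1 p.2 else 0 := by
      refine Measurable.dite (s := {p : ℝ × Ω | p.1 ∈ Set.Icc s q})
        (f := fun p => α p.1.1 p.1.2) (g := fun _ => 0) ?_ measurable_const
        (measurable_fst measurableSet_Icc)
      have h2 : Measurable fun p : {p : ℝ × Ω | p.1 ∈ Set.Icc s q} =>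
          ((⟨p.1.1, p.2⟩ : Set.Icc s q), p.1.2) :=
        ((measurable_fst.comp measurable_subtype_coe).subtype_mk).prodMk
          (measurable_snd.comp measurable_subtype_coe)
      exact (hα q hq).comp h2
    have h3 : StronglyMeasurable (Function.uncurry fun (w : ℝ) (ω : Ω) =>
        (if h : w ∈ Set.Icc s q then α w ω else 0) * Real.exp (θ * (w - r))) := by
      refine (h1.mul ?_).stronglyMeasurable
      have hc : Continuous fun w : ℝ => Real.exp (θ * (w - r)) := by fun_prop
      exact hc.measurable.comp measurable_fst
    have h4 := (h3.integral_prod_left (μ := volume.restrict (Set.Ioc r q))).measurable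
    convert h4 using 2 with ω
    rw [intervalIntegral.integral_of_le hq.1]
    refine setIntegral_congr_fun measurableSet_Ioc fun w hw => ?_
    have : w ∈ Set.Icc s q := ⟨hsr.trans hw.1.le, hw.2⟩
    simp [this]
  -- Taking the limit q ↑ t avoids any use of the information that arrives at time t itself.
  have hlim : Measurable fun ω => ∫ w in r..t, α w ω * Real.exp (θ * (w - r)) := by
    obtain ⟨q, -, hq, hqt⟩ := exists_seq_strictMono_tendsto' hrt'
    refine measurable_of_tendsto_metrizable (fun k => key (q k) ⟨(hq k).1.le, (hq k).2⟩) ?_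
    rw [tendsto_pi_nhds]
    intro ω
    have hc := continuousOn_primitive_Icc hrt (intervalIntegrable_mul_exp (θ := θ) (hint ω))
    exact (hc t ⟨hrt, le_rfl⟩).tendsto.comp (tendsto_nhdsWithin_iff.2
      ⟨hqt, Eventually.of_forall fun k => ⟨(hq k).1.le, (hq k).2.le⟩⟩)
  exact (hm.add hlim).const_mul _

/-- The expected quadratic cost after an observation. -/
lemma lintegral_posterior {Ω : Type*} [MeasurableSpace Ω] {P : Measure Ω} [IsProbabilityMeasure P]
    (X : Ω → ℝ≥0∞) {m W : Ω → ℝ} (hm : Measurable m) (hW : Measurable W) (hind : IndepFun m W P)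
    {v : ℝ≥0} (hlaw : P.map W = gaussianReal 0 v) {p c : ℝ} (hp : 0 ≤ p) (hc : 0 ≤ c) (κ : ℝ) :
    ∫⁻ ω, (X ω + ENNReal.ofReal (p * (m ω + κ * W ω) ^ 2 + c)) ∂P =
      ∫⁻ ω, (X ω + ENNReal.ofReal (p * m ω ^ 2 + (p * (κ ^ 2 * v) + c))) ∂P := by
  -- Additivity needs only the second summand to be measurable. Nothing is assumed of X, which will
  -- be an accumulated running cost with no known measurability in ω.
  rw [lintegral_add_right _ (by fun_prop), lintegral_add_right _ (by fun_prop)]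
  congr 1
  have hprod := (indepFun_iff_map_prod_eq_prod_map_map hm.aemeasurable hW.aemeasurable).1 hind
  have hmeas : Measurable fun x : ℝ × ℝ => ENNReal.ofReal (p * (x.1 + κ * x.2) ^ 2 + c) := by
    fun_prop
  have e1 : ∫⁻ ω, ENNReal.ofReal (p * (m ω + κ * W ω) ^ 2 + c) ∂P =
      ∫⁻ x, ENNReal.ofReal (p * (x.1 + κ * x.2) ^ 2 + c)
        ∂(P.map fun ω => (m ω, W ω)) := by
    rw [lintegral_map hmeas (hm.prodMk hW)]
  rw [e1, hprod, hlaw, lintegral_prod _ hmeas.aemeasurable]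
  have e2 : ∀ x, ∫⁻ w, ENNReal.ofReal (p * (x + κ * w) ^ 2 + c) ∂(gaussianReal 0 v) =
      ENNReal.ofReal (p * x ^ 2 + (p * (κ ^ 2 * v) + c)) := fun x => by
    have h1 : ∀ w, ENNReal.ofReal (p * (x + κ * w) ^ 2 + c) =
        ENNReal.ofReal p * ENNReal.ofReal ((x + κ * w) ^ 2) + ENNReal.ofReal c := fun w => by
      rw [ENNReal.ofReal_add (by positivity) hc, ENNReal.ofReal_mul hp]
    simp_rw [h1]
    rw [lintegral_add_right _ measurable_const, lintegral_const_mul _ (by fun_prop),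
      lintegral_affine_sq_gaussianReal, lintegral_const, measure_univ, mul_one,
      ← ENNReal.ofReal_mul hp, ← ENNReal.ofReal_add (by positivity) hc]
    congr 1; ring
  simp_rw [e2]
  rw [lintegral_map (by fun_prop) hm]

/-! ### The driving variables and the innovations -/

namespace OUModel

variable {n : ℕ} {Ω : Type*} (M : OUModel n Ω)

/-- The `σ`-algebra generated by the variables that drive the first `k` observations. -/
abbrev drivingSigma (k : ℕ) : MeasurableSpace Ω :=
  ⨆ l ∈ {l : Fin n ⊕ Fin n | Sum.elim Fin.val Fin.val l < k},
    MeasurableSpace.comap ((Sum.elim M.U M.Z : Fin n ⊕ Fin n → Ω → ℝ) l) inferInstance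

lemma drivingSigma_mono {k l : ℕ} (h : k ≤ l) : M.drivingSigma k ≤ M.drivingSigma l :=
  biSup_mono fun _ hi => lt_of_lt_of_le hi h

lemma measurable_U_drivingSigma (j : Fin n) {k : ℕ} (h : (j : ℕ) < k) :
    Measurable[M.drivingSigma k] (M.U j) := by
  refine Measurable.mono (comap_measurable (M.U j)) ?_ le_rfl
  exact le_biSup (fun l => MeasurableSpace.comap ((Sum.elim M.U M.Z : Fin n ⊕ Fin n → Ω → ℝ) l)
    inferInstance) (show Sum.inl j ∈ _ from h)

lemma measurable_Z_drivingSigma (j : Fin n) {k : ℕ} (h : (j : ℕ) < k) :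
    Measurable[M.drivingSigma k] (M.Z j) := by
  refine Measurable.mono (comap_measurable (M.Z j)) ?_ le_rfl
  exact le_biSup (fun l => MeasurableSpace.comap ((Sum.elim M.U M.Z : Fin n ⊕ Fin n → Ω → ℝ) l)
    inferInstance) (show Sum.inr j ∈ _ from h)

variable {M}

/-- The centred observation error `F[𝒩(0, v)]⁻¹(U_j) + ε Z_j`. -/
noncomputable def innovation (M : OUModel n Ω) (v : ℝ) (j : Fin n) (ω : Ω) : ℝ :=
  quantile (gaussianLaw 0 v : Measure ℝ) (M.U j ω) + M.ε * M.Z j ω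

lemma measurable_innovation [MeasurableSpace Ω] {j : Fin n} (hU : Measurable (M.U j))
    (hZ : Measurable (M.Z j)) (v : ℝ) : Measurable (M.innovation v j) :=
  ((measurable_quantile _).comp hU).add (hZ.const_mul _)

lemma obsSigma_le {prior : Fin n → Ω → ProbabilityMeasure ℝ} {s t : ℝ} {𝒜 : MeasurableSpace Ω}
    (h : ∀ j, s < M.obsTime j → M.obsTime j ≤ t → Measurable[𝒜] (M.observation prior j)) :
    M.obsSigma prior s t ≤ 𝒜 := by
  refine iSup_le fun j => iSup_le fun hj => ?_
  have := (h j hj.1 hj.2).comap_le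
  rwa [BorelSpace.measurable_eq (α := ℝ)] at this

variable [mΩ : MeasurableSpace Ω]

lemma measurable_driving (hU : ∀ j, Measurable (M.U j)) (hZ : ∀ j, Measurable (M.Z j))
    (l : Fin n ⊕ Fin n) : Measurable ((Sum.elim M.U M.Z : Fin n ⊕ Fin n → Ω → ℝ) l) := by
  rcases l with j | j
  exacts [hU j, hZ j]

lemma drivingSigma_le (hU : ∀ j, Measurable (M.U j)) (hZ : ∀ j, Measurable (M.Z j)) (k : ℕ) :
    M.drivingSigma k ≤ mΩ :=
  iSup₂_le fun l _ => (measurable_driving hU hZ l).comap_le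

variable {P : Measure Ω}

/-- Variables with index below j generate a σ-algebra independent of the one generated by U_j and
Z_j, as the two index sets are disjoint. -/
lemma indepFun_innovation (hU : ∀ j, Measurable (M.U j)) (hZ : ∀ j, Measurable (M.Z j))
    (h_indep : iIndepFun (Sum.elim M.U M.Z : Fin n ⊕ Fin n → Ω → ℝ) P) (v : ℝ) (j : Fin n)
    {m : Ω → ℝ} (hm : Measurable[M.drivingSigma j] m) : IndepFun m (M.innovation v j) P := by
  have hdisj : Disjoint {l : Fin n ⊕ Fin n | Sum.elim Fin.val Fin.val l < (j : ℕ)} {Sum.inl j, Sum.inr j} := by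
    rw [Set.disjoint_left]
    rintro l hl (rfl | rfl)
    · exact lt_irrefl _ (show (j : ℕ) < j from hl)
    · exact lt_irrefl _ (show (j : ℕ) < j from hl)
  have key := indep_iSup_of_disjoint (fun l => (measurable_driving hU hZ l).comap_le)
    h_indep.iIndep hdisj
  rw [IndepFun_iff_Indep]
  refine indep_of_indep_of_le_right (indep_of_indep_of_le_left key hm.comap_le) ?_
  set 𝒯 : MeasurableSpace Ω := ⨆ l ∈ ({Sum.inl j, Sum.inr j} : Set (Fin n ⊕ Fin n)),
    MeasurableSpace.comap ((Sum.elim M.U M.Z : Fin n ⊕ Fin n → Ω → ℝ) l) inferInstance with h𝒯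
  have h1 : Measurable[𝒯] (M.U j) := by
    refine Measurable.mono (comap_measurable (M.U j)) ?_ le_rfl
    exact le_biSup (fun l => MeasurableSpace.comap ((Sum.elim M.U M.Z : Fin n ⊕ Fin n → Ω → ℝ) l)
      inferInstance) (show Sum.inl j ∈ ({Sum.inl j, Sum.inr j} : Set (Fin n ⊕ Fin n)) by simp)
  have h2 : Measurable[𝒯] (M.Z j) := by
    refine Measurable.mono (comap_measurable (M.Z j)) ?_ le_rfl
    exact le_biSup (fun l => MeasurableSpace.comap ((Sum.elim M.U M.Z : Fin n ⊕ Fin n → Ω → ℝ) l)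
      inferInstance) (show Sum.inr j ∈ ({Sum.inl j, Sum.inr j} : Set (Fin n ⊕ Fin n)) by simp)
  have h3 : Measurable[𝒯] (M.innovation v j) :=
    @measurable_innovation n Ω M 𝒯 j h1 h2 v
  exact h3.comap_le

/-- The inverse transform gives a sample of 𝒩(0, v), and the independent noise of variance ε² is
added. -/
lemma map_innovation (hU : ∀ j, Measurable (M.U j)) (hZ : ∀ j, Measurable (M.Z j))
    (hU_law : ∀ j, P.map (M.U j) = volume.restrict (Set.Icc (0 : ℝ) 1))
    (hZ_law : ∀ j, P.map (M.Z j) = gaussianReal 0 1)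
    (h_indep : iIndepFun (Sum.elim M.U M.Z : Fin n ⊕ Fin n → Ω → ℝ) P) {v : ℝ} (hv : 0 ≤ v)
    (j : Fin n) : P.map (M.innovation v j) = gaussianReal 0 (v + M.ε ^ 2).toNNReal := by
  have hUZ : IndepFun (M.U j) (M.Z j) P :=
    h_indep.indepFun (i := Sum.inl j) (j := Sum.inr j) (by simp)
  have hind := hUZ.comp (measurable_quantile (gaussianLaw 0 v : Measure ℝ))
    (measurable_const_mul M.ε)
  have h1 : P.map (quantile (gaussianLaw 0 v : Measure ℝ) ∘ M.U j) =
      gaussianReal 0 v.toNNReal := by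
    rw [← Measure.map_map (measurable_quantile _) (hU j), hU_law, map_quantile]
    rfl
  have h2 : P.map ((fun x => M.ε * x) ∘ M.Z j) = gaussianReal 0 (M.ε ^ 2).toNNReal := by
    rw [← Measure.map_map (measurable_const_mul M.ε) (hZ j), hZ_law, gaussianReal_map_const_mul,
      mul_zero, mul_one]
    congr 1
    ext
    simp [Real.coe_toNNReal _ (sq_nonneg M.ε)]
  have h3 := gaussianReal_add_gaussianReal_of_indepFun hind h1 h2
  rw [add_zero, ← Real.toNNReal_add hv (sq_nonneg _)] at h3
  exact h3

lemma ae_U_mem_Ioo (hU : ∀ j, Measurable (M.U j))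
    (hU_law : ∀ j, P.map (M.U j) = volume.restrict (Set.Icc (0 : ℝ) 1)) (j : Fin n) :
    ∀ᵐ ω ∂P, M.U j ω ∈ Set.Ioo (0 : ℝ) 1 := by
  have h1 : ∀ᵐ u ∂(P.map (M.U j)), u ∈ Set.Ioo (0 : ℝ) 1 := by
    rw [hU_law, ← restrict_Ioo_eq_restrict_Icc]
    exact ae_restrict_mem measurableSet_Ioo
  exact ae_of_ae_map (hU j).aemeasurable h1

end OUModel

/-! ### The cost of a controlled path -/

namespace OUModel

variable {n : ℕ} {Ω : Type*} {M : OUModel n Ω}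

/-- The running cost at time `t`. -/
noncomputable def runningCost (M : OUModel n Ω) (α : ℝ → Ω → ℝ) (μ : ℝ → Ω → ProbabilityMeasure ℝ)
    (ω : Ω) (t : ℝ) : ℝ≥0∞ :=
  secondMoment (μ t ω : Measure ℝ) + ENNReal.ofReal (M.C * α t ω ^ 2)

/-- The feedback form of the control that solves the linear quadratic problem. -/
def IsFeedback (M : OUModel n Ω) (s : ℝ) (α : ℝ → Ω → ℝ)
    (μ : ℝ → Ω → ProbabilityMeasure ℝ) : Prop :=
  ∀ ω, ∀ t ∈ Set.Icc s M.horizon, α t ω =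
    -(riccati M.θ M.C (M.horizon - t) * (∫ x, x ∂(μ t ω : Measure ℝ)) / M.C)

section

variable {s : ℝ} {μ₀ : ProbabilityMeasure ℝ} {α : ℝ → Ω → ℝ} {μ : ℝ → Ω → ProbabilityMeasure ℝ}
  {prior : Fin n → Ω → ProbabilityMeasure ℝ}

lemma IsControlledPath.intervalIntegrable (h : M.IsControlledPath s μ₀ α μ prior) {r t : ℝ}
    (hr : s ≤ r) (hrt : r ≤ t) (ht : t ≤ M.horizon) (ω : Ω) :
    IntervalIntegrable (fun q => α q ω) volume r t := by
  rw [intervalIntegrable_iff_integrableOn_Icc_of_le hrt]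
  exact (h.integrable ω).mono_set (Set.Icc_subset_Icc hr ht)

/-- The alternative n ≤ k covers the last interval, closed on the right because no observation takes
place at the horizon. -/
lemma obsTime_notMem_Ioc (hmono : StrictMono M.time) {k : ℕ} {x y : ℝ} (hx : M.timeNat k ≤ x)
    (hy : y < M.timeNat (k + 1) ∨ n ≤ k) (j : Fin n) : M.obsTime j ∉ Set.Ioc x y := by
  rw [obsTime_eq]
  rintro ⟨h1, h2⟩
  have h3 : k < j + 1 := by
    by_contra! h3
    exact absurd (timeNat_mono hmono h3) (not_le.2 (hx.trans_lt h1))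
  rcases hy with hy | hy
  · exact absurd (timeNat_mono hmono (show k + 1 ≤ j + 1 by omega)) (not_le.2 (h2.trans_lt hy))
  · omega

lemma IsControlledPath.solvesFokkerPlanck (h : M.IsControlledPath s μ₀ α μ prior)
    (hmono : StrictMono M.time) {k : ℕ} {q : ℝ} (hqT : q ≤ M.horizon)
    (hq : q < M.timeNat (k + 1) ∨ n ≤ k) (ω : Ω) :
    SolvesFokkerPlanck M.θ M.b (fun t => α t ω) (fun t => μ t ω) (max s (M.timeNat k)) q := by
  intro f hf x y hx hxy hy
  refine h.fokkerPlanck ω f hf.smooth hf.support x y ((le_max_left _ _).trans hx) hxy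
    (hy.trans hqT) (obsTime_notMem_Ioc hmono ((le_max_right _ _).trans hx) ?_)
  exact hq.imp_left hy.trans_lt

lemma IsControlledPath.eq_gaussianLaw (h : M.IsControlledPath s μ₀ α μ prior)
    (hmono : StrictMono M.time) {k : ℕ} {q m v : ℝ} (hrq : max s (M.timeNat k) ≤ q)
    (hqT : q ≤ M.horizon) (hq : q < M.timeNat (k + 1) ∨ n ≤ k) (hv : 0 ≤ v) {ω : Ω}
    (hμ : μ (max s (M.timeNat k)) ω = gaussianLaw m v) :
    μ q ω = gaussianLaw (meanFlow M.θ (fun t => α t ω) (max s (M.timeNat k)) q m)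
      (ouVar M.θ M.b (q - max s (M.timeNat k)) v) :=
  (h.solvesFokkerPlanck hmono hqT hq ω).eq_gaussianLaw hrq
    (h.intervalIntegrable (le_max_left _ _) hrq hqT ω) hv hμ

lemma IsControlledPath.prior_eq_gaussianLaw (h : M.IsControlledPath s μ₀ α μ prior)
    (hmono : StrictMono M.time) {m v : ℝ} (j : Fin n) (hs : s < M.obsTime j) (hv : 0 ≤ v) {ω : Ω}
    (hμ : μ (max s (M.timeNat j)) ω = gaussianLaw m v) :
    prior j ω =
      gaussianLaw (meanFlow M.θ (fun t => α t ω) (max s (M.timeNat j)) (M.timeNat (j + 1)) m)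
        (ouVar M.θ M.b (M.timeNat (j + 1) - max s (M.timeNat j)) v) := by
  have hlim := h.leftLimit ω j hs
  rw [obsTime_eq] at hlim hs
  set r := max s (M.timeNat j) with hr
  have hrt : r < M.timeNat (j + 1) :=
    max_lt hs (timeNat_lt hmono (Nat.lt_succ_self _) (by omega))
  have htT := timeNat_le_horizon hmono (j + 1)
  have hint := h.intervalIntegrable (le_max_left _ _) hrt.le htT ω
  have hmc := continuousOn_meanFlow (θ := M.θ) (m := m) hrt.le hint
  -- Clamping q to the interval makes the mean continuous and the variance nonnegative for every q;
  -- near the left limit it changes nothing.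
  have hm : Tendsto (fun q => meanFlow M.θ (fun t => α t ω) r (min (max q r) (M.timeNat (j + 1))) m)
      (𝓝[<] M.timeNat (j + 1))
      (𝓝 (meanFlow M.θ (fun t => α t ω) r (M.timeNat (j + 1)) m)) := by
    refine (hmc (M.timeNat (j + 1)) ⟨hrt.le, le_rfl⟩).tendsto.comp (tendsto_nhdsWithin_iff.2
      ⟨?_, Eventually.of_forall fun q => ⟨le_min (le_max_right _ _) hrt.le, min_le_right _ _⟩⟩)
    have hc : Continuous fun q => min (max q r) (M.timeNat (j + 1)) := by fun_prop
    have := hc.tendsto (M.timeNat (j + 1))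
    rw [max_eq_left hrt.le, min_self] at this
    exact this.mono_left nhdsWithin_le_nhds
  have hvt : Tendsto (fun q => ouVar M.θ M.b (max q r - r) v) (𝓝[<] M.timeNat (j + 1))
      (𝓝 (ouVar M.θ M.b (M.timeNat (j + 1) - r) v)) := by
    have hc : Continuous fun q => ouVar M.θ M.b (max q r - r) v :=
      (continuous_ouVar_left _ _ _).comp (by fun_prop)
    have := hc.tendsto (M.timeNat (j + 1))
    rw [max_eq_left hrt.le] at this
    exact this.mono_left nhdsWithin_le_nhds
  have hg := tendsto_gaussianLaw hm hvt
    (fun q => ouVar_nonneg _ _ (sub_nonneg.2 (le_max_right _ _)) hv)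
    (ouVar_nonneg _ _ (sub_nonneg.2 hrt.le) hv)
  refine tendsto_nhds_unique hlim (hg.congr' ?_)
  filter_upwards [Ioo_mem_nhdsLT hrt] with q hq
  rw [max_eq_left hq.1.le, min_eq_left hq.2.le]
  exact (h.eq_gaussianLaw hmono hq.1.le (hq.2.le.trans htT) (Or.inl hq.2) hv hμ).symm

/-- The running cost on an interval without observations. -/
lemma IsControlledPath.lintegral_runningCost (h : M.IsControlledPath s μ₀ α μ prior)
    (hC : 0 < M.C) (hmono : StrictMono M.time) {k : ℕ} {m v : ℝ} (hv : 0 ≤ v) {ω : Ω} (hμ : μ (max s (M.timeNat k)) ω = gaussianLaw m v) :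
    ∫⁻ q in Set.Ioc (max s (M.timeNat k)) (M.timeNat (k + 1)), M.runningCost α μ ω q =
      ∫⁻ q in Set.Ioc (max s (M.timeNat k)) (M.timeNat (k + 1)),
        ENNReal.ofReal (meanFlow M.θ (fun t => α t ω) (max s (M.timeNat k)) q m ^ 2 +
          ouVar M.θ M.b (q - max s (M.timeNat k)) v + M.C * α q ω ^ 2) := by
  rw [← restrict_Ioo_eq_restrict_Ioc]
  refine setLIntegral_congr_fun measurableSet_Ioo fun q hq => ?_
  have hv' := ouVar_nonneg M.θ M.b (sub_nonneg.2 hq.1.le) hv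
  rw [runningCost, h.eq_gaussianLaw hmono hq.1.le
    (hq.2.le.trans (timeNat_le_horizon hmono _)) (Or.inl hq.2) hv hμ,
    secondMoment_gaussianLaw _ hv', ← ENNReal.ofReal_add (by positivity) (by positivity)]

lemma IsControlledPath.le_interval_cost (h : M.IsControlledPath s μ₀ α μ prior)
    (hC : 0 < M.C) (hε : 0 < M.ε) (hmono : StrictMono M.time) {k : ℕ}
    (hs : s < M.timeNat (k + 1)) {m v : ℝ} (hv : 0 ≤ v) {ω : Ω}
    (hμ : μ (max s (M.timeNat k)) ω = gaussianLaw m v) :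
    ENNReal.ofReal (M.gaussCost k (max s (M.timeNat k)) m v) ≤
      (∫⁻ q in Set.Ioc (max s (M.timeNat k)) (M.timeNat (k + 1)), M.runningCost α μ ω q) +
        ENNReal.ofReal (riccati M.θ M.C (M.horizon - M.timeNat (k + 1)) *
          meanFlow M.θ (fun t => α t ω) (max s (M.timeNat k)) (M.timeNat (k + 1)) m ^ 2 +
          M.priorCost (k + 1) (ouVar M.θ M.b (M.timeNat (k + 1) - max s (M.timeNat k)) v)) := by
  have hrt : max s (M.timeNat k) ≤ M.timeNat (k + 1) := max_le hs.le (timeNat_mono hmono (by omega))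
  have htT := timeNat_le_horizon hmono (k + 1)
  rw [h.lintegral_runningCost hC hmono hv hμ]
  exact le_cost_Ioc hC hrt htT hv (priorCost_nonneg hC hε hmono _)
    (h.intervalIntegrable (le_max_left _ _) hrt htT ω)

lemma IsControlledPath.interval_cost_eq (h : M.IsControlledPath s μ₀ α μ prior)
    (hC : 0 < M.C) (hε : 0 < M.ε) (hmono : StrictMono M.time) {k : ℕ}
    (hs : s < M.timeNat (k + 1)) {m v : ℝ} (hv : 0 ≤ v) {ω : Ω}
    (hμ : μ (max s (M.timeNat k)) ω = gaussianLaw m v) (hfb : M.IsFeedback s α μ) :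
    ENNReal.ofReal (M.gaussCost k (max s (M.timeNat k)) m v) =
      (∫⁻ q in Set.Ioc (max s (M.timeNat k)) (M.timeNat (k + 1)), M.runningCost α μ ω q) +
        ENNReal.ofReal (riccati M.θ M.C (M.horizon - M.timeNat (k + 1)) *
          meanFlow M.θ (fun t => α t ω) (max s (M.timeNat k)) (M.timeNat (k + 1)) m ^ 2 +
          M.priorCost (k + 1) (ouVar M.θ M.b (M.timeNat (k + 1) - max s (M.timeNat k)) v)) := by
  have hrt : max s (M.timeNat k) ≤ M.timeNat (k + 1) := max_le hs.le (timeNat_mono hmono (by omega))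
  have htT := timeNat_le_horizon hmono (k + 1)
  rw [h.lintegral_runningCost hC hmono hv hμ]
  refine (cost_Ioc_eq hC hrt htT hv (priorCost_nonneg hC hε hmono _)
    (h.intervalIntegrable (le_max_left _ _) hrt htT ω) fun q hq => ?_).symm
  rw [hfb ω q ⟨(le_max_left _ _).trans hq.1.le, hq.2.le.trans htT⟩,
    h.eq_gaussianLaw hmono hq.1.le (hq.2.le.trans htT) (Or.inl hq.2) hv hμ,
    integral_id_gaussianLaw]

lemma lintegral_Ioc_add_Ioc (f : ℝ → ℝ≥0∞) {x y z : ℝ} (hxy : x ≤ y) (hyz : y ≤ z) :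
    (∫⁻ q in Set.Ioc x y, f q) + ∫⁻ q in Set.Ioc y z, f q = ∫⁻ q in Set.Ioc x z, f q := by
  rw [← Set.Ioc_union_Ioc_eq_Ioc hxy hyz, lintegral_union measurableSet_Ioc]
  exact Set.Ioc_disjoint_Ioc_of_le le_rfl

/-- The law just after the `k`-th observation is Gaussian with a deterministic variance, and the
value at this law accounts for the remaining cost. -/
lemma IsControlledPath.exists_gaussianLaw [mΩ : MeasurableSpace Ω] {P : Measure Ω}
    [IsProbabilityMeasure P] {m₀ z₀ : ℝ}
    (h : M.IsControlledPath s (gaussianLaw m₀ z₀) α μ prior)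
    (hC : 0 < M.C) (hε : 0 < M.ε) (hmono : StrictMono M.time)
    (hU : ∀ j, Measurable (M.U j)) (hZ : ∀ j, Measurable (M.Z j))
    (hU_law : ∀ j, P.map (M.U j) = volume.restrict (Set.Icc (0 : ℝ) 1))
    (hZ_law : ∀ j, P.map (M.Z j) = gaussianReal 0 1)
    (h_indep : iIndepFun (Sum.elim M.U M.Z : Fin n ⊕ Fin n → Ω → ℝ) P) {i : ℕ}
    (hs : s ∈ Set.Ico (M.timeNat i) (M.timeNat (i + 1))) (hz₀ : 0 ≤ z₀) {k : ℕ} (hik : i ≤ k) :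
    k ≤ n → ∃ (v : ℝ) (m : Ω → ℝ), 0 ≤ v ∧ Measurable[M.drivingSigma k] m ∧
      (∀ ω, μ (max s (M.timeNat k)) ω = gaussianLaw (m ω) v) ∧
      (∀ j, s < M.obsTime j → (j : ℕ) + 1 ≤ k →
        Measurable[M.drivingSigma k] (M.observation prior j)) ∧
      ENNReal.ofReal (M.gaussCost i s m₀ z₀) ≤
        ∫⁻ ω, ((∫⁻ q in Set.Ioc s (max s (M.timeNat k)), M.runningCost α μ ω q) +
          ENNReal.ofReal (M.gaussCost k (max s (M.timeNat k)) (m ω) v)) ∂P ∧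
      (M.IsFeedback s α μ → ENNReal.ofReal (M.gaussCost i s m₀ z₀) =
        ∫⁻ ω, ((∫⁻ q in Set.Ioc s (max s (M.timeNat k)), M.runningCost α μ ω q) +
          ENNReal.ofReal (M.gaussCost k (max s (M.timeNat k)) (m ω) v)) ∂P) := by
  induction k, hik using Nat.le_induction with
  | base =>
    intro hi
    have hmax : max s (M.timeNat i) = s := max_eq_left hs.1
    refine ⟨z₀, fun _ => m₀, hz₀, measurable_const, fun ω => by rw [hmax, h.initial], ?_, ?_, ?_⟩
    · intro j hj hji
      rw [obsTime_eq] at hj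
      exact absurd (hj.trans_le (timeNat_mono hmono hji)) (not_lt.2 hs.1)
    · rw [hmax]; simp
    · intro _; rw [hmax]; simp
  | succ k hik ih =>
    intro hkn
    obtain ⟨v, m, hv, hm, hlaw, hobs, hle, heq⟩ := ih (by omega)
    set r := max s (M.timeNat k) with hr
    set t := M.timeNat (k + 1) with ht
    have hst : s < t := hs.2.trans_le (timeNat_mono hmono (by omega))
    have hrt : r < t := max_lt hst (timeNat_lt hmono (Nat.lt_succ_self _) (by omega))
    have htT : t ≤ M.horizon := timeNat_le_horizon hmono (k + 1)
    have hmax : max s t = t := max_eq_right hst.le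
    set j : Fin n := ⟨k, by omega⟩ with hj
    have hjt : M.obsTime j = t := obsTime_eq _ _
    have hsj : s < M.obsTime j := by rw [hjt]; exact hst
    have hint : ∀ ω, IntervalIntegrable (fun q => α q ω) volume r t := fun ω =>
      h.intervalIntegrable (le_max_left _ _) hrt.le htT ω
    set m' : Ω → ℝ := fun ω => meanFlow M.θ (fun q => α q ω) r t (m ω) with hm'
    set v' := ouVar M.θ M.b (t - r) v with hv'
    have hv'0 : 0 ≤ v' := ouVar_nonneg _ _ (sub_nonneg.2 hrt.le) hv
    have hprior : ∀ ω, prior j ω = gaussianLaw (m' ω) v' := fun ω =>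
      h.prior_eq_gaussianLaw hmono j hsj hv (hlaw ω)
    -- Observations at times up to q < t have index below k. Hence the mean before this observation
    -- depends only on earlier noise, which gives the independence needed below.
    have hm'meas : Measurable[M.drivingSigma k] m' := by
      refine @measurable_meanFlow Ω (M.drivingSigma k) α M.θ s r t (le_max_left _ _) hrt.le ?_
        hint m hm
      intro q hq
      have hsq : s ≤ q := (le_max_left _ _).trans hq.1
      refine (h.adapted q ⟨hsq, hq.2.le.trans htT⟩).mono ?_ le_rfl
      refine sup_le_sup le_rfl (MeasurableSpace.comap_mono (obsSigma_le fun l hl hlq => ?_))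
      refine hobs l hl ?_
      by_contra! hcon
      have := timeNat_mono hmono (show k + 1 ≤ l + 1 by omega)
      rw [obsTime_eq] at hlq
      exact absurd (this.trans hlq) (not_le.2 hq.2)
    have hY : ∀ ω, M.observation prior j ω =
        quantile (gaussianLaw (m' ω) v' : Measure ℝ) (M.U j ω) + M.ε * M.Z j ω := fun ω => by
      rw [observation, hprior]
    have hm'meas1 : Measurable[M.drivingSigma (k + 1)] m' :=
      hm'meas.mono (M.drivingSigma_mono (Nat.le_succ k)) le_rfl
    have hYmeas : Measurable[M.drivingSigma (k + 1)] (M.observation prior j) := by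
      rw [show M.observation prior j = _ from funext hY]
      exact ((measurable_quantile_gaussianLaw v').comp
        (hm'meas1.prodMk (M.measurable_U_drivingSigma j (Nat.lt_succ_self k)))).add
        ((M.measurable_Z_drivingSigma j (Nat.lt_succ_self k)).const_mul _)
    have hm'mΩ : Measurable m' := hm'meas.mono (drivingSigma_le hU hZ k) le_rfl
    set κ := v' / (v' + M.ε ^ 2) with hκ
    set v'' := v' * M.ε ^ 2 / (v' + M.ε ^ 2) with hv''
    have hv''0 : 0 ≤ v'' := posterior_nonneg hε hv'0
    set m'' : Ω → ℝ := fun ω => m' ω + κ * (M.observation prior j ω - m' ω) with hm''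
    -- Only almost surely: for U outside (0, 1) the quantile may be a default value that does not
    -- follow the translation by the mean.
    have hae : ∀ᵐ ω ∂P, m'' ω = m' ω + κ * M.innovation v' j ω := by
      filter_upwards [ae_U_mem_Ioo hU hU_law j] with ω hω
      simp only [hm'', hY, innovation, quantile_gaussianLaw_of_mem (m' ω) v' hω]
      ring
    set p := riccati M.θ M.C (M.horizon - t) with hp
    set c := varCost M.θ M.b (M.priorCost (k + 1 + 1)) (M.timeNat (k + 1 + 1) - t) v'' with hc
    have hp0 : 0 ≤ p := (riccati_pos M.θ hC (sub_nonneg.2 htT)).le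
    have hc0 : 0 ≤ c := varCost_nonneg _ _ (priorCost_nonneg hC hε hmono _)
      (sub_nonneg.2 (timeNat_mono hmono (Nat.le_succ _))) hv''0
    have hpc : p * (κ ^ 2 * ((v' + M.ε ^ 2).toNNReal : ℝ)) + c = M.priorCost (k + 1) v' := by
      have hpos : 0 < v' + M.ε ^ 2 := by positivity
      rw [priorCost_eq M hkn, Real.coe_toNNReal _ hpos.le]
      congr 2
      rw [hκ]; field_simp
    -- Integrating out the innovation turns the value after the observation into the cost-to-go
    -- before it, which is the terminal cost of the preceding interval.
    have hcost : ∫⁻ ω, ((∫⁻ q in Set.Ioc s t, M.runningCost α μ ω q) +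
          ENNReal.ofReal (M.gaussCost (k + 1) t (m'' ω) v'')) ∂P =
        ∫⁻ ω, ((∫⁻ q in Set.Ioc s r, M.runningCost α μ ω q) +
          ((∫⁻ q in Set.Ioc r t, M.runningCost α μ ω q) +
            ENNReal.ofReal (p * m' ω ^ 2 + M.priorCost (k + 1) v'))) ∂P := by
      rw [lintegral_congr_ae (g := fun ω => (∫⁻ q in Set.Ioc s t, M.runningCost α μ ω q) +
        ENNReal.ofReal (p * (m' ω + κ * M.innovation v' j ω) ^ 2 + c)),
        lintegral_posterior _ hm'mΩ (measurable_innovation (hU j) (hZ j) v')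
          (indepFun_innovation hU hZ h_indep v' j hm'meas)
          (map_innovation hU hZ hU_law hZ_law h_indep hv'0 j) hp0 hc0 κ, hpc]
      · refine lintegral_congr fun ω => ?_
        rw [← add_assoc, lintegral_Ioc_add_Ioc _ (le_max_left _ _) hrt.le]
      · filter_upwards [hae] with ω hω
        rw [gaussCost, hω]
    refine ⟨v'', m'', hv''0, ?_, ?_, ?_, ?_, ?_⟩
    · exact hm'meas1.add ((hYmeas.sub hm'meas1).const_mul _)
    · intro ω
      rw [hmax]
      apply Subtype.ext
      have := h.update ω j hsj
      rw [hjt, hprior, bayesUpdate_gaussianLaw hε hv'0] at this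
      exact this
    · intro l hl hlk
      rcases Nat.lt_or_ge (l : ℕ) k with hlt | hge
      · exact (hobs l hl hlt).mono (M.drivingSigma_mono (Nat.le_succ k)) le_rfl
      · have : l = j := Fin.ext (by simp [hj]; omega)
        rw [this]; exact hYmeas
    · rw [hmax, hcost]
      refine hle.trans (lintegral_mono fun ω => ?_)
      exact add_le_add le_rfl (h.le_interval_cost hC hε hmono hst hv (hlaw ω))
    · intro hfb
      rw [hmax, hcost, heq hfb]
      refine lintegral_congr fun ω => ?_
      rw [h.interval_cost_eq hC hε hmono hst hv (hlaw ω) hfb]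

/-- The cost of a controlled path is at least the value, with equality for the feedback control. -/
lemma IsControlledPath.le_cost [mΩ : MeasurableSpace Ω] {P : Measure Ω}
    [IsProbabilityMeasure P] {m₀ z₀ : ℝ}
    (h : M.IsControlledPath s (gaussianLaw m₀ z₀) α μ prior)
    (hC : 0 < M.C) (hε : 0 < M.ε) (hmono : StrictMono M.time)
    (hU : ∀ j, Measurable (M.U j)) (hZ : ∀ j, Measurable (M.Z j))
    (hU_law : ∀ j, P.map (M.U j) = volume.restrict (Set.Icc (0 : ℝ) 1))
    (hZ_law : ∀ j, P.map (M.Z j) = gaussianReal 0 1)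
    (h_indep : iIndepFun (Sum.elim M.U M.Z : Fin n ⊕ Fin n → Ω → ℝ) P) {i : ℕ}
    (hi : i ≤ n) (hs : s ∈ Set.Ico (M.timeNat i) (M.timeNat (i + 1))) (hz₀ : 0 ≤ z₀) :
    ENNReal.ofReal (M.gaussCost i s m₀ z₀) ≤ M.cost P s α μ ∧
      (M.IsFeedback s α μ → M.cost P s α μ = ENNReal.ofReal (M.gaussCost i s m₀ z₀)) := by
  obtain ⟨v, m, hv, -, hlaw, -, hle, heq⟩ := h.exists_gaussianLaw hC hε hmono hU hZ hU_law hZ_law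
    h_indep hs hz₀ hi le_rfl
  set r := max s (M.timeNat n) with hr
  have hT : M.horizon = M.timeNat (n + 1) := horizon_eq _
  have hsT : s < M.timeNat (n + 1) := hs.2.trans_le (timeNat_mono hmono (by omega))
  have hrT : r ≤ M.timeNat (n + 1) := max_le hsT.le (timeNat_mono hmono (Nat.le_succ n))
  have hcost : M.cost P s α μ = ∫⁻ ω, ((∫⁻ q in Set.Ioc s r, M.runningCost α μ ω q) +
      ((∫⁻ q in Set.Ioc r (M.timeNat (n + 1)), M.runningCost α μ ω q) +
        ENNReal.ofReal (riccati M.θ M.C (M.horizon - M.timeNat (n + 1)) *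
          meanFlow M.θ (fun t => α t ω) r (M.timeNat (n + 1)) (m ω) ^ 2 +
          M.priorCost (n + 1) (ouVar M.θ M.b (M.timeNat (n + 1) - r) v)))) ∂P := by
    refine lintegral_congr fun ω => ?_
    rw [← add_assoc, lintegral_Ioc_add_Ioc _ (le_max_left _ _) hrT, ← restrict_Ioc_eq_restrict_Icc,
      priorCost_last, ← hT, sub_self, riccati_zero, one_mul,
      h.eq_gaussianLaw hmono (hrT.trans_eq hT.symm) le_rfl (Or.inr le_rfl) hv (hlaw ω),
      secondMoment_gaussianLaw _ (ouVar_nonneg _ _ (sub_nonneg.2 (hrT.trans_eq hT.symm)) hv)]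
    rfl
  rw [hcost]
  constructor
  · refine hle.trans (lintegral_mono fun ω => ?_)
    exact add_le_add le_rfl (h.le_interval_cost hC hε hmono hsT hv (hlaw ω))
  · intro hfb
    rw [heq hfb]
    refine lintegral_congr fun ω => ?_
    rw [h.interval_cost_eq hC hε hmono hsT hv (hlaw ω) hfb]

lemma IsControlledPath.cost_horizon [MeasurableSpace Ω] {P : Measure Ω} [IsProbabilityMeasure P]
    {m₀ z₀ : ℝ} (h : M.IsControlledPath M.horizon (gaussianLaw m₀ z₀) α μ prior) (hz₀ : 0 ≤ z₀) :
    M.cost P M.horizon α μ = ENNReal.ofReal (m₀ ^ 2 + z₀) := by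
  simp [cost, h.initial, secondMoment_gaussianLaw _ hz₀]

end

end OUModel

/-! ### The optimal controlled path -/

/-- A process indexed by a monotone counter is progressively measurable. -/
lemma measurable_comp_monotone {Ω : Type*} [MeasurableSpace Ω] {κ : ℝ → ℕ} (hκ : Monotone κ)
    {s t : ℝ} {f : ℕ → Ω → ℝ} (hf : ∀ k ≤ κ t, Measurable (f k)) :
    Measurable fun p : Set.Icc s t × Ω => f (κ p.1) p.2 := by
  -- Only the f k with k ≤ κ t are measurable. By monotonicity the counter never exceeds κ t on [s,
  -- t], so truncating it is harmless.
  have h1 : Measurable fun p : ℕ × Ω => f (min p.1 (κ t)) p.2 :=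
    measurable_from_prod_countable_right fun k => hf _ (min_le_right _ _)
  have h2 : Measurable fun p : Set.Icc s t × Ω => (κ p.1, p.2) :=
    (hκ.measurable.comp (measurable_subtype_coe.comp measurable_fst)).prodMk measurable_snd
  convert h1.comp h2 using 2 with p
  simp [min_eq_left (hκ p.1.2.2)]

namespace OUModel

variable {n : ℕ} {Ω : Type*} (M : OUModel n Ω)

open scoped Classical in
/-- The number of observations made up to time `t`. -/
noncomputable def obsIndex (t : ℝ) : ℕ := Nat.findGreatest (fun k => M.timeNat k ≤ t) n

/-- The conditional variance after `k` observations, when the path starts at time `s`. -/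
noncomputable def postVar (s z₀ : ℝ) : ℕ → ℝ
  | 0 => z₀
  | k + 1 =>
    if k < n ∧ s < M.timeNat (k + 1) then
      ouVar M.θ M.b (M.timeNat (k + 1) - max s (M.timeNat k)) (postVar s z₀ k) * M.ε ^ 2 /
        (ouVar M.θ M.b (M.timeNat (k + 1) - max s (M.timeNat k)) (postVar s z₀ k) + M.ε ^ 2)
    else postVar s z₀ k

/-- The conditional variance just before the `(k + 1)`-st observation. -/
noncomputable def preVar (s z₀ : ℝ) (k : ℕ) : ℝ :=
  ouVar M.θ M.b (M.timeNat (k + 1) - max s (M.timeNat k)) (M.postVar s z₀ k)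

/-- The constant of proportionality between the conditional mean of the optimal path at time `t`
and `riccatiDen (T - t)`, after `k` observations. -/
noncomputable def meanCoeff (s m₀ z₀ : ℝ) : ℕ → Ω → ℝ
  | 0, _ => m₀ / riccatiDen M.θ M.C (M.horizon - s)
  | k + 1, ω =>
    if h : k < n ∧ s < M.timeNat (k + 1) then
      meanCoeff s m₀ z₀ k ω + M.preVar s z₀ k / (M.preVar s z₀ k + M.ε ^ 2) *
        (quantile (gaussianLaw (meanCoeff s m₀ z₀ k ω *
            riccatiDen M.θ M.C (M.horizon - M.timeNat (k + 1))) (M.preVar s z₀ k) : Measure ℝ)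
            (M.U ⟨k, h.1⟩ ω) + M.ε * M.Z ⟨k, h.1⟩ ω -
          meanCoeff s m₀ z₀ k ω * riccatiDen M.θ M.C (M.horizon - M.timeNat (k + 1))) /
        riccatiDen M.θ M.C (M.horizon - M.timeNat (k + 1))
    else meanCoeff s m₀ z₀ k ω

/-- The optimal control. -/
noncomputable def optControl (s m₀ z₀ t : ℝ) (ω : Ω) : ℝ :=
  -(M.meanCoeff s m₀ z₀ (M.obsIndex t) ω * riccatiNum M.θ M.C (M.horizon - t) / M.C)

/-- The conditional law under the optimal control. -/
noncomputable def optLaw (s m₀ z₀ t : ℝ) (ω : Ω) : ProbabilityMeasure ℝ :=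
  gaussianLaw (M.meanCoeff s m₀ z₀ (M.obsIndex t) ω * riccatiDen M.θ M.C (M.horizon - t))
    (ouVar M.θ M.b (t - max s (M.timeNat (M.obsIndex t))) (M.postVar s z₀ (M.obsIndex t)))

/-- The conditional law under the optimal control just before an observation. -/
noncomputable def optPrior (s m₀ z₀ : ℝ) (j : Fin n) (ω : Ω) : ProbabilityMeasure ℝ :=
  gaussianLaw (M.meanCoeff s m₀ z₀ j ω * riccatiDen M.θ M.C (M.horizon - M.timeNat (j + 1)))
    (M.preVar s z₀ j)

variable {M} {s m₀ z₀ : ℝ}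

lemma obsIndex_le (t : ℝ) : M.obsIndex t ≤ n := Nat.findGreatest_le n

lemma timeNat_obsIndex_le {t : ℝ} (ht : M.timeNat 0 ≤ t) : M.timeNat (M.obsIndex t) ≤ t := by
  classical
  exact Nat.findGreatest_spec (P := fun k => M.timeNat k ≤ t) (Nat.zero_le n) ht

lemma lt_timeNat_obsIndex_succ (t : ℝ) :
    t < M.timeNat (M.obsIndex t + 1) ∨ n ≤ M.obsIndex t := by
  classical
  by_contra! h
  exact Nat.findGreatest_is_greatest (P := fun k => M.timeNat k ≤ t) (n := n)
    (k := M.obsIndex t + 1) (Nat.lt_succ_self _) h.2 h.1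

lemma obsIndex_mono : Monotone M.obsIndex := fun _ _ h =>
  Nat.findGreatest_mono (fun _ hk => le_trans hk h) le_rfl

lemma obsIndex_eq (hmono : StrictMono M.time) {k : ℕ} {t : ℝ} (hk : k ≤ n)
    (h1 : M.timeNat k ≤ t) (h2 : t < M.timeNat (k + 1) ∨ n ≤ k) : M.obsIndex t = k := by
  apply le_antisymm
  · by_contra! h
    have h3 := timeNat_obsIndex_le (M := M) ((timeNat_mono hmono (Nat.zero_le k)).trans h1)
    have h4 := timeNat_mono hmono (Nat.succ_le_of_lt h)
    have h5 := M.obsIndex_le t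
    rcases h2 with h2 | h2
    · exact absurd (h4.trans h3) (not_le.2 h2)
    · omega
  · classical
    exact Nat.le_findGreatest hk h1

lemma postVar_nonneg (hε : 0 < M.ε) (hmono : StrictMono M.time) (hz₀ : 0 ≤ z₀) (k : ℕ) :
    0 ≤ M.postVar s z₀ k := by
  induction k with
  | zero => exact hz₀
  | succ k ih =>
    rw [postVar]
    split_ifs with h
    · exact posterior_nonneg hε (ouVar_nonneg _ _ (sub_nonneg.2
        (max_le h.2.le (timeNat_mono hmono (Nat.le_succ k)))) ih)
    · exact ih

/-- The index counts observation times from the start of the model rather than from s, so the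
updates up to time s are skipped. -/
lemma postVar_of_le (hmono : StrictMono M.time) {k : ℕ} (hk : M.timeNat k ≤ s) :
    M.postVar s z₀ k = z₀ := by
  induction k with
  | zero => rfl
  | succ k ih =>
    rw [postVar, if_neg fun h => not_lt.2 hk h.2,
      ih ((timeNat_mono hmono (Nat.le_succ k)).trans hk)]

lemma meanCoeff_of_le (hmono : StrictMono M.time) {k : ℕ} (hk : M.timeNat k ≤ s) (ω : Ω) :
    M.meanCoeff s m₀ z₀ k ω = m₀ / riccatiDen M.θ M.C (M.horizon - s) := by
  induction k with
  | zero => rfl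
  | succ k ih =>
    rw [meanCoeff, dif_neg fun h => not_lt.2 hk h.2,
      ih ((timeNat_mono hmono (Nat.le_succ k)).trans hk)]

lemma meanCoeff_succ {j : Fin n} (hj : s < M.obsTime j) (ω : Ω) :
    M.meanCoeff s m₀ z₀ (j + 1) ω = M.meanCoeff s m₀ z₀ j ω +
      M.preVar s z₀ j / (M.preVar s z₀ j + M.ε ^ 2) *
        (M.observation (M.optPrior s m₀ z₀) j ω -
          M.meanCoeff s m₀ z₀ j ω * riccatiDen M.θ M.C (M.horizon - M.timeNat (j + 1))) /
        riccatiDen M.θ M.C (M.horizon - M.timeNat (j + 1)) := by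
  rw [obsTime_eq] at hj
  rw [meanCoeff, dif_pos ⟨j.2, hj⟩]
  rfl

/-- Rewritten by `meanCoeff_succ`, the recursion involves the noise only through the observations;
the feedback is thus adapted to the observation filtration itself. -/
lemma measurable_meanCoeff (hmono : StrictMono M.time) {t : ℝ} {k : ℕ} (hk : k ≤ n)
    (ht : M.timeNat k ≤ t) :
    Measurable[M.obsSigma (M.optPrior s m₀ z₀) s t] (M.meanCoeff s m₀ z₀ k) := by
  induction k with
  | zero => exact measurable_const
  | succ k ih =>
    have ih' := ih (by omega) ((timeNat_mono hmono (Nat.le_succ k)).trans ht)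
    by_cases hs : s < M.timeNat (k + 1)
    · set j : Fin n := ⟨k, hk⟩ with hj
      have hsj : s < M.obsTime j := by rw [obsTime_eq]; exact hs
      have hjt : M.obsTime j ≤ t := by rw [obsTime_eq]; exact ht
      have hY : Measurable[M.obsSigma (M.optPrior s m₀ z₀) s t]
          (M.observation (M.optPrior s m₀ z₀) j) := by
        have h1 : MeasurableSpace.comap (M.observation (M.optPrior s m₀ z₀) j) (borel ℝ) ≤
            M.obsSigma (M.optPrior s m₀ z₀) s t :=
          le_iSup₂_of_le (f := fun (j : Fin n) (_ : s < M.obsTime j ∧ M.obsTime j ≤ t) =>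
            MeasurableSpace.comap (M.observation (M.optPrior s m₀ z₀) j) (borel ℝ))
            j ⟨hsj, hjt⟩ le_rfl
        rw [← BorelSpace.measurable_eq (α := ℝ)] at h1
        exact (comap_measurable _).mono h1 le_rfl
      rw [show M.meanCoeff s m₀ z₀ (k + 1) = _ from funext (meanCoeff_succ hsj)]
      exact ih'.add (((hY.sub (ih'.mul_const _)).const_mul _).div_const _)
    · rw [show M.meanCoeff s m₀ z₀ (k + 1) = M.meanCoeff s m₀ z₀ k from funext fun ω => by
        rw [meanCoeff, dif_neg fun h => hs h.2]]
      exact ih'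

lemma continuous_riccatiNum_sub (θ C T : ℝ) (hC : 0 < C) :
    Continuous fun t => riccatiNum θ C (T - t) := by
  have : Continuous (riccatiNum θ C) :=
    continuous_iff_continuousAt.2 fun h => (hasDerivAt_riccatiNum θ hC h).continuousAt
  exact this.comp (by fun_prop)

/-- Between observations the mean is a constant times `riccatiDen` and the control minus the same
constant times `riccatiNum`/C, so `hasDerivAt_riccatiDen` is the mean equation. An observation
changes only the constant and the variance. -/
lemma isControlledPath_opt (hC : 0 < M.C) (hε : 0 < M.ε) (hmono : StrictMono M.time)
    (hs : M.timeNat 0 ≤ s) (hsT : s ≤ M.horizon) (hz₀ : 0 ≤ z₀) :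
    M.IsControlledPath s (gaussianLaw m₀ z₀) (M.optControl s m₀ z₀) (M.optLaw s m₀ z₀)
      (M.optPrior s m₀ z₀) := by
  have hnum : Continuous fun t => riccatiNum M.θ M.C (M.horizon - t) :=
    continuous_riccatiNum_sub M.θ M.C M.horizon hC
  have hden' : ∀ t, HasDerivAt (fun t => riccatiDen M.θ M.C (M.horizon - t))
      (-(M.θ * riccatiDen M.θ M.C (M.horizon - t) + riccatiNum M.θ M.C (M.horizon - t) / M.C)) t :=
    fun t => (hasDerivAt_riccatiDen M.θ hC (M.horizon - t)).comp_const_sub M.horizon t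
  have hden : Continuous fun t => riccatiDen M.θ M.C (M.horizon - t) :=
    continuous_iff_continuousAt.2 fun t => (hden' t).continuousAt
  have hdenpos : ∀ t ≤ M.horizon, 0 < riccatiDen M.θ M.C (M.horizon - t) := fun t ht =>
    riccatiDen_pos M.θ hC (sub_nonneg.2 ht)
  have hpre : ∀ j : Fin n, s < M.obsTime j → 0 ≤ M.preVar s z₀ j := fun j hj => by
    rw [obsTime_eq] at hj
    exact ouVar_nonneg _ _ (sub_nonneg.2 (max_le hj.le (timeNat_mono hmono (Nat.le_succ _))))
      (postVar_nonneg hε hmono hz₀ _)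
  constructor
  · intro t ht
    set 𝒜 := M.obsSigma (M.optPrior s m₀ z₀) s t with h𝒜
    have h4 : Measurable[MeasurableSpace.prod inferInstance 𝒜] fun p : Set.Icc s t × Ω =>
        M.meanCoeff s m₀ z₀ (M.obsIndex p.1) p.2 :=
      @measurable_comp_monotone Ω 𝒜 M.obsIndex obsIndex_mono s t _ fun k hk =>
        measurable_meanCoeff hmono (hk.trans (obsIndex_le t))
          ((timeNat_mono hmono hk).trans (timeNat_obsIndex_le (hs.trans ht.1)))
    have h6 : Measurable[MeasurableSpace.prod inferInstance 𝒜] fun p : Set.Icc s t × Ω =>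
        riccatiNum M.θ M.C (M.horizon - p.1) :=
      hnum.measurable.comp (measurable_subtype_coe.comp (@measurable_fst _ _ _ 𝒜))
    exact ((h4.mul h6).div_const _).neg
  · intro ω
    have h1 : Measurable fun t => M.meanCoeff s m₀ z₀ (M.obsIndex t) ω :=
      (measurable_from_nat (f := fun k => M.meanCoeff s m₀ z₀ k ω)).comp obsIndex_mono.measurable
    have h2 : IntegrableOn (fun t => riccatiNum M.θ M.C (M.horizon - t))
        (Set.Icc s M.horizon) := hnum.continuousOn.integrableOn_Icc
    have h3 := Integrable.bdd_mul (c := ∑ k ∈ Finset.range (n + 1), |M.meanCoeff s m₀ z₀ k ω|)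
      h2 h1.aestronglyMeasurable (Eventually.of_forall fun t => by
        rw [Real.norm_eq_abs]
        exact Finset.single_le_sum (f := fun k => |M.meanCoeff s m₀ z₀ k ω|)
          (fun _ _ => abs_nonneg _)
          (Finset.mem_range.2 (Nat.lt_succ_of_le (obsIndex_le t))))
    exact (h3.div_const M.C).neg
  · intro ω
    have hle := timeNat_obsIndex_le hs
    rw [optLaw, postVar_of_le hmono hle, meanCoeff_of_le hmono hle, max_eq_left hle, sub_self,
      ouVar_zero, div_mul_cancel₀ _ (hdenpos s hsT).ne']
  · intro ω f hf hf' r t hsr hrt htT hobs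
    set k := M.obsIndex r with hk
    have hkr : M.timeNat k ≤ r := timeNat_obsIndex_le (hs.trans hsr)
    -- The index can increase only at an observation time in (r, t], and there is none.
    have hidx : ∀ q ∈ Set.Icc r t, M.obsIndex q = k := fun q hq => by
      refine obsIndex_eq hmono (obsIndex_le r) (hkr.trans hq.1) ?_
      rcases lt_timeNat_obsIndex_succ (M := M) r with h | h
      · rcases Nat.lt_or_ge k n with hkn | hkn
        · left
          by_contra! hcon
          refine hobs ⟨k, hkn⟩ ?_
          rw [obsTime_eq]
          exact ⟨h, hcon.trans hq.2⟩
        · exact Or.inr hkn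
      · exact Or.inr h
    have key := gaussianLaw_solvesFokkerPlanck (θ := M.θ) (b := M.b) (r := max s (M.timeNat k))
      (t := t) (a := fun q => -(M.meanCoeff s m₀ z₀ k ω *
        riccatiNum M.θ M.C (M.horizon - q) / M.C))
      (m := fun q => M.meanCoeff s m₀ z₀ k ω * riccatiDen M.θ M.C (M.horizon - q))
      (postVar_nonneg (s := s) hε hmono hz₀ k) (Continuous.continuousOn (by fun_prop))
      (Continuous.continuousOn (by fun_prop))
      (fun q _ => ((hden' q).const_mul _).congr_deriv (by ring)) f ⟨hf, hf'⟩ r t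
      (max_le hsr hkr) hrt le_rfl
    have hlaw : ∀ q ∈ Set.Icc r t, M.optLaw s m₀ z₀ q ω =
        gaussianLaw (M.meanCoeff s m₀ z₀ k ω * riccatiDen M.θ M.C (M.horizon - q))
          (ouVar M.θ M.b (q - max s (M.timeNat k)) (M.postVar s z₀ k)) := fun q hq => by
      rw [optLaw, hidx q hq]
    have hctrl : ∀ q ∈ Set.Icc r t, M.optControl s m₀ z₀ q ω =
        -(M.meanCoeff s m₀ z₀ k ω * riccatiNum M.θ M.C (M.horizon - q) / M.C) := fun q hq => by
      rw [optControl, hidx q hq]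
    have heq : Set.EqOn (fun q => ∫ x, ouGenerator M.θ M.b (M.optControl s m₀ z₀ q ω) f x
        ∂(M.optLaw s m₀ z₀ q ω : Measure ℝ)) (fun q => ∫ x, ouGenerator M.θ M.b
          (-(M.meanCoeff s m₀ z₀ k ω * riccatiNum M.θ M.C (M.horizon - q) / M.C)) f x
        ∂(gaussianLaw (M.meanCoeff s m₀ z₀ k ω * riccatiDen M.θ M.C (M.horizon - q))
          (ouVar M.θ M.b (q - max s (M.timeNat k)) (M.postVar s z₀ k)) : Measure ℝ))
        (Set.uIcc r t) := fun q hq => by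
      rw [Set.uIcc_of_le hrt] at hq
      simp only [hlaw q hq, hctrl q hq]
    refine ⟨key.1.congr fun q hq => (heq (Set.uIoc_subset_uIcc hq)).symm, ?_⟩
    rw [intervalIntegral.integral_congr heq, hlaw t ⟨hrt, le_rfl⟩, hlaw r ⟨le_rfl, hrt⟩]
    exact key.2
  · intro ω j hj
    have hpre' := hpre j hj
    rw [obsTime_eq] at hj ⊢
    set t := M.timeNat (j + 1) with ht
    set r := max s (M.timeNat j) with hr
    have hrt : r < t := max_lt hj (timeNat_lt hmono (Nat.lt_succ_self _) (by omega))
    have hm : Tendsto (fun q => M.meanCoeff s m₀ z₀ j ω * riccatiDen M.θ M.C (M.horizon - q))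
        (𝓝[<] t) (𝓝 (M.meanCoeff s m₀ z₀ j ω * riccatiDen M.θ M.C (M.horizon - t))) :=
      ((hden.const_mul _).tendsto t).mono_left nhdsWithin_le_nhds
    have hv : Tendsto (fun q => ouVar M.θ M.b (max q r - r) (M.postVar s z₀ j)) (𝓝[<] t)
        (𝓝 (M.preVar s z₀ j)) := by
      have hc : Continuous fun q => ouVar M.θ M.b (max q r - r) (M.postVar s z₀ j) :=
        (continuous_ouVar_left _ _ _).comp (by fun_prop)
      have := hc.tendsto t
      rw [max_eq_left hrt.le] at this
      exact this.mono_left nhdsWithin_le_nhds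
    refine (tendsto_gaussianLaw hm hv (fun q => ouVar_nonneg _ _
      (sub_nonneg.2 (le_max_right _ _)) (postVar_nonneg hε hmono hz₀ _)) hpre').congr' ?_
    filter_upwards [Ioo_mem_nhdsLT hrt] with q hq
    rw [optLaw, obsIndex_eq hmono j.2.le ((le_max_right _ _).trans hq.1.le) (Or.inl hq.2),
      max_eq_left hq.1.le]
  · intro ω j hj
    -- Observation j, counted from 0, takes place at t_{j+1}, and the law at that time is already
    -- the updated one.
    have hidx : M.obsIndex (M.obsTime j) = j + 1 := by
      rw [obsTime_eq]
      exact obsIndex_eq hmono j.2 le_rfl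
        (Or.inl (timeNat_lt hmono (Nat.lt_succ_self _) (by omega)))
    have hcond : (j : ℕ) < n ∧ s < M.timeNat (j + 1) := ⟨j.2, by rwa [← obsTime_eq]⟩
    have hd := (hdenpos (M.timeNat (j + 1)) (timeNat_le_horizon hmono _)).ne'
    rw [optPrior, bayesUpdate_gaussianLaw hε (hpre j hj), optLaw, hidx, meanCoeff_succ hj,
      postVar, if_pos hcond, obsTime_eq, max_eq_right hcond.2.le, sub_self, ouVar_zero, add_mul,
      div_mul_cancel₀ _ hd]
    rfl

lemma isFeedback_opt (hC : 0 < M.C) : M.IsFeedback s (M.optControl s m₀ z₀) (M.optLaw s m₀ z₀) := by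
  intro ω t ht
  have hd := (riccatiDen_pos M.θ hC (sub_nonneg.2 ht.2)).ne'
  rw [optLaw, integral_id_gaussianLaw, optControl, riccati]
  field_simp

end OUModel

/-! ### The value at Gaussian laws -/

namespace OUModel

variable {n : ℕ} {Ω : Type*} [MeasurableSpace Ω] {P : Measure Ω} [IsProbabilityMeasure P]
  {M : OUModel n Ω}

/-- The value at Gaussian laws before the horizon. -/
lemma value_gaussianLaw (hC : 0 < M.C) (hε : 0 < M.ε) (hmono : StrictMono M.time)
    (hU : ∀ j, Measurable (M.U j)) (hZ : ∀ j, Measurable (M.Z j))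
    (hU_law : ∀ j, P.map (M.U j) = volume.restrict (Set.Icc (0 : ℝ) 1))
    (hZ_law : ∀ j, P.map (M.Z j) = gaussianReal 0 1)
    (h_indep : iIndepFun (Sum.elim M.U M.Z : Fin n ⊕ Fin n → Ω → ℝ) P) {i : ℕ}
    (hi : i ≤ n) {s : ℝ} (hs : s ∈ Set.Ico (M.timeNat i) (M.timeNat (i + 1))) (m : ℝ) {z : ℝ}
    (hz : 0 ≤ z) : M.value P s (gaussianLaw m z) = ENNReal.ofReal (M.gaussCost i s m z) := by
  have hopt := isControlledPath_opt (M := M) (m₀ := m) hC hε hmono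
    ((timeNat_mono hmono (Nat.zero_le i)).trans hs.1)
    (hs.2.le.trans (timeNat_le_horizon hmono _)) hz
  apply le_antisymm
  · refine (iInf₂_le_of_le _ _ (iInf₂_le_of_le _ hopt le_rfl)).trans_eq ?_
    exact (hopt.le_cost hC hε hmono hU hZ hU_law hZ_law h_indep hi hs hz).2 (isFeedback_opt hC)
  · refine le_iInf fun α => le_iInf fun μ => le_iInf fun prior => le_iInf fun h => ?_
    exact (h.le_cost hC hε hmono hU hZ hU_law hZ_law h_indep hi hs hz).1

/-- The horizon lies in none of the half-open intervals. There the running cost vanishes and all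
admissible paths have the same cost; the optimal one shows that there is at least one. -/
lemma value_horizon (hC : 0 < M.C) (hε : 0 < M.ε) (hmono : StrictMono M.time) (m : ℝ) {z : ℝ}
    (hz : 0 ≤ z) : M.value P M.horizon (gaussianLaw m z) = ENNReal.ofReal (m ^ 2 + z) := by
  have hopt := isControlledPath_opt (M := M) (m₀ := m) hC hε hmono
    (timeNat_le_horizon hmono 0) le_rfl hz
  apply le_antisymm
  · exact (iInf₂_le_of_le _ _ (iInf₂_le_of_le _ hopt le_rfl)).trans_eq (hopt.cost_horizon hz)
  · refine le_iInf fun α => le_iInf fun μ => le_iInf fun prior => le_iInf fun h => ?_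
    exact (h.cost_horizon hz).ge

end OUModel

theorem lemma4p3 {n : ℕ} {Ω : Type*} [MeasurableSpace Ω] (P : Measure Ω) [IsProbabilityMeasure P]
    (M : OUModel n Ω) (hC : 0 < M.C) (hε : 0 < M.ε)
    (htime : StrictMono M.time) (htime_zero : M.time 0 = 0)
    (hU : ∀ j, Measurable (M.U j)) (hZ : ∀ j, Measurable (M.Z j))
    (hU_law : ∀ j, P.map (M.U j) = volume.restrict (Set.Icc (0 : ℝ) 1))
    (hZ_law : ∀ j, P.map (M.Z j) = gaussianReal 0 1)
    (h_indep : iIndepFun (Sum.elim M.U M.Z : Fin n ⊕ Fin n → Ω → ℝ) P) :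
    -- the value function is finite at Gaussian laws
    (∀ t ∈ Set.Icc 0 M.horizon, ∀ m z : ℝ, 0 ≤ z → M.value P t (gaussianLaw m z) ≠ ⊤) ∧
    -- the equation on `[t_i, t_{i+1})`, `i = 0, …, n`
    (∀ i : Fin (n + 1), ∀ t ∈ Set.Ico (M.time i.castSucc) (M.time i.succ),
      ∀ m z : ℝ, 0 ≤ z → ∃ Ut Um Uz : ℝ,
        HasDerivWithinAt (fun r => M.gaussValue P r m z) Ut
          (Set.Ico (M.time i.castSucc) (M.time i.succ)) t ∧
        HasDerivAt (fun x => M.gaussValue P t x z) Um m ∧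
        HasDerivWithinAt (fun y => M.gaussValue P t m y) Uz (Set.Ici 0) z ∧
        Ut + z + m ^ 2 - M.θ * m * Um + (M.b ^ 2 - 2 * M.θ * z) * Uz
          - 1 / (4 * M.C) * Um ^ 2 = 0) ∧
    -- the condition at the observation times
    (∀ j : Fin n, ∀ m z : ℝ, 0 ≤ z →
      Integrable (fun w => M.gaussValue P (M.obsTime j) (m + z / √(z + M.ε ^ 2) * w)
        (z * M.ε ^ 2 / (z + M.ε ^ 2)) * gaussianPDFReal 0 1 w) ∧
      Tendsto (fun t => M.gaussValue P t m z) (𝓝[<] M.obsTime j)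
        (𝓝 (∫ w, M.gaussValue P (M.obsTime j) (m + z / √(z + M.ε ^ 2) * w)
          (z * M.ε ^ 2 / (z + M.ε ^ 2)) * gaussianPDFReal 0 1 w))) ∧
    -- the terminal condition, which is attained continuously
    (∀ m z : ℝ, 0 ≤ z → M.gaussValue P M.horizon m z = m ^ 2 + z ∧
      Tendsto (fun t => M.gaussValue P t m z) (𝓝[<] M.horizon) (𝓝 (m ^ 2 + z))) := by
  have hval : ∀ i ≤ n, ∀ s ∈ Set.Ico (M.timeNat i) (M.timeNat (i + 1)), ∀ m z : ℝ, 0 ≤ z →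
      M.gaussValue P s m z = M.gaussCost i s m z := fun i hi s hs m z hz => by
    rw [OUModel.gaussValue,
      OUModel.value_gaussianLaw hC hε htime hU hZ hU_law hZ_law h_indep hi hs m hz,
      ENNReal.toReal_ofReal (OUModel.gaussCost_nonneg hC hε htime hs.2.le m hz)]
  have hlim : ∀ i ≤ n, ∀ m z : ℝ, 0 ≤ z →
      Tendsto (fun t => M.gaussValue P t m z) (𝓝[<] M.timeNat (i + 1))
        (𝓝 (riccati M.θ M.C (M.horizon - M.timeNat (i + 1)) * m ^ 2 +
          M.priorCost (i + 1) z)) := fun i hi m z hz => by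
    refine (OUModel.tendsto_gaussCost hC hε htime i m hz).congr' ?_
    filter_upwards [Ioo_mem_nhdsLT (OUModel.timeNat_lt htime (Nat.lt_succ_self i) (by omega))]
      with t ht
    exact (hval i hi t ⟨ht.1.le, ht.2⟩ m z hz).symm
  refine ⟨fun t ht m z hz => ?_, fun i t ht m z hz => ?_, fun j m z hz => ?_, fun m z hz => ⟨?_, ?_⟩⟩
  · rcases ht.2.eq_or_lt with rfl | htT
    · rw [OUModel.value_horizon hC hε htime m hz]
      exact ENNReal.ofReal_ne_top
    · obtain ⟨i, hi, hti⟩ := OUModel.exists_timeNat_mem (htime_zero.trans_le ht.1) htT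
      rw [OUModel.value_gaussianLaw hC hε htime hU hZ hU_law hZ_law h_indep hi hti m hz]
      exact ENNReal.ofReal_ne_top
  · rw [OUModel.timeNat_castSucc, OUModel.timeNat_succ] at ht ⊢
    have hi : (i : ℕ) ≤ n := Nat.le_of_lt_succ i.2
    obtain ⟨Ut, Um, Uz, h1, h2, h3, h4⟩ := OUModel.gaussCost_hjb hC hε htime ht m hz
    refine ⟨Ut, Um, Uz, ?_, ?_, ?_, h4⟩
    · exact h1.congr_of_mem (fun r hr => hval i hi r hr m z hz) ht
    · rwa [show (fun x => M.gaussValue P t x z) = fun x => M.gaussCost i t x z from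
        funext fun x => hval i hi t ht x z hz]
    · exact h3.congr_of_mem (fun y hy => hval i hi t ht m y hy) hz
  · have hmem : M.timeNat (j + 1) ∈ Set.Ico (M.timeNat (j + 1)) (M.timeNat (j + 1 + 1)) :=
      ⟨le_rfl, OUModel.timeNat_lt htime (Nat.lt_succ_self _) (by omega)⟩
    -- At the observation time the closed form is that of the interval to its right; its average
    -- agrees with the left limit from the interval before.
    have hv := fun x => hval (j + 1) j.2 _ hmem x _ (OUModel.posterior_nonneg hε hz)
    obtain ⟨h1, h2⟩ := OUModel.integral_gaussCost (M := M) hε j.2 m hz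
    rw [OUModel.obsTime_eq]
    simp only [hv]
    refine ⟨h1, ?_⟩
    rw [h2]
    exact hlim j j.2.le m z hz
  · rw [OUModel.gaussValue, OUModel.value_horizon hC hε htime m hz,
      ENNReal.toReal_ofReal (by positivity)]
  · have := hlim n le_rfl m z hz
    rwa [← OUModel.horizon_eq, sub_self, riccati_zero, one_mul, OUModel.priorCost_last] at this
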